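/- Let $\overline{\mathbb C}$ be the Riemann sphere, $\overline{\mathbb R}=\mathbb R\cup\{\infty\}\subset\overline{\mathbb C}$. A surface spread over the sphere is a pair $(X,\psi)$ where $X$ is a topological surface and $\psi:X\to\overline{\mathbb C}$ is continuous, open and discrete; $X$ carries the pull-back complex structure, the unique one for which $\psi$ is holomorphic. An open set $Y\subset X$ is a logarithmic staircase over $a\in\mathbb R$ if for some $c\in\mathbb R$ there is a conformal map $\phi$ of $Y$ onto $\{\operatorname{Re} z<c\}$ with $\psi=a+e^{\phi}$ on $Y$ (so $Y$ is simply connected), and a logarithmic staircase over $\infty$ if it is one over $0$ for $1/\psi$. For a map $f:X\to\overline{\mathbb C}$ and an open set $Y\subset X$, an asymptotic value of $f$ in $Y$ is a limit of $f$ along a curve in $Y$ that tends to infinity in $X$. The map $f$ is cellular on $Y$ if its restriction to $Y$ is continuous, open and discrete and all critical values of $f|_Y$ and all asymptotic values of $f$ in $Y$ lie in $\overline{\mathbb R}$. The pair $(Y,f)$ is a $\cos$-spine in $(X,f)$ if $Y$ is simply connected, $f$ is cellular on $Y$, and $Y\cap f^{-1}(\overline{\mathbb R})$ is a union of infinitely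 many lines $l_0,l_1,l_2,\dots$ such that $l_0$ (the axis of symmetry) has one endpoint on $\partial Y$ and its other end tends to infinity in $X$, each $l_k$ with $k\ge 1$ has two endpoints on $\partial Y$ (distinct as accessible boundary points of $Y$), $l_0$ meets every $l_k$, $k\geq 1$, in exactly one point, and the $l_k$, $k\ge1$, are pairwise disjoint. Theorem. There is a universal constant $K>1$ with the following property. Let $(X,\psi)$ be a surface spread over the sphere, let $Y\subset X$ be a logarithmic staircase over some $a\in\overline{\mathbb R}$, and assume that $\psi$ has no asymptotic value in $Y$ other than $a$ (that is, $X$ contains the whole boundary line of the staircase). Let $z_0\in\partial Y$ with $\psi(z_0)\in\mathbb R$. Then there is a map $\tilde\psi:X\to\overline{\mathbb C}$, $K$-quasiregular for the pull-back structure, such that $\tilde\psi=\psi$ outside $Y$ and $(Y,\tilde\psi)$ is a $\cos$-spine in $(X,\tilde\psi)$ whose axis of symmetry has $z_0$ as its endpoint. If $a\in\mathbb R$, then moreover $\tilde\psi$ has no poles in $Y$, so that $Y\cap\tilde\psi^{-1}(\overline{\mathbb R})=Y\cap\tilde\psi^{-1}(\mathbb R)$. -/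

import Mathlib

open Set Filter Topology MeasureTheory
open scoped ContDiff

noncomputable section

/-! The Riemann sphere is `OnePoint ℂ`. -/

/-- The extended real line in the Riemann sphere. -/
def extendedReals : Set (OnePoint ℂ) :=
  insert OnePoint.infty (range fun x : ℝ => ((x : ℂ) : OnePoint ℂ))

/-- The affine coordinate on the sphere (meaningful away from `∞`, where it takes the value `0`). -/
def affineCoord (p : OnePoint ℂ) : ℂ := p.elim 0 id

open Classical in
/-- The inversion `w ↦ 1 / w` of the Riemann sphere, interchanging `0` and `∞`. -/
def sphereInv (p : OnePoint ℂ) : OnePoint ℂ :=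
  if p = OnePoint.infty then ((0 : ℂ) : OnePoint ℂ)
  else if p = ((0 : ℂ) : OnePoint ℂ) then OnePoint.infty
  else (((affineCoord p)⁻¹ : ℂ) : OnePoint ℂ)

/-! ### Surfaces spread over the sphere -/

/-- `(X, ψ)` is a surface spread over the sphere: the projection `ψ` of the topological surface `X`
is continuous, open and discrete (every fibre is a discrete subset of `X`). -/
structure IsSurfaceSpread {X : Type*} [TopologicalSpace X] (ψ : X → OnePoint ℂ) : Prop where
  continuous : Continuous ψ
  isOpenMap : IsOpenMap ψ
  discrete : ∀ p, IsDiscrete (ψ ⁻¹' {p})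

/-- A map from an open set `U` of the plane to the Riemann sphere is holomorphic. -/
structure IsHolomorphicToSphere (g : ℂ → OnePoint ℂ) (U : Set ℂ) : Prop where
  continuousOn : ContinuousOn g U
  affine : DifferentiableOn ℂ (fun z => affineCoord (g z)) {z ∈ U | g z ≠ OnePoint.infty}
  atInfty : DifferentiableOn ℂ (fun z => affineCoord (sphereInv (g z)))
    {z ∈ U | g z ≠ ((0 : ℂ) : OnePoint ℂ)}

/-- `e` is a chart of the pull-back complex structure on the surface spread over the sphere
`(X, ψ)`, that is, of the unique complex structure for which `ψ` is holomorphic: its charts are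
exactly the homeomorphisms between open sets of `X` and of `ℂ` in which `ψ` is holomorphic. -/
def IsPullbackChart {X : Type*} [TopologicalSpace X] (ψ : X → OnePoint ℂ)
    (e : OpenPartialHomeomorph X ℂ) : Prop :=
  IsHolomorphicToSphere (fun z => ψ (e.symm z)) e.target

/-! ### Quasiregular maps -/

/-- On the open set `U` of the plane, `h` is a weak directional derivative of `g` in the
direction `v`, tested against real smooth functions with compact support in `U`. -/
def IsWeakDerivOn (g h : ℂ → ℂ) (v : ℂ) (U : Set ℂ) : Prop :=
  ∀ θ : ℂ → ℝ, ContDiff ℝ ∞ θ → HasCompactSupport θ → tsupport θ ⊆ U →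
    ∫ z, (fderiv ℝ θ z v : ℂ) * g z = - ∫ z, (θ z : ℂ) * h z

/-- `g` is `K`-quasiregular on the open set `U` of the plane: it is continuous, has weak first
partial derivatives `gx`, `gy` in `L²_loc(U)`, and `|∂g/∂z̄| ≤ (K - 1) / (K + 1) |∂g/∂z|` almost
everywhere in `U` (equivalently `‖Dg‖² ≤ K J_g` almost everywhere). -/
def IsQuasiregularOn (K : ℝ) (g : ℂ → ℂ) (U : Set ℂ) : Prop :=
  ContinuousOn g U ∧ ∃ gx gy : ℂ → ℂ,
    IsWeakDerivOn g gx 1 U ∧ IsWeakDerivOn g gy Complex.I U ∧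
    (∀ C, IsCompact C → C ⊆ U →
      MemLp gx 2 (volume.restrict C) ∧ MemLp gy 2 (volume.restrict C)) ∧
    ∀ᵐ z ∂(volume.restrict U),
      ‖(gx z + Complex.I * gy z) / 2‖ ≤ (K - 1) / (K + 1) * ‖(gx z - Complex.I * gy z) / 2‖

/-- `f : X → OnePoint ℂ` is `K`-quasiregular for the pull-back complex structure of `(X, ψ)`: it
is continuous, and in every chart of that structure it is `K`-quasiregular in the coordinate `w` of
the sphere away from `∞`, and in the coordinate `1 / w` away from `0`. -/
def IsQuasiregularMap {X : Type*} [TopologicalSpace X] (K : ℝ) (ψ f : X → OnePoint ℂ) : Prop :=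
  Continuous f ∧ ∀ e : OpenPartialHomeomorph X ℂ, IsPullbackChart ψ e →
    IsQuasiregularOn K (fun z => affineCoord (f (e.symm z)))
      {z ∈ e.target | f (e.symm z) ≠ OnePoint.infty} ∧
    IsQuasiregularOn K (fun z => affineCoord (sphereInv (f (e.symm z))))
      {z ∈ e.target | f (e.symm z) ≠ ((0 : ℂ) : OnePoint ℂ)}

/-! ### Logarithmic staircases -/

/-- `Y` is a logarithmic staircase over the real number `a`: for some real `c` there is a
conformal map `φ` of the open set `Y` onto the half-plane `Re z < c` with `ψ = a + e^φ` on `Y`.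
(A homeomorphism `φ` with this property is conformal for the pull-back structure, since
`ψ ∘ φ⁻¹ = a + exp` is holomorphic; and `Y` is then simply connected.) -/
def IsLogStaircaseOverReal {X : Type*} [TopologicalSpace X] (ψ : X → OnePoint ℂ) (Y : Set X)
    (a : ℝ) : Prop :=
  ∃ (c : ℝ) (φ : OpenPartialHomeomorph X ℂ), φ.source = Y ∧ φ.target = {z : ℂ | z.re < c} ∧
    ∀ x ∈ Y, ψ x = (((a : ℂ) + Complex.exp (φ x) : ℂ) : OnePoint ℂ)

/-- `Y` is a logarithmic staircase over the point `a` of the extended real line. Over `∞` this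
means that it is one over `0` for the projection `1 / ψ`. -/
def IsLogStaircase {X : Type*} [TopologicalSpace X] (ψ : X → OnePoint ℂ) (Y : Set X)
    (a : OnePoint ℂ) : Prop :=
  (∃ r : ℝ, a = ((r : ℂ) : OnePoint ℂ) ∧ IsLogStaircaseOverReal ψ Y r) ∨
  (a = OnePoint.infty ∧ IsLogStaircaseOverReal (fun x => sphereInv (ψ x)) Y 0)

/-! ### Cellular maps and cos-spines -/

/-- `x` is a critical point of `f`: the local degree of `f` at `x` is not one, that is, `f` is not
injective near `x`. -/
def IsCriticalPt {X : Type*} [TopologicalSpace X] (f : X → OnePoint ℂ) (x : X) : Prop :=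
  ¬ ∃ U ∈ 𝓝 x, InjOn f U

/-- `p` is an asymptotic value of `f` in the part `Y` of the surface `X`: some curve in `Y` tends to
infinity in `X` (it leaves every compact subset of `X`), and `f` tends to `p` along it. -/
def IsAsymptoticValueIn {X : Type*} [TopologicalSpace X] (f : X → OnePoint ℂ) (Y : Set X)
    (p : OnePoint ℂ) : Prop :=
  ∃ γ : ℝ → X, ContinuousOn γ (Ici 0) ∧ (∀ t ∈ Ici (0 : ℝ), γ t ∈ Y) ∧
    Tendsto γ atTop (cocompact X) ∧ Tendsto (fun t => f (γ t)) atTop (𝓝 p)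

/-- `f` is cellular on the open part `Y` of the surface `X`: on `Y` it is continuous, open and
discrete, and its critical and asymptotic values in `Y` lie on the extended real line. -/
structure IsCellularOn {X : Type*} [TopologicalSpace X] (f : X → OnePoint ℂ) (Y : Set X) :
    Prop where
  continuousOn : ContinuousOn f Y
  isOpenMap : ∀ U, U ⊆ Y → IsOpen U → IsOpen (f '' U)
  discrete : ∀ p, IsDiscrete (Y ∩ f ⁻¹' {p})
  critical : ∀ x ∈ Y, IsCriticalPt f x → f x ∈ extendedReals
  asymptotic : ∀ p, IsAsymptoticValueIn f Y p → p ∈ extendedReals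

/-- `(Y, f)` is a cos-spine in `(X, f)`, and `l 0, l 1, l 2, …` are (parametrisations by `ℝ` of) the
lines whose union is its net, the preimage of the extended real line in `Y`. The line `l 0` is the
axis of symmetry. -/
structure IsCosSpine {X : Type*} [TopologicalSpace X] (f : X → OnePoint ℂ) (Y : Set X)
    (l : ℕ → ℝ → X) : Prop where
  isOpen : IsOpen Y
  simplyConnected : SimplyConnectedSpace Y
  cellular : IsCellularOn f Y
  continuous : ∀ k, Continuous (l k)
  injective : ∀ k, Function.Injective (l k)
  net : Y ∩ f ⁻¹' extendedReals = ⋃ k, range (l k)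
  /-- The axis has exactly one endpoint on `∂Y`; its other end tends to infinity in `X`. -/
  axis : (∃ p ∈ frontier Y, Tendsto (l 0) atBot (𝓝 p)) ∧ Tendsto (l 0) atTop (cocompact X)
  /-- All other lines have two endpoints on `∂Y`. The two are distinct as accessible boundary points
  of `Y`: if they are the same point `p` of `X`, then the two ends approach `p` through different
  components of `U ∩ Y` for some neighbourhood `U` of `p`. -/
  endpoints : ∀ k, k ≠ 0 → ∃ p ∈ frontier Y, ∃ q ∈ frontier Y,
    Tendsto (l k) atBot (𝓝 p) ∧ Tendsto (l k) atTop (𝓝 q) ∧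
    (p = q → ∃ U ∈ 𝓝 p, ∀ᶠ s in atBot, ∀ᶠ t in atTop, ¬ JoinedIn (U ∩ Y) (l k s) (l k t))
  axis_inter : ∀ k, k ≠ 0 → ∃ x, range (l 0) ∩ range (l k) = {x}
  disjoint : ∀ j k, j ≠ 0 → k ≠ 0 → j ≠ k → Disjoint (range (l j)) (range (l k))

end

noncomputable section

/-! ### The model map on the left half-plane -/

/-! The staircase is filled with one explicit quasiregular map of the left half-plane. Write `z = -t
+ iy`, let `ρ = foldWidth t`, `N = |ρ + iy|` and `τ = t - ρ + N`, and put `F = e^{-(t+ρ)} (cos τ +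
((ρ + iy)/N) sin τ)`; this is `spineMap`. For `t = 0` one has `ρ = 0` and `τ = |y|`, so `F =
e^{iy}`, as for the exponential. The imaginary part of `F` vanishes exactly where `y = 0` or `sin τ
= 0`, that is, on the negative half-axis and on the arcs `τ = kπ`, `k ≥ 1`, which run from `-ikπ` to
`ikπ` and cross the axis at `-kπ`. This is the net of a cos-spine.

The width `ρ` has slope 1 at `t = 0`, so that `F` is `1 + z` to first order at the corner `z = 0`,
and it is constant for `t ≥ 1`. Because of this the squared size of the differential is at most 1216
times the Jacobian, and the Jacobian vanishes only at the points `-kπ` (`spineMap_estimates`). These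
critical points are isolated in their fibres, so `F` is open and discrete.

Gluing: the differential of `F` is bounded, hence `|F - exp| ≤ 23 |Re z|`. If `ζ` is the point of
the boundary line which corresponds to `z₀`, the map equal to `r + e^ζ F(φ - ζ)` in `Y` and to `ψ`
elsewhere is therefore continuous, and locally Lipschitz in charts. A locally Lipschitz map has its
almost everywhere derivatives as weak derivatives. The frontier of `Y` lies over the circle `|w - r|
= e^c`, so it is a null set in charts, and the Beltrami inequality is needed only off the frontier.
Since `ψ z₀` is real, so is `e^ζ`, and the net of the new map is the net of `F`.

Two facts about the surface carry the topology. The coordinate `φ` is locally bounded on `X`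
(`IsStaircaseChart.locally_bounded`), because a compact set meets only finitely many sheets of `Y`.
The inverse of `φ` extends continuously to the boundary line
(`IsStaircaseChart.exists_tendsto_symm`), because a path towards that line has a limit value other
than `r` and so cannot leave `X`. Thus a curve in `Y` which tends to infinity in `X` has unbounded
coordinate; if the new map has a limit along it, the curve cannot eventually avoid the net, and the
limit is in the extended real line. The case `a = ∞` reduces to `a = 0` by the inversion of the
sphere. -/

/-- The half-width of the fold along the axis, at distance `t` from the boundary. -/
def foldWidth (t : ℝ) : ℝ := (1 - max (1 - t) 0 ^ 2) / 2

/-- Its derivative. -/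
def foldSlope (t : ℝ) : ℝ := max (1 - t) 0

/-- The distance in the folded coordinates. -/
def foldNorm (t y : ℝ) : ℝ := √(foldWidth t ^ 2 + y ^ 2)

/-- The argument of the model map up to folding. -/
def foldAngle (t y : ℝ) : ℝ := t - foldWidth t + foldNorm t y

/-- The unit vector `(ρ + iy)/N` multiplying `sin τ` turns from `±i` on the boundary line to `1` on
the axis. At `t = y = 0` the quotients are `0/0 = 0`, which is harmless because `sin τ = 0` there.
-/
def spineRe (t y : ℝ) : ℝ :=
  Real.exp (-(t + foldWidth t)) *
    (Real.cos (foldAngle t y) + foldWidth t / foldNorm t y * Real.sin (foldAngle t y))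

def spineIm (t y : ℝ) : ℝ :=
  Real.exp (-(t + foldWidth t)) * (y / foldNorm t y * Real.sin (foldAngle t y))

/-- The model of a cos-spine: a quasiregular map of the left half-plane which agrees with `exp` on
the imaginary axis. -/
def spineMap (z : ℂ) : ℂ := ⟨spineRe (-z.re) z.im, spineIm (-z.re) z.im⟩

/-- Squaring removes the corner of the positive part, so `foldWidth` is continuously differentiable
across `t = 1`. -/
theorem hasDerivAt_max_zero_sq (x : ℝ) : HasDerivAt (fun x : ℝ => max x 0 ^ 2) (2 * max x 0) x := by
  rcases lt_trichotomy x 0 with h | h | h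
  · rw [max_eq_right h.le, mul_zero]
    refine (hasDerivAt_const x (0 : ℝ)).congr_of_eventuallyEq ?_
    filter_upwards [eventually_lt_nhds h] with y hy
    simp [max_eq_right hy.le]
  · subst h
    simp only [max_self, mul_zero]
    rw [hasDerivAt_iff_isLittleO]
    simp only [max_self, sub_zero, smul_zero, ne_eq, OfNat.ofNat_ne_zero, not_false_eq_true,
      zero_pow]
    refine Asymptotics.IsBigO.trans_isLittleO (g := fun y : ℝ => y ^ 2) ?_ ?_
    · refine Asymptotics.IsBigO.of_bound 1 (Eventually.of_forall fun y => ?_)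
      rw [one_mul, norm_pow, norm_pow]
      gcongr
      rcases le_total y 0 with hy | hy <;> simp [hy]
    · have := Asymptotics.isLittleO_pow_id (𝕜 := ℝ) (n := 2) (by norm_num)
      simpa using this
  · rw [max_eq_left h.le]
    have := hasDerivAt_pow 2 x
    simp only [Nat.cast_ofNat, Nat.add_one_sub_one, pow_one] at this
    refine this.congr_of_eventuallyEq ?_
    filter_upwards [eventually_gt_nhds h] with y hy
    simp [max_eq_left hy.le]

theorem hasDerivAt_foldWidth (t : ℝ) : HasDerivAt foldWidth (foldSlope t) t := by
  have h1 : HasDerivAt (fun t : ℝ => 1 - t) (-1) t := by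
    simpa using (hasDerivAt_id t).const_sub 1
  have := (((hasDerivAt_max_zero_sq (1 - t)).comp t h1).const_sub 1).div_const 2
  refine this.congr_deriv ?_
  unfold foldSlope
  ring

theorem continuous_foldSlope : Continuous foldSlope := by
  unfold foldSlope; fun_prop

theorem contDiff_foldWidth : ContDiff ℝ 1 foldWidth := by
  rw [contDiff_one_iff_deriv]
  refine ⟨fun t => (hasDerivAt_foldWidth t).differentiableAt, ?_⟩
  have : deriv foldWidth = foldSlope := funext fun t => (hasDerivAt_foldWidth t).deriv
  rw [this]
  exact continuous_foldSlope

theorem continuous_foldWidth : Continuous foldWidth := contDiff_foldWidth.continuous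

theorem foldSlope_nonneg (t : ℝ) : 0 ≤ foldSlope t := le_max_right _ _

theorem foldSlope_le_one {t : ℝ} (ht : 0 ≤ t) : foldSlope t ≤ 1 := by
  unfold foldSlope; simp [ht]

theorem foldWidth_of_le {t : ℝ} (ht : t ≤ 1) : foldWidth t = t - t ^ 2 / 2 := by
  unfold foldWidth; rw [max_eq_left (by linarith)]; ring

theorem foldWidth_of_ge {t : ℝ} (ht : 1 ≤ t) : foldWidth t = 1 / 2 := by
  unfold foldWidth; rw [max_eq_right (by linarith)]; norm_num

theorem foldSlope_of_le {t : ℝ} (ht : t ≤ 1) : foldSlope t = 1 - t := by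
  unfold foldSlope; rw [max_eq_left (by linarith)]

theorem foldSlope_of_ge {t : ℝ} (ht : 1 ≤ t) : foldSlope t = 0 := by
  unfold foldSlope; rw [max_eq_right (by linarith)]

theorem foldWidth_zero : foldWidth 0 = 0 := by simp [foldWidth]

theorem foldWidth_le (t : ℝ) : foldWidth t ≤ t := by
  rcases le_total t 1 with h | h
  · rw [foldWidth_of_le h]; nlinarith [sq_nonneg t]
  · rw [foldWidth_of_ge h]; linarith

theorem foldWidth_pos {t : ℝ} (ht : 0 < t) : 0 < foldWidth t := by
  rcases le_total t 1 with h | h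
  · rw [foldWidth_of_le h]; nlinarith
  · rw [foldWidth_of_ge h]; norm_num

theorem foldWidth_le_half (t : ℝ) : foldWidth t ≤ 1 / 2 := by
  unfold foldWidth; nlinarith [sq_nonneg (max (1 - t) 0)]

theorem foldNorm_sq (t y : ℝ) : foldNorm t y ^ 2 = foldWidth t ^ 2 + y ^ 2 :=
  Real.sq_sqrt (by positivity)

theorem foldNorm_pos {t : ℝ} (ht : 0 < t) (y : ℝ) : 0 < foldNorm t y := by
  have := foldWidth_pos ht
  unfold foldNorm; positivity

theorem foldWidth_le_foldNorm (t y : ℝ) : foldWidth t ≤ foldNorm t y :=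
  Real.le_sqrt_of_sq_le (by nlinarith [sq_nonneg y])

theorem abs_le_foldNorm (t y : ℝ) : |y| ≤ foldNorm t y :=
  Real.le_sqrt_of_sq_le (by rw [sq_abs]; nlinarith [sq_nonneg (foldWidth t)])

theorem foldNorm_zero_left (y : ℝ) : foldNorm 0 y = |y| := by
  simp [foldNorm, foldWidth_zero, Real.sqrt_sq_eq_abs]

theorem foldNorm_zero_right {t : ℝ} (ht : 0 < t) : foldNorm t 0 = foldWidth t := by
  simp [foldNorm, Real.sqrt_sq_eq_abs, abs_of_pos (foldWidth_pos ht)]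

theorem foldAngle_zero_right {t : ℝ} (ht : 0 < t) : foldAngle t 0 = t := by
  simp [foldAngle, foldNorm_zero_right ht]

theorem le_foldAngle (t y : ℝ) : t ≤ foldAngle t y := by
  have := foldWidth_le_foldNorm t y
  unfold foldAngle; linarith

theorem abs_le_foldAngle (t y : ℝ) : |y| ≤ foldAngle t y := by
  have := abs_le_foldNorm t y
  have := foldWidth_le t
  unfold foldAngle; linarith

theorem continuous_foldAngle : Continuous fun p : ℝ × ℝ => foldAngle p.1 p.2 := by
  have := continuous_foldWidth
  unfold foldAngle foldNorm
  fun_prop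

/-! ### Partial derivatives of the model map -/

theorem hasDerivAt_foldNorm_left {t : ℝ} (ht : 0 < t) (y : ℝ) :
    HasDerivAt (fun t => foldNorm t y) (foldSlope t * (foldWidth t / foldNorm t y)) t := by
  have hN := foldNorm_pos ht y
  have h := (((hasDerivAt_foldWidth t).pow 2).add_const (y ^ 2)).sqrt
    (by have := foldWidth_pos ht; simp; positivity)
  refine h.congr_deriv ?_
  simp only [Pi.pow_apply]
  change _ / (2 * foldNorm t y) = _
  field_simp
  norm_num
  ring

theorem hasDerivAt_foldNorm_right {t : ℝ} (ht : 0 < t) (y : ℝ) :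
    HasDerivAt (fun y => foldNorm t y) (y / foldNorm t y) y := by
  have hN := foldNorm_pos ht y
  have h := ((hasDerivAt_pow 2 y).const_add (foldWidth t ^ 2)).sqrt
    (by have := foldWidth_pos ht; positivity)
  refine h.congr_deriv ?_
  change _ / (2 * foldNorm t y) = _
  field_simp
  simp

theorem hasDerivAt_foldAngle_left {t : ℝ} (ht : 0 < t) (y : ℝ) : HasDerivAt (fun t => foldAngle t y)
    (1 - foldSlope t * (1 - foldWidth t / foldNorm t y)) t := by
  have h := ((hasDerivAt_id t).sub (hasDerivAt_foldWidth t)).add (hasDerivAt_foldNorm_left ht y)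
  refine h.congr_deriv ?_
  ring

theorem hasDerivAt_foldAngle_right {t : ℝ} (ht : 0 < t) (y : ℝ) : HasDerivAt (fun y => foldAngle t y) (y / foldNorm t y) y :=
  (hasDerivAt_foldNorm_right ht y).const_add (t - foldWidth t)

theorem hasDerivAt_exp_left (t : ℝ) : HasDerivAt (fun t => Real.exp (-(t + foldWidth t)))
    (Real.exp (-(t + foldWidth t)) * -(1 + foldSlope t)) t :=
  ((hasDerivAt_id t).add (hasDerivAt_foldWidth t)).neg.exp

/-- `∂/∂t` of `exp (t + foldWidth t) * spineRe`, up to the derivative of the first factor. -/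
theorem hasDerivAt_spineRe_left {t : ℝ} (ht : 0 < t) (y : ℝ) : HasDerivAt (fun t => spineRe t y)
    (Real.exp (-(t + foldWidth t)) *
      (-(1 + foldSlope t) *
        (Real.cos (foldAngle t y) + foldWidth t / foldNorm t y * Real.sin (foldAngle t y))
      + (1 - foldSlope t * (1 - foldWidth t / foldNorm t y)) *
        (-Real.sin (foldAngle t y) + foldWidth t / foldNorm t y * Real.cos (foldAngle t y))
      + (y / foldNorm t y) ^ 2 * foldSlope t / foldNorm t y * Real.sin (foldAngle t y))) t := by
  have hN := foldNorm_pos ht y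
  have hN2 := foldNorm_sq t y
  have hτ := hasDerivAt_foldAngle_left ht y
  have hr := (hasDerivAt_foldWidth t).div (hasDerivAt_foldNorm_left ht y) hN.ne'
  have h := (hasDerivAt_exp_left t).mul (hτ.cos.add (hr.mul hτ.sin)) (x := t)
  refine h.congr_deriv ?_
  simp only [Pi.div_apply, Pi.add_apply, Pi.mul_apply]
  generalize foldAngle t y = τ at *
  generalize foldNorm t y = N at *
  generalize foldWidth t = ρ at *
  have hy : y ^ 2 = N ^ 2 - ρ ^ 2 := by linarith
  rw [div_pow, hy]
  field_simp
  ring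

theorem hasDerivAt_spineIm_left {t : ℝ} (ht : 0 < t) (y : ℝ) : HasDerivAt (fun t => spineIm t y)
    (Real.exp (-(t + foldWidth t)) *
      (-(1 + foldSlope t) * (y / foldNorm t y * Real.sin (foldAngle t y))
      + (1 - foldSlope t * (1 - foldWidth t / foldNorm t y)) *
        (y / foldNorm t y * Real.cos (foldAngle t y))
      - foldWidth t / foldNorm t y * (y / foldNorm t y) * foldSlope t / foldNorm t y *
        Real.sin (foldAngle t y))) t := by
  have hN := foldNorm_pos ht y
  have hN2 := foldNorm_sq t y
  have hτ := hasDerivAt_foldAngle_left ht y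
  have hr := (hasDerivAt_const t y).div (hasDerivAt_foldNorm_left ht y) hN.ne'
  have h := (hasDerivAt_exp_left t).mul (hr.mul hτ.sin) (x := t)
  refine h.congr_deriv ?_
  simp only [Pi.div_apply, Pi.mul_apply]
  generalize foldAngle t y = τ at *
  generalize foldNorm t y = N at *
  generalize foldWidth t = ρ at *
  field_simp
  ring

theorem hasDerivAt_spineRe_right {t : ℝ} (ht : 0 < t) (y : ℝ) : HasDerivAt (fun y => spineRe t y)
    (Real.exp (-(t + foldWidth t)) *
      (y / foldNorm t y *
        (-Real.sin (foldAngle t y) + foldWidth t / foldNorm t y * Real.cos (foldAngle t y))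
      - y / foldNorm t y * (foldWidth t / foldNorm t y) / foldNorm t y *
        Real.sin (foldAngle t y))) y := by
  have hN := foldNorm_pos ht y
  have hτ := hasDerivAt_foldAngle_right ht y
  have hr := (hasDerivAt_const y (foldWidth t)).div (hasDerivAt_foldNorm_right ht y) hN.ne'
  have h := (hτ.cos.add (hr.mul hτ.sin)).const_mul (Real.exp (-(t + foldWidth t)))
  refine h.congr_deriv ?_
  simp only [Pi.div_apply]
  generalize foldAngle t y = τ at *
  generalize foldNorm t y = N at *
  generalize foldWidth t = ρ at *
  field_simp
  ring

theorem hasDerivAt_spineIm_right {t : ℝ} (ht : 0 < t) (y : ℝ) : HasDerivAt (fun y => spineIm t y)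
    (Real.exp (-(t + foldWidth t)) *
      (y / foldNorm t y * (y / foldNorm t y * Real.cos (foldAngle t y))
      + (foldWidth t / foldNorm t y) ^ 2 / foldNorm t y * Real.sin (foldAngle t y))) y := by
  have hN := foldNorm_pos ht y
  have hN2 := foldNorm_sq t y
  have hτ := hasDerivAt_foldAngle_right ht y
  have hr := (hasDerivAt_id y).div (hasDerivAt_foldNorm_right ht y) hN.ne'
  have h := (hr.mul hτ.sin).const_mul (Real.exp (-(t + foldWidth t)))
  refine h.congr_deriv ?_
  simp only [Pi.div_apply, id]
  generalize foldAngle t y = τ at *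
  generalize foldNorm t y = N at *
  generalize foldWidth t = ρ at *
  have hy : ρ ^ 2 = N ^ 2 - y ^ 2 := by linarith
  rw [div_pow ρ, hy]
  field_simp
  ring

/-! ### Bounds for the differential and the Jacobian of the model map -/

/-- Here `c`, `σ` stand for the cosine and sine of the fold angle, `r = ρ/N`, `s = y/N`, `m =
foldSlope t` and `w = σ/N`. The factors on the left are the partial derivatives of the model without
the exponential; the right side is their determinant reduced modulo the two relations. -/
theorem spine_jacobian_eq {c σ r s m w : ℝ} (h1 : c ^ 2 + σ ^ 2 = 1) (h2 : r ^ 2 + s ^ 2 = 1) :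
    (s * (-σ + r * c) - s * r * w) * (-(1 + m) * (s * σ) + (1 - m * (1 - r)) * (s * c) - r * s * m * w)
      - (-(1 + m) * (c + r * σ) + (1 - m * (1 - r)) * (-σ + r * c) + s ^ 2 * m * w)
        * (s * (s * c) + r ^ 2 * w)
    = s ^ 2 * (1 + m) + w * c * (m * (r ^ 2 + r - 1) - r * (1 - r))
      + σ * w * r * (1 + r + m * (2 - r)) := by
  have hs : s ^ 2 = 1 - r ^ 2 := by linarith
  have hc : c ^ 2 = 1 - σ ^ 2 := by linarith
  have e1 : s ^ 4 = (1 - r ^ 2) ^ 2 := by rw [← hs]; ring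
  ring_nf
  simp only [hs, hc, e1]
  ring

/-- The range `t ≥ 1`: the slope is 0 and `ρ = 1/2`, so `σ/N = 2rσ`. Near a critical point energy
and Jacobian both degenerate like `s² + σ²`, so each is compared with this quantity: the energy is
at most `22 (s² + σ²)`, and `88 = 22 · 4`. -/
theorem spine_bound_outer {c σ r s w : ℝ} (h1 : c ^ 2 + σ ^ 2 = 1) (h2 : r ^ 2 + s ^ 2 = 1)
    (hr : 0 ≤ r) (hw : w = 2 * r * σ) :
    (-(c + r * σ) + (-σ + r * c)) ^ 2 + (-(s * σ) + s * c) ^ 2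
      + (s * (-σ + r * c) - s * r * w) ^ 2 + (s * (s * c) + r ^ 2 * w) ^ 2
    ≤ 88 * (s ^ 2 - w * c * (r * (1 - r)) + σ * w * r * (1 + r)) ∧
    s ^ 2 + σ ^ 2 ≤ 4 * (s ^ 2 - w * c * (r * (1 - r)) + σ * w * r * (1 + r)) := by
  have hr1 : r ≤ 1 := by nlinarith [sq_nonneg s]
  have hs1 : s ^ 2 ≤ 1 := by nlinarith
  have hσ1 : σ ^ 2 ≤ 1 := by nlinarith [sq_nonneg c]
  have hc1 : c ^ 2 ≤ 1 := by nlinarith [sq_nonneg σ]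
  have hJ : s ^ 2 + σ ^ 2 ≤ 4 * (s ^ 2 - w * c * (r * (1 - r)) + σ * w * r * (1 + r)) := by
    have hcs : σ * c ≤ 1 / 2 := by nlinarith [sq_nonneg (σ - c)]
    -- The only term of indefinite sign is absorbed by `s²`, since `s² = (1 - r)(1 + r)` also
    -- carries the factor `1 - r`.
    have hw' : w * c * (r * (1 - r)) ≤ s ^ 2 / 2 := by
      have : w * c * (r * (1 - r)) = 2 * (σ * c) * (r ^ 2 * (1 - r)) := by rw [hw]; ring
      rw [this]
      have h0 : 0 ≤ r ^ 2 * (1 - r) := mul_nonneg (sq_nonneg _) (by linarith)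
      have : r ^ 2 * (1 - r) ≤ s ^ 2 / 2 := by
        have : s ^ 2 = (1 - r) * (1 + r) := by linarith
        rw [this]
        nlinarith [mul_nonneg (sub_nonneg.2 hr1) hr, mul_nonneg (sub_nonneg.2 hr1) (sub_nonneg.2 hr1), mul_nonneg hr (mul_nonneg (sub_nonneg.2 hr1) (sub_nonneg.2 hr1))]
      nlinarith
    have h3 : 2 * σ ^ 2 * r ^ 2 ≤ σ * w * r * (1 + r) := by
      rw [hw]
      nlinarith [mul_nonneg (sq_nonneg (σ * r)) hr]
    have h4 : s ^ 2 * σ ^ 2 + r ^ 2 * σ ^ 2 = σ ^ 2 := by rw [← add_mul, add_comm (s ^ 2), h2, one_mul]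
    nlinarith [mul_nonneg (sq_nonneg s) (sub_nonneg.2 hσ1), mul_nonneg (sq_nonneg r) (sq_nonneg σ)]
  have e1 : (-(c + r * σ) + (-σ + r * c)) ^ 2 ≤ 2 * s ^ 2 + 8 * σ ^ 2 := by
    have : (-(c + r * σ) + (-σ + r * c)) ^ 2 ≤ 2 * ((1 - r) ^ 2 * c ^ 2) + 2 * ((1 + r) ^ 2 * σ ^ 2) := by
      nlinarith [sq_nonneg ((1 - r) * c - (1 + r) * σ)]
    have h5 : (1 - r) ^ 2 * c ^ 2 ≤ s ^ 2 := by
      have : (1 - r) ^ 2 ≤ s ^ 2 := by nlinarith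
      nlinarith [sq_nonneg (1 - r)]
    have h6 : (1 + r) ^ 2 * σ ^ 2 ≤ 4 * σ ^ 2 := by
      have : (1 + r) ^ 2 ≤ 4 := by nlinarith
      nlinarith [sq_nonneg σ]
    linarith
  have e2 : (-(s * σ) + s * c) ^ 2 ≤ 2 * s ^ 2 := by
    have : (-(s * σ) + s * c) ^ 2 = s ^ 2 * (1 - 2 * (σ * c)) := by rw [← h1]; ring
    rw [this]
    nlinarith [sq_nonneg (σ + c), sq_nonneg s]
  have e3 : (s * (-σ + r * c) - s * r * w) ^ 2 ≤ 16 * s ^ 2 := by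
    have : (s * (-σ + r * c) - s * r * w) ^ 2 = s ^ 2 * (r * c - (1 + 2 * r ^ 2) * σ) ^ 2 := by
      rw [hw]; ring
    rw [this]
    have : (r * c - (1 + 2 * r ^ 2) * σ) ^ 2 ≤ 16 := by
      have hr2 : r ^ 2 ≤ 1 := by nlinarith
      have : (r * c - (1 + 2 * r ^ 2) * σ) ^ 2 ≤ (r ^ 2 + (1 + 2 * r ^ 2) ^ 2) * (c ^ 2 + σ ^ 2) := by
        nlinarith [sq_nonneg (r * σ + (1 + 2 * r ^ 2) * c)]
      rw [h1] at this
      nlinarith [sq_nonneg r]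
    nlinarith [sq_nonneg s]
  have e4 : (s * (s * c) + r ^ 2 * w) ^ 2 ≤ 2 * s ^ 2 + 8 * σ ^ 2 := by
    have h7 : (s * (s * c) + r ^ 2 * w) ^ 2 ≤ 2 * (s ^ 2 * (s ^ 2 * c ^ 2)) + 2 * (r ^ 4 * w ^ 2) := by
      nlinarith [sq_nonneg (s * (s * c) - r ^ 2 * w)]
    have h8 : s ^ 2 * (s ^ 2 * c ^ 2) ≤ s ^ 2 := by
      have : s ^ 2 * c ^ 2 ≤ 1 := by nlinarith [sq_nonneg s, sq_nonneg c]
      nlinarith [sq_nonneg s]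
    have h9 : r ^ 4 * w ^ 2 ≤ 4 * σ ^ 2 := by
      have hr2 : r ^ 6 ≤ 1 := pow_le_one₀ hr hr1
      have : r ^ 4 * w ^ 2 = 4 * (r ^ 6 * σ ^ 2) := by rw [hw]; ring
      rw [this]
      nlinarith [sq_nonneg σ]
    linarith
  exact ⟨by linarith, hJ⟩

/-- The triangle inequality bounds the four partial derivatives by 8, 5, 4 and 3, and `64 + 25 + 16
+ 9 = 114`. -/
theorem spine_bound_inner {c σ r s m w : ℝ} (h1 : c ^ 2 + σ ^ 2 = 1) (h2 : r ^ 2 + s ^ 2 = 1)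
    (hr : 0 ≤ r) (hm : 0 ≤ m) (hm1 : m ≤ 1) (hw : |w| ≤ 2) :
    (-(1 + m) * (c + r * σ) + (1 - m * (1 - r)) * (-σ + r * c) + s ^ 2 * m * w) ^ 2
      + (-(1 + m) * (s * σ) + (1 - m * (1 - r)) * (s * c) - r * s * m * w) ^ 2
      + (s * (-σ + r * c) - s * r * w) ^ 2 + (s * (s * c) + r ^ 2 * w) ^ 2 ≤ 114 := by
  have hr1 : r ≤ 1 := by nlinarith [sq_nonneg s]
  have hs1 : |s| ≤ 1 := by rw [← sq_le_one_iff_abs_le_one]; nlinarith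
  have hσ1 : |σ| ≤ 1 := by rw [← sq_le_one_iff_abs_le_one]; nlinarith [sq_nonneg c]
  have hc1 : |c| ≤ 1 := by rw [← sq_le_one_iff_abs_le_one]; nlinarith [sq_nonneg σ]
  have habs : ∀ {a b A B : ℝ}, |a| ≤ A → |b| ≤ B → |a * b| ≤ A * B := fun {a b A B} h h' => by
    rw [abs_mul]; exact mul_le_mul h h' (abs_nonneg _) ((abs_nonneg _).trans h)
  have hadd : ∀ {a b A B : ℝ}, |a| ≤ A → |b| ≤ B → |a + b| ≤ A + B := fun {a b A B} h h' =>
    (abs_add_le _ _).trans (add_le_add h h')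
  have hsub : ∀ {a b A B : ℝ}, |a| ≤ A → |b| ≤ B → |a - b| ≤ A + B := fun {a b A B} h h' =>
    (abs_sub _ _).trans (add_le_add h h')
  have hra : |r| ≤ 1 := by rwa [abs_of_nonneg hr]
  have hma : |m| ≤ 1 := by rwa [abs_of_nonneg hm]
  have hneg : |-σ| ≤ 1 := by rwa [abs_neg]
  have hm2 : |-(1 + m)| ≤ 2 := by rw [abs_neg, abs_of_nonneg (by linarith)]; linarith
  have hm3 : |1 - m * (1 - r)| ≤ 1 := by
    rw [abs_le]; constructor <;> nlinarith [mul_nonneg hm hr]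
  have hs2 : |s ^ 2| ≤ 1 := by rw [abs_pow]; exact pow_le_one₀ (abs_nonneg _) hs1
  have hr2 : |r ^ 2| ≤ 1 := by rw [abs_pow]; exact pow_le_one₀ (abs_nonneg _) hra
  have e1 := hadd (hadd (habs hm2 (hadd hc1 (habs hra hσ1))) (habs hm3 (hadd hneg (habs hra hc1))))
    (habs (habs hs2 hma) hw)
  have e2 := hsub (hadd (habs hm2 (habs hs1 hσ1)) (habs hm3 (habs hs1 hc1)))
    (habs (habs (habs hra hs1) hma) hw)
  have e3 := hsub (habs hs1 (hadd hneg (habs hra hc1))) (habs (habs hs1 hra) hw)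
  have e4 := hadd (habs hs1 (habs hs1 hc1)) (habs hr2 hw)
  have hsq : ∀ {a A : ℝ}, |a| ≤ A → a ^ 2 ≤ A ^ 2 := fun {a A} h => by
    rw [← sq_abs a]; exact pow_le_pow_left₀ (abs_nonneg _) h 2
  have := hsq e1
  have := hsq e2
  have := hsq e3
  have := hsq e4
  norm_num at *
  linarith

/-- The Jacobian of the model map is bounded from below near the boundary. -/
theorem spine_jacobian_inner {t y : ℝ} (ht : 0 < t) (ht1 : t ≤ 1) {c σ r s m w N τ : ℝ}
    (hN : N = foldNorm t y) (hτ : τ = foldAngle t y) (hc : c = Real.cos τ) (hσ : σ = Real.sin τ)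
    (hr : r = foldWidth t / N) (h2 : r ^ 2 + s ^ 2 = 1) (hm : m = foldSlope t) (hw : w = σ / N) :
    3 / 32 ≤ s ^ 2 * (1 + m) + w * c * (m * (r ^ 2 + r - 1) - r * (1 - r))
      + σ * w * r * (1 + r + m * (2 - r)) := by
  have hN0 : 0 < N := hN ▸ foldNorm_pos ht y
  have hρ := foldWidth_of_le ht1
  have hρ0 := foldWidth_pos ht
  have hρN : foldWidth t ≤ N := hN ▸ foldWidth_le_foldNorm t y
  have hm' : m = 1 - t := hm ▸ foldSlope_of_le ht1
  have hr0 : 0 < r := by rw [hr]; positivity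
  have hr1 : r ≤ 1 := by rw [hr]; exact (div_le_one hN0).2 hρN
  have hτN : τ = N + t ^ 2 / 2 := by rw [hτ, foldAngle, hρ, ← hN]; ring
  have h1 : c ^ 2 + σ ^ 2 = 1 := by rw [hc, hσ]; exact Real.cos_sq_add_sin_sq τ
  have hs : s ^ 2 = (1 - r) * (1 + r) := by linarith
  have hσw : σ * w = σ ^ 2 / N := by rw [hw]; ring
  have hσw0 : 0 ≤ σ * w := by rw [hσw]; positivity
  have hwc : w * c = σ * c / N := by rw [hw]; ring
  -- the main term absorbs the terms which vanish to second order in `s`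
  have hmain : s ^ 2 / 3 ≤ s ^ 2 * (1 + m) - |w * c| * ((1 - r) * (m + r)) := by
    -- For `t ≤ 1/2` one has `N ≥ ρ ≥ 3t/4`, so `t²/2 ≤ N/3` and `τ ≤ 4N/3`. For `t ≥ 1/2` one has
    -- `N ≥ ρ ≥ 3/8`, while `|σ c| ≤ 1/2`.
    have h3 : |σ * c| ≤ 4 / 3 * N := by
      rcases le_total t (1 / 2) with h | h
      · have hσN : |σ| ≤ τ := by
          rw [hσ]; exact Real.abs_sin_le_abs.trans (abs_of_nonneg (by rw [hτN]; positivity)).le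
        have hc1 : |c| ≤ 1 := by rw [hc]; exact Real.abs_cos_le_one _
        rw [abs_mul]
        have : |σ| * |c| ≤ τ := by nlinarith only [abs_nonneg σ, abs_nonneg c, hσN, hc1]
        nlinarith only [this, hτN, h, ht, hρN, hρ]
      · have : |σ * c| ≤ 1 / 2 := abs_le.2 ⟨by nlinarith [sq_nonneg (σ + c)], by nlinarith [sq_nonneg (σ - c)]⟩
        nlinarith only [this, h, ht1, hρN, hρ]
    have h4 : |w * c| ≤ 4 / 3 := by
      rw [hwc, abs_div, abs_of_pos hN0, div_le_iff₀ hN0]; linarith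
    have h5 : (1 - r) * (m + r) ≤ s ^ 2 * (1 - t / 2) := by
      rw [hs, hm']
      have : (1 - t + r) ≤ (1 + r) * (1 - t / 2) := by nlinarith
      nlinarith
    have h6 : 0 ≤ (1 - r) * (m + r) := mul_nonneg (by linarith) (by linarith)
    have h7 : |w * c| * ((1 - r) * (m + r)) ≤ 4 / 3 * (s ^ 2 * (1 - t / 2)) :=
      mul_le_mul h4 h5 h6 (by norm_num)
    rw [hm']
    have h14 := mul_nonneg (sq_nonneg s) (sub_nonneg.2 ht1)
    rw [hm'] at h7
    linarith
  -- Since `m(r² + r - 1) - r(1 - r) = m r² - (1 - r)(m + r)`, `hmain` takes care of the last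
  -- product.
  have hlow : s ^ 2 / 3 + w * c * m * r ^ 2 + σ * w * r ≤
      s ^ 2 * (1 + m) + w * c * (m * (r ^ 2 + r - 1) - r * (1 - r))
      + σ * w * r * (1 + r + m * (2 - r)) := by
    have h8 : w * c * ((1 - r) * (m + r)) ≤ |w * c| * ((1 - r) * (m + r)) :=
      mul_le_mul_of_nonneg_right (le_abs_self _) (mul_nonneg (by linarith) (by linarith))
    have h9 : 0 ≤ (σ * w) * r * (r + m * (2 - r)) :=
      mul_nonneg (mul_nonneg hσw0 hr0.le) (add_nonneg hr0.le (mul_nonneg (by linarith) (by linarith)))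
    linarith
  refine le_trans ?_ hlow
  have hm0 : 0 ≤ m := by linarith
  rcases le_total 1 N with hN1 | hN1
  -- Away from the corner `z = 0` the direction `(r, s)` is nearly vertical, and `s²/3 ≥ 1/4`
  -- outweighs the mixed term.
  · have hr2 : r ≤ 1 / 2 := by
      rw [hr, div_le_iff₀ hN0]; linarith only [foldWidth_le_half t, hN1]
    have hs2 : 3 / 4 ≤ s ^ 2 := by rw [hs]; nlinarith only [hr2, hr0]
    have h10 : |w * c| ≤ 1 / 2 := by
      rw [hwc, abs_div, abs_of_pos hN0, div_le_iff₀ hN0]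
      have : |σ * c| ≤ 1 / 2 := abs_le.2 ⟨by nlinarith only [sq_nonneg (σ + c), h1], by nlinarith only [sq_nonneg (σ - c), h1]⟩
      linarith only [this, hN1]
    have h11 : -(1 / 8) ≤ w * c * m * r ^ 2 := by
      have hr4 : r ^ 2 ≤ 1 / 4 := by nlinarith only [hr2, hr0]
      have hmr : m * r ^ 2 ≤ 1 / 4 := by
        nlinarith only [hr4, hm0, hm', ht, mul_nonneg hm0 (sub_nonneg.2 hr4)]
      have hmr0 : 0 ≤ m * r ^ 2 := by positivity
      have := (abs_le.1 h10).1
      nlinarith only [this, hmr, hmr0]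
    linarith only [mul_nonneg hσw0 hr0.le, h11, hs2]
  -- Near the corner `τ = N + t²/2 ≤ 3/2 < π/2`, so sine and cosine are nonnegative. The last two
  -- terms are then at least `w r² (c m + σ) ≥ (3/32) r²`, which complements `s²/3`.
  · have hpi := Real.pi_gt_three
    have hτ0 : 0 ≤ τ := by rw [hτN]; positivity
    have hτ1 : τ ≤ Real.pi / 2 := by rw [hτN]; nlinarith only [hpi, hN1, ht, ht1]
    have hσ2 : τ / 2 ≤ σ := by
      have := Real.mul_le_sin hτ0 hτ1
      rw [hσ]
      refine le_trans ?_ this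
      have : 1 / 2 ≤ 2 / Real.pi := by
        rw [div_le_div_iff₀ (by norm_num) Real.pi_pos]; linarith [Real.pi_le_four]
      nlinarith only [this, hτ0]
    have hc0 : 0 ≤ c := by
      rw [hc]; exact Real.cos_nonneg_of_neg_pi_div_two_le_of_le (by linarith) hτ1
    have hσ0 : 0 ≤ σ := by linarith
    have hw2 : 1 / 2 ≤ w := by
      rw [hw, le_div_iff₀ hN0]; nlinarith only [hσ2, hτN, sq_nonneg t]
    have hcσ : 1 ≤ c + σ := by nlinarith only [h1, hc0, hσ0]
    have hcm : 3 / 16 ≤ c * m + σ := by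
      rw [hm']
      rcases le_total t (1 / 2) with h | h
      · nlinarith only [hcσ, h, hc0, hσ0]
      · nlinarith only [hσ2, hτN, hρN, hρ, h, ht1, mul_nonneg hc0 (sub_nonneg.2 ht1)]
    have hrr : r ^ 2 ≤ r := by nlinarith only [hr0, hr1]
    have h12 : w * r ^ 2 * (c * m + σ) ≤ w * c * m * r ^ 2 + σ * w * r := by
      have := mul_le_mul_of_nonneg_left hrr hσw0
      linarith only [this]
    have h13 : 1 / 2 * r ^ 2 * (3 / 16) ≤ w * r ^ 2 * (c * m + σ) :=
      mul_le_mul (mul_le_mul_of_nonneg_right hw2 (sq_nonneg r)) hcm (by norm_num) (by positivity)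
    linarith only [h12, h13, h2, sq_nonneg s]

/-- For `t ≤ 1` one has `t - ρ = t²/2 ≤ ρ ≤ N`, hence `τ ≤ 2N`; for `t ≥ 1` one has `N ≥ 1/2`. -/
theorem abs_sin_foldAngle_div_le {t : ℝ} (ht : 0 < t) (y : ℝ) :
    |Real.sin (foldAngle t y) / foldNorm t y| ≤ 2 := by
  have hN0 := foldNorm_pos ht y
  have hρN := foldWidth_le_foldNorm t y
  rw [abs_div, abs_of_pos hN0, div_le_iff₀ hN0]
  rcases le_total t 1 with h | h
  · refine Real.abs_sin_le_abs.trans ?_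
    rw [abs_of_nonneg (ht.le.trans (le_foldAngle t y)), foldAngle]
    rw [foldWidth_of_le h] at *
    nlinarith
  · rw [foldWidth_of_ge h] at hρN
    linarith [Real.abs_sin_le_one (foldAngle t y)]

/-! ### The differential of the model map -/

theorem contDiffAt_spineRe {p : ℝ × ℝ} (hp : foldNorm p.1 p.2 ≠ 0) :
    ContDiffAt ℝ 1 (fun p : ℝ × ℝ => spineRe p.1 p.2) p := by
  have h1 : ContDiffAt ℝ 1 (fun p : ℝ × ℝ => foldWidth p.1) p :=
    contDiff_foldWidth.contDiffAt.comp p contDiffAt_fst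
  have h2 : ContDiffAt ℝ 1 (fun p : ℝ × ℝ => foldNorm p.1 p.2) p := by
    refine ContDiffAt.sqrt ((h1.pow 2).add (contDiffAt_snd.pow 2)) fun h => hp ?_
    rw [foldNorm, h, Real.sqrt_zero]
  have h3 : ContDiffAt ℝ 1 (fun p : ℝ × ℝ => foldAngle p.1 p.2) p :=
    (contDiffAt_fst.sub h1).add h2
  exact (contDiffAt_fst.add h1).neg.exp.mul (h3.cos.add ((h1.div h2 hp).mul h3.sin))

theorem contDiffAt_spineIm {p : ℝ × ℝ} (hp : foldNorm p.1 p.2 ≠ 0) :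
    ContDiffAt ℝ 1 (fun p : ℝ × ℝ => spineIm p.1 p.2) p := by
  have h1 : ContDiffAt ℝ 1 (fun p : ℝ × ℝ => foldWidth p.1) p :=
    contDiff_foldWidth.contDiffAt.comp p contDiffAt_fst
  have h2 : ContDiffAt ℝ 1 (fun p : ℝ × ℝ => foldNorm p.1 p.2) p := by
    refine ContDiffAt.sqrt ((h1.pow 2).add (contDiffAt_snd.pow 2)) fun h => hp ?_
    rw [foldNorm, h, Real.sqrt_zero]
  have h3 : ContDiffAt ℝ 1 (fun p : ℝ × ℝ => foldAngle p.1 p.2) p :=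
    (contDiffAt_fst.sub h1).add h2
  exact (contDiffAt_fst.add h1).neg.exp.mul ((contDiffAt_snd.div h2 hp).mul h3.sin)

theorem spineMap_eq (z : ℂ) :
    spineMap z = (spineRe (-z.re) z.im : ℂ) + (spineIm (-z.re) z.im : ℂ) * Complex.I := by
  apply Complex.ext <;> simp [spineMap]

theorem contDiffAt_spineMap {z : ℂ} (hz : foldNorm (-z.re) z.im ≠ 0) :
    ContDiffAt ℝ 1 spineMap z := by
  have hp : ContDiffAt ℝ 1 (fun z : ℂ => ((-z.re, z.im) : ℝ × ℝ)) z :=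
    (Complex.reCLM.contDiff.contDiffAt.neg).prodMk Complex.imCLM.contDiff.contDiffAt
  have h1 := (contDiffAt_spineRe (p := (-z.re, z.im)) hz).comp z hp
  have h2 := (contDiffAt_spineIm (p := (-z.re, z.im)) hz).comp z hp
  have h3 := (Complex.ofRealCLM.contDiff.contDiffAt.comp z h1).add
    ((Complex.ofRealCLM.contDiff.contDiffAt.comp z h2).mul (contDiffAt_const (c := Complex.I)))
  exact h3.congr_of_eventuallyEq (Eventually.of_forall spineMap_eq)

theorem contDiffAt_spineMap_of_re_neg {z : ℂ} (hz : z.re < 0) : ContDiffAt ℝ 1 spineMap z :=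
  contDiffAt_spineMap (foldNorm_pos (by linarith) _).ne'

theorem hasStrictFDerivAt_spineMap {z : ℂ} (hz : z.re < 0) :
    HasStrictFDerivAt spineMap (fderiv ℝ spineMap z) z :=
  (contDiffAt_spineMap_of_re_neg hz).hasStrictFDerivAt (by norm_num)

theorem differentiableAt_spineMap {z : ℂ} (hz : z.re < 0) : DifferentiableAt ℝ spineMap z :=
  (hasStrictFDerivAt_spineMap hz).differentiableAt

theorem fderiv_spineMap_one {z : ℂ} (hz : z.re < 0) {a b : ℝ}
    (ha : HasDerivAt (fun t => spineRe t z.im) a (-z.re))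
    (hb : HasDerivAt (fun t => spineIm t z.im) b (-z.re)) :
    fderiv ℝ spineMap z 1 = ⟨-a, -b⟩ := by
  have h0 : HasDerivAt (fun s : ℝ => z + s) 1 0 := by
    simpa using (Complex.ofRealCLM.hasDerivAt (x := (0 : ℝ))).const_add z
  have h1 := (differentiableAt_spineMap hz).hasFDerivAt.comp_hasDerivAt_of_eq (0 : ℝ) h0 (by simp)
  have hs : HasDerivAt (fun s : ℝ => -z.re - s) (-1) 0 := by
    simpa using (hasDerivAt_id (0 : ℝ)).const_sub (-z.re)
  have ha' := (ha.comp_of_eq (0 : ℝ) hs (by simp)).ofReal_comp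
  have hb' := (hb.comp_of_eq (0 : ℝ) hs (by simp)).ofReal_comp
  have h2 := ha'.add (hb'.mul_const Complex.I)
  have h3 : (spineMap ∘ fun s : ℝ => z + s) = fun s : ℝ =>
      ((spineRe (-z.re - s) z.im : ℝ) : ℂ) + ((spineIm (-z.re - s) z.im : ℝ) : ℂ) * Complex.I := by
    funext s
    simp [spineMap_eq, sub_eq_add_neg, add_comm]
  rw [h3] at h1
  rw [h1.unique h2]
  apply Complex.ext <;> simp

theorem fderiv_spineMap_I {z : ℂ} (hz : z.re < 0) {a b : ℝ}
    (ha : HasDerivAt (fun y => spineRe (-z.re) y) a z.im)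
    (hb : HasDerivAt (fun y => spineIm (-z.re) y) b z.im) :
    fderiv ℝ spineMap z Complex.I = ⟨a, b⟩ := by
  have h0 : HasDerivAt (fun s : ℝ => z + s * Complex.I) Complex.I 0 := by
    simpa using ((Complex.ofRealCLM.hasDerivAt (x := (0 : ℝ))).mul_const Complex.I).const_add z
  have h1 := (differentiableAt_spineMap hz).hasFDerivAt.comp_hasDerivAt_of_eq (0 : ℝ) h0 (by simp)
  have hs : HasDerivAt (fun s : ℝ => z.im + s) 1 0 := by
    simpa using (hasDerivAt_id (0 : ℝ)).const_add z.im
  have ha' := (ha.comp_of_eq (0 : ℝ) hs (by simp)).ofReal_comp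
  have hb' := (hb.comp_of_eq (0 : ℝ) hs (by simp)).ofReal_comp
  have h2 := ha'.add (hb'.mul_const Complex.I)
  have h3 : (spineMap ∘ fun s : ℝ => z + s * Complex.I) = fun s : ℝ =>
      ((spineRe (-z.re) (z.im + s) : ℝ) : ℂ) + ((spineIm (-z.re) (z.im + s) : ℝ) : ℂ) * Complex.I := by
    funext s
    simp [spineMap_eq]
  rw [h3] at h1
  rw [h1.unique h2]
  apply Complex.ext <;> simp

/-- The Jacobian determinant of a real-linear map of the plane. -/
def planeDet (L : ℂ →L[ℝ] ℂ) : ℝ := (L 1).re * (L Complex.I).im - (L 1).im * (L Complex.I).re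

/-- In terms of the complex derivatives this is `2(|∂L|² + |∂̄L|²)`, while `planeDet L = |∂L|² -
|∂̄L|²`. -/
def planeEnergy (L : ℂ →L[ℝ] ℂ) : ℝ := ‖L 1‖ ^ 2 + ‖L Complex.I‖ ^ 2

/-- Up to the common factor `e^{-2(t+ρ)}`, the energy is at most 114 and for `t ≤ 1` the Jacobian is
at least `3/32`; this gives `1216 = 114 · 32/3`. For `t ≥ 1` the ratio is at most 88. The Jacobian
can vanish only where `s = σ = 0`, that is, at the points `-kπ` of the axis. -/
theorem spineMap_estimates {z : ℂ} (hz : z.re < 0) :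
    planeEnergy (fderiv ℝ spineMap z) ≤ 114 ∧
    planeEnergy (fderiv ℝ spineMap z) ≤ 1216 * planeDet (fderiv ℝ spineMap z) ∧
    (planeDet (fderiv ℝ spineMap z) ≤ 0 → z.im = 0 ∧ Real.sin z.re = 0) := by
  have ht : 0 < -z.re := by linarith
  have hL1 := fderiv_spineMap_one hz (hasDerivAt_spineRe_left ht z.im)
    (hasDerivAt_spineIm_left ht z.im)
  have hL2 := fderiv_spineMap_I hz (hasDerivAt_spineRe_right ht z.im)
    (hasDerivAt_spineIm_right ht z.im)
  have hN0 := foldNorm_pos ht z.im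
  have hNsq := foldNorm_sq (-z.re) z.im
  have hw := abs_sin_foldAngle_div_le ht z.im
  have h1 := Real.cos_sq_add_sin_sq (foldAngle (-z.re) z.im)
  have h2 : (foldWidth (-z.re) / foldNorm (-z.re) z.im) ^ 2
      + (z.im / foldNorm (-z.re) z.im) ^ 2 = 1 := by
    rw [div_pow, div_pow, ← add_div, ← hNsq, div_self (by positivity)]
  have hr : 0 ≤ foldWidth (-z.re) / foldNorm (-z.re) z.im :=
    div_nonneg (foldWidth_pos ht).le hN0.le
  have hm0 := foldSlope_nonneg (-z.re)
  have hm1 := foldSlope_le_one ht.le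
  have hE := spine_bound_inner h1 h2 hr hm0 hm1 hw
  have hJ := spine_jacobian_eq (m := foldSlope (-z.re))
    (w := Real.sin (foldAngle (-z.re) z.im) / foldNorm (-z.re) z.im) h1 h2
  have hin := fun h : -z.re ≤ 1 => spine_jacobian_inner ht h rfl rfl rfl rfl rfl h2 rfl rfl
  have hout := fun h : 1 ≤ -z.re => spine_bound_outer h1 h2 hr
    (w := Real.sin (foldAngle (-z.re) z.im) / foldNorm (-z.re) z.im)
    (by rw [foldWidth_of_ge h]; field_simp)
  have hm' := fun h : 1 ≤ -z.re => foldSlope_of_ge h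
  have hy : z.im / foldNorm (-z.re) z.im = 0 → z.im = 0 := fun h =>
    (div_eq_zero_iff.1 h).resolve_right hN0.ne'
  have hangle : z.im = 0 → foldAngle (-z.re) z.im = -z.re := fun h => by
    rw [h, foldAngle_zero_right ht]
  have hsin : Real.sin (-z.re) = -Real.sin z.re := Real.sin_neg _
  have he0 := Real.exp_pos (-(-z.re + foldWidth (-z.re)))
  have he1 : Real.exp (-(-z.re + foldWidth (-z.re))) ≤ 1 :=
    Real.exp_le_one_iff.2 (by linarith [foldWidth_pos ht])
  unfold planeEnergy planeDet
  rw [hL1, hL2, ← Complex.normSq_eq_norm_sq, ← Complex.normSq_eq_norm_sq]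
  simp only [Complex.normSq_apply]
  clear hL1 hL2 hNsq
  generalize Real.exp (-(-z.re + foldWidth (-z.re))) = e at *
  generalize hσ : Real.sin (foldAngle (-z.re) z.im) = σ at *
  generalize Real.cos (foldAngle (-z.re) z.im) = c at *
  generalize foldWidth (-z.re) / foldNorm (-z.re) z.im = r at *
  generalize z.im / foldNorm (-z.re) z.im = s at *
  generalize foldSlope (-z.re) = m at *
  have hdiv : ∀ a : ℝ, a / foldNorm (-z.re) z.im * σ = a * (σ / foldNorm (-z.re) z.im) :=
    fun a => by ring
  simp only [hdiv]
  generalize σ / foldNorm (-z.re) z.im = w at *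
  generalize hut : -(1 + m) * (c + r * σ) + (1 - m * (1 - r)) * (-σ + r * c) + s ^ 2 * m * w = ut at *
  generalize hvt : -(1 + m) * (s * σ) + (1 - m * (1 - r)) * (s * c) - r * s * m * w = vt at *
  generalize huy : s * (-σ + r * c) - s * r * w = uy at *
  generalize hvy : s * (s * c) + r ^ 2 * w = vy at *
  have hen : -(e * ut) * -(e * ut) + -(e * vt) * -(e * vt) + (e * uy * (e * uy) + e * vy * (e * vy))
      = e ^ 2 * (ut ^ 2 + vt ^ 2 + uy ^ 2 + vy ^ 2) := by ring
  have hdet : -(e * ut) * (e * vy) - -(e * vt) * (e * uy) = e ^ 2 * (uy * vt - ut * vy) := by ring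
  rw [hen, hdet, hJ]
  have he2 : e ^ 2 ≤ 1 := pow_le_one₀ he0.le he1
  have he3 : 0 < e ^ 2 := by positivity
  have hjac : ut ^ 2 + vt ^ 2 + uy ^ 2 + vy ^ 2 ≤ 1216 *
      (s ^ 2 * (1 + m) + w * c * (m * (r ^ 2 + r - 1) - r * (1 - r))
        + σ * w * r * (1 + r + m * (2 - r))) ∧
      (s ^ 2 * (1 + m) + w * c * (m * (r ^ 2 + r - 1) - r * (1 - r))
        + σ * w * r * (1 + r + m * (2 - r)) ≤ 0 → z.im = 0 ∧ Real.sin z.re = 0) := by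
    rcases le_total (-z.re) 1 with h | h
    · have := hin h
      exact ⟨by linarith only [this, hE], fun h' => absurd (this.trans h') (by norm_num)⟩
    · have hm := hm' h
      obtain ⟨ho1, ho2⟩ := hout h
      subst hm
      have e1 : ut = -(c + r * σ) + (-σ + r * c) := by rw [← hut]; ring
      have e2 : vt = -(s * σ) + s * c := by rw [← hvt]; ring
      rw [← e1, ← e2] at ho1
      have e3 : s ^ 2 * (1 + 0) + w * c * (0 * (r ^ 2 + r - 1) - r * (1 - r))
        + σ * w * r * (1 + r + 0 * (2 - r)) = s ^ 2 - w * c * (r * (1 - r)) + σ * w * r * (1 + r) := by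
        ring
      rw [e3]
      have hs2 := sq_nonneg s
      have hσ2 := sq_nonneg σ
      refine ⟨by linarith only [ho1, ho2, hs2, hσ2], fun h' => ?_⟩
      have hs0 : s = 0 := pow_eq_zero_iff two_ne_zero |>.1 (by linarith only [ho2, hs2, hσ2, h'])
      have hσ0 : σ = 0 := pow_eq_zero_iff two_ne_zero |>.1 (by linarith only [ho2, hs2, hσ2, h'])
      have hy0 := hy hs0
      refine ⟨hy0, ?_⟩
      rw [hangle hy0, hsin, hσ0] at hσ
      linarith only [hσ]
  refine ⟨?_, ?_, fun h => hjac.2 (nonpos_of_mul_nonpos_right h he3)⟩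
  · have h0 : 0 ≤ ut ^ 2 + vt ^ 2 + uy ^ 2 + vy ^ 2 := by positivity
    nlinarith only [he2, he3, hE, h0]
  · nlinarith only [he3, hjac.1]

/-! ### Real-linear maps of the plane -/

theorem planeMap_apply (L : ℂ →L[ℝ] ℂ) (v : ℂ) : L v = v.re * L 1 + v.im * L Complex.I := by
  conv_lhs => rw [← Complex.re_add_im v]
  rw [map_add]
  congr 1
  · rw [← mul_one (v.re : ℂ), ← Complex.real_smul, map_smul, Complex.real_smul]
    simp
  · rw [← Complex.real_smul, map_smul, Complex.real_smul]

theorem norm_planeMap_le (L : ℂ →L[ℝ] ℂ) (v : ℂ) : ‖L v‖ ≤ (‖L 1‖ + ‖L Complex.I‖) * ‖v‖ := by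
  rw [planeMap_apply]
  refine (norm_add_le _ _).trans ?_
  rw [norm_mul, norm_mul, Complex.norm_real, Complex.norm_real, add_mul, mul_comm, mul_comm ‖(v.im : ℝ)‖]
  gcongr
  · exact Complex.abs_re_le_norm v
  · exact Complex.abs_im_le_norm v

theorem norm_le_of_planeEnergy_le {L : ℂ →L[ℝ] ℂ} {E : ℝ} (h : planeEnergy L ≤ E ^ 2) (hE : 0 ≤ E) :
    ‖L‖ ≤ 2 * E := by
  unfold planeEnergy at h
  have h1 : ‖L 1‖ ≤ E := abs_le_of_sq_le_sq' (by nlinarith [sq_nonneg ‖L Complex.I‖]) hE |>.2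
  have h2 : ‖L Complex.I‖ ≤ E := abs_le_of_sq_le_sq' (by nlinarith [sq_nonneg ‖L 1‖]) hE |>.2
  refine L.opNorm_le_bound (by positivity) fun v => (norm_planeMap_le L v).trans ?_
  gcongr
  linarith

/-- The Beltrami inequality `|∂L| ≤ k |∂̄L|` for a real-linear map of the plane. -/
def IsBeltrami (k : ℝ) (L : ℂ →L[ℝ] ℂ) : Prop :=
  ‖(L 1 + Complex.I * L Complex.I) / 2‖ ≤ k * ‖(L 1 - Complex.I * L Complex.I) / 2‖

/-- The hypothesis reads `(K + 2)|∂̄L|² ≤ (K - 2)|∂L|²`, and `(K - 2)/(K + 2) ≤ ((K - 1)/(K + 1))²`.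
-/
theorem IsBeltrami.of_energy {L : ℂ →L[ℝ] ℂ} {K : ℝ} (hK : 1 ≤ K)
    (h : planeEnergy L ≤ K * planeDet L) : IsBeltrami ((K - 1) / (K + 1)) L := by
  unfold IsBeltrami
  rw [norm_div, norm_div, ← mul_div_assoc]
  gcongr
  have hk : 0 ≤ (K - 1) / (K + 1) := div_nonneg (by linarith) (by linarith)
  refine abs_le_of_sq_le_sq' ?_ (mul_nonneg hk (norm_nonneg _)) |>.2
  unfold planeEnergy planeDet at h
  rw [mul_pow, div_pow, div_mul_eq_mul_div, le_div_iff₀ (by positivity)]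
  rw [← Complex.normSq_eq_norm_sq, ← Complex.normSq_eq_norm_sq] at h ⊢
  generalize L 1 = a at *
  generalize L Complex.I = b at *
  simp only [Complex.normSq_apply, Complex.add_re, Complex.add_im, Complex.mul_re, Complex.mul_im,
    Complex.sub_re, Complex.sub_im, Complex.I_re, Complex.I_im, zero_mul, one_mul, zero_sub,
    zero_add] at *
  obtain ⟨a1, a2⟩ := a
  obtain ⟨b1, b2⟩ := b
  simp only at *
  have hdet : 0 ≤ a1 * b2 - a2 * b1 := by
    nlinarith only [h, hK, sq_nonneg a1, sq_nonneg a2, sq_nonneg b1, sq_nonneg b2]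
  nlinarith only [mul_nonneg (by linarith only [hK] : 0 ≤ K) (sub_nonneg.2 h), hdet]

/-- The two complex derivatives are multiplied by `c d̄` and `c d`, which have the same modulus.
This is the invariance of the Beltrami inequality under holomorphic changes of coordinate in source
and target. -/
theorem IsBeltrami.comp_mul {k : ℝ} {L M : ℂ →L[ℝ] ℂ} (h : IsBeltrami k L) (c d : ℂ)
    (hM : ∀ v, M v = c * L (d * v)) : IsBeltrami k M := by
  unfold IsBeltrami at *
  have h1 : (M 1 + Complex.I * M Complex.I) / 2 =
      c * ((starRingEnd ℂ) d * ((L 1 + Complex.I * L Complex.I) / 2)) := by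
    rw [hM, hM, planeMap_apply L (d * 1), planeMap_apply L (d * Complex.I)]
    have : (starRingEnd ℂ) d = d.re - d.im * Complex.I := by
      apply Complex.ext <;> simp
    rw [this]
    simp only [mul_one, Complex.mul_re, Complex.mul_im, Complex.I_re, Complex.I_im, mul_zero,
      zero_sub, add_zero]
    push_cast
    linear_combination (c * d.im * L Complex.I / 2) * Complex.I_sq
  have h2 : (M 1 - Complex.I * M Complex.I) / 2 =
      c * (d * ((L 1 - Complex.I * L Complex.I) / 2)) := by
    rw [hM, hM, planeMap_apply L (d * 1), planeMap_apply L (d * Complex.I)]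
    have : d = d.re + d.im * Complex.I := (Complex.re_add_im d).symm
    conv_rhs => rw [this]
    simp only [mul_one, Complex.mul_re, Complex.mul_im, Complex.I_re, Complex.I_im, mul_zero,
      zero_sub, add_zero]
    push_cast
    linear_combination (c * d.im * L Complex.I / 2) * Complex.I_sq
  rw [h1, h2, norm_mul, norm_mul, norm_mul c, norm_mul d, RCLike.norm_conj]
  have := mul_le_mul_of_nonneg_left h (mul_nonneg (norm_nonneg c) (norm_nonneg d))
  linarith

theorem IsBeltrami.mul {k : ℝ} (hk : 0 ≤ k) {L : ℂ →L[ℝ] ℂ} (d : ℂ) (hL : ∀ v, L v = d * v) :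
    IsBeltrami k L := by
  unfold IsBeltrami
  have : L 1 + Complex.I * L Complex.I = 0 := by
    rw [hL, hL]; linear_combination d * Complex.I_sq
  rw [this, zero_div, norm_zero]
  positivity

theorem planeMap_injective {L : ℂ →L[ℝ] ℂ} (h : planeDet L ≠ 0) : Function.Injective L := by
  rw [injective_iff_map_eq_zero]
  intro v hv
  rw [planeMap_apply] at hv
  have h1 := congrArg Complex.re hv
  have h2 := congrArg Complex.im hv
  simp only [Complex.add_re, Complex.add_im, Complex.re_ofReal_mul, Complex.im_ofReal_mul,
    Complex.zero_re, Complex.zero_im] at h1 h2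
  unfold planeDet at h
  apply Complex.ext
  · exact (mul_eq_zero.1 (show v.re * _ = 0 by linear_combination (L Complex.I).im * h1 - (L Complex.I).re * h2)).resolve_right h
  · exact (mul_eq_zero.1 (show v.im * _ = 0 by linear_combination (L 1).re * h2 - (L 1).im * h1)).resolve_right h

/-- An invertible real-linear map of the plane as an equivalence. -/
theorem exists_planeEquiv {L : ℂ →L[ℝ] ℂ} (h : planeDet L ≠ 0) :
    ∃ e : ℂ ≃L[ℝ] ℂ, (e : ℂ →L[ℝ] ℂ) = L := by
  refine ⟨(LinearEquiv.ofInjectiveEndo (L : ℂ →ₗ[ℝ] ℂ) (planeMap_injective h)).toContinuousLinearEquiv, ?_⟩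
  ext v; rfl

/-! ### The model map near the boundary -/

theorem norm_fderiv_spineMap_le {z : ℂ} (hz : z.re < 0) : ‖fderiv ℝ spineMap z‖ ≤ 22 := by
  have := norm_le_of_planeEnergy_le (E := 11)
    ((spineMap_estimates hz).1.trans (by norm_num)) (by norm_num)
  linarith

theorem spineMap_I_mul (y : ℝ) : spineMap (y * Complex.I) = Complex.exp (y * Complex.I) := by
  rw [Complex.exp_mul_I, ← Complex.ofReal_cos, ← Complex.ofReal_sin, spineMap_eq]
  simp only [Complex.mul_I_re, Complex.ofReal_im, neg_zero, Complex.mul_I_im, Complex.ofReal_re]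
  simp only [spineRe, spineIm, foldAngle, foldNorm_zero_left, foldWidth_zero]
  rcases lt_trichotomy y 0 with h | h | h
  · have : y / -y = -1 := by rw [div_neg, div_self h.ne]
    rw [abs_of_neg h, this]; simp
  · subst h; simp
  · rw [abs_of_pos h, div_self h.ne']; simp

theorem convex_re_lt (c : ℝ) : Convex ℝ {z : ℂ | z.re < c} :=
  convex_halfSpace_lt Complex.reLm.isLinear c

theorem isOpen_re_lt (c : ℝ) : IsOpen {z : ℂ | z.re < c} :=
  isOpen_lt Complex.continuous_re continuous_const

theorem norm_spineMap_sub_exp_sub_le {z w : ℂ} (hz : z.re < 0) (hw : w.re < 0) :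
    ‖(spineMap z - Complex.exp z) - (spineMap w - Complex.exp w)‖ ≤ 23 * ‖z - w‖ := by
  have hd : ∀ x ∈ {z : ℂ | z.re < 0}, HasFDerivWithinAt (fun z => spineMap z - Complex.exp z)
      (fderiv ℝ spineMap x - (Complex.exp x • (1 : ℂ →L[ℂ] ℂ)).restrictScalars ℝ) {z : ℂ | z.re < 0} x := by
    intro x hx
    refine HasFDerivAt.hasFDerivWithinAt ?_
    have := (Complex.hasDerivAt_exp x).hasFDerivAt.restrictScalars ℝ
    refine (differentiableAt_spineMap hx).hasFDerivAt.sub (this.congr_fderiv ?_)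
    ext; simp [mul_comm]
  refine (convex_re_lt 0).norm_image_sub_le_of_norm_hasFDerivWithin_le hd (fun x hx => ?_) hw hz
  refine (norm_sub_le _ _).trans ?_
  have h1 := norm_fderiv_spineMap_le hx
  have h2 : ‖(Complex.exp x • (1 : ℂ →L[ℂ] ℂ)).restrictScalars ℝ‖ ≤ 1 := by
    rw [ContinuousLinearMap.norm_restrictScalars, norm_smul, norm_one, mul_one, Complex.norm_exp]
    exact Real.exp_le_one_iff.2 (le_of_lt hx)
  linarith

/-- The difference of the model and the exponential is 23-Lipschitz, with `23 = 22 + 1`, and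
vanishes on the imaginary axis. Boundary points `iy` with `y ≠ 0` are used, because `foldNorm`
vanishes at the origin and smoothness is not available there; the case `Im z = 0` follows by letting
`y` tend to 0. -/
theorem norm_spineMap_sub_exp_le {z : ℂ} (hz : z.re < 0) :
    ‖spineMap z - Complex.exp z‖ ≤ 23 * |z.re| := by
  have key : ∀ y : ℝ, y ≠ 0 → ‖spineMap z - Complex.exp z‖ ≤ 23 * ‖z - y * Complex.I‖ := by
    intro y hy
    have hc : ContinuousAt (fun w => spineMap w - Complex.exp w) (y * Complex.I) := by
      refine ContinuousAt.sub (contDiffAt_spineMap ?_).continuousAt Complex.continuous_exp.continuousAt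
      simpa [foldNorm_zero_left] using hy
    have ht : Tendsto (fun s : ℝ => (s : ℂ) + y * Complex.I) (𝓝[<] 0) (𝓝 (y * Complex.I)) := by
      have : Tendsto (fun s : ℝ => (s : ℂ) + y * Complex.I) (𝓝 0) (𝓝 ((0 : ℝ) + y * Complex.I)) :=
        (Complex.continuous_ofReal.tendsto 0).add_const _
      simpa using this.mono_left nhdsWithin_le_nhds
    have h1 := hc.tendsto.comp ht
    simp only [Function.comp_def, spineMap_I_mul, sub_self] at h1
    have h2 := (tendsto_const_nhds (x := spineMap z - Complex.exp z)).sub h1 |>.norm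
    have h3 := ((tendsto_const_nhds (x := z)).sub ht).norm.const_mul 23
    rw [sub_zero] at h2
    refine le_of_tendsto_of_tendsto h2 h3 ?_
    filter_upwards [self_mem_nhdsWithin] with s hs
    exact norm_spineMap_sub_exp_sub_le hz (by simpa using hs)
  have hlim : Tendsto (fun y : ℝ => 23 * ‖z - y * Complex.I‖) (𝓝[≠] z.im)
      (𝓝 (23 * ‖z - z.im * Complex.I‖)) := by
    have : Continuous fun y : ℝ => 23 * ‖z - y * Complex.I‖ := by fun_prop
    exact (this.tendsto _).mono_left nhdsWithin_le_nhds
  have hre : ‖z - z.im * Complex.I‖ = |z.re| := by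
    have : z - z.im * Complex.I = z.re := by
      apply Complex.ext <;> simp
    rw [this, Complex.norm_real, Real.norm_eq_abs]
  rw [← hre]
  by_cases h : z.im = 0
  · refine ge_of_tendsto hlim ?_
    filter_upwards [self_mem_nhdsWithin] with y hy
    exact key y fun h' => hy (by simp [h', h])
  · exact key _ h

/-! ### Openness and fibres of the model map -/

theorem isPreconnected_punctured_ball (c : ℂ) {r : ℝ} (hr : 0 < r) :
    IsPreconnected (Metric.ball c r \ {c}) := by
  have : Metric.ball c r \ {c} = (fun z => c + Complex.exp z) '' {z : ℂ | z.re < Real.log r} := by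
    ext w
    simp only [Set.mem_sdiff, Metric.mem_ball, dist_eq_norm, mem_singleton_iff, mem_image,
      Set.mem_ofPred_eq]
    constructor
    · rintro ⟨h1, h2⟩
      have h3 : w - c ≠ 0 := sub_ne_zero.2 h2
      refine ⟨Complex.log (w - c), ?_, by rw [Complex.exp_log h3]; ring⟩
      rw [Complex.log_re]
      exact Real.log_lt_log (norm_pos_iff.2 h3) h1
    · rintro ⟨z, hz, rfl⟩
      refine ⟨?_, fun h => Complex.exp_ne_zero z (by linear_combination h)⟩
      rw [add_sub_cancel_left, Complex.norm_exp]
      rwa [Real.lt_log_iff_exp_lt hr] at hz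
  rw [this]
  exact (convex_re_lt _).isPreconnected.image _ (by fun_prop)

/-- A continuous map of the plane is open at an isolated point of a fibre if it is open
elsewhere. -/
theorem nhds_le_map_of_isolated {f : ℂ → ℂ} {x : ℂ} {V : Set ℂ} (hV : V ∈ 𝓝 x)
    (hc : ContinuousOn f V) (hf : ∀ y ∈ V, y ≠ x → f y ≠ f x ∧ 𝓝 (f y) ≤ map f (𝓝 y)) :
    𝓝 (f x) ≤ map f (𝓝 x) := by
  intro S hS
  obtain ⟨r, hr, hrS⟩ := Metric.nhds_basis_closedBall.mem_iff.1 (inter_mem hV (mem_map.1 hS))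
  have hcb : ContinuousOn f (Metric.closedBall x r) := hc.mono fun y hy => (hrS hy).1
  have hsph : IsCompact (f '' Metric.sphere x r) :=
    (isCompact_sphere x r).image_of_continuousOn (hcb.mono Metric.sphere_subset_closedBall)
  have hnot : f x ∉ f '' Metric.sphere x r := by
    rintro ⟨y, hy, hyx⟩
    have hyne : y ≠ x := by
      rintro rfl; simp only [Metric.mem_sphere, dist_self] at hy; exact hr.ne hy
    exact (hf y (hrS (Metric.sphere_subset_closedBall hy)).1 hyne).1 hyx
  obtain ⟨ε, hε, hεS⟩ := Metric.mem_nhds_iff.1 (hsph.isClosed.isOpen_compl.mem_nhds hnot)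
  have hxcb : x ∈ Metric.closedBall x r := Metric.mem_closedBall_self hr.le
  have hopen : IsOpen (f '' (Metric.ball x r \ {x})) := by
    rw [isOpen_iff_mem_nhds]
    rintro _ ⟨y, hy, rfl⟩
    have hyV : y ∈ V := (hrS (Metric.ball_subset_closedBall hy.1)).1
    refine (hf y hyV hy.2).2 (mem_map.2 (mem_of_superset ?_ (subset_preimage_image f _)))
    exact (Metric.isOpen_ball.sdiff isClosed_singleton).mem_nhds hy
  -- The image of the punctured ball is open. It is also relatively closed in the punctured disc: a
  -- limit of values is a value on the closed ball, and neither the sphere nor the centre can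
  -- provide it. The punctured disc is connected.
  have hsub : Metric.ball (f x) ε \ {f x} ⊆ f '' (Metric.ball x r \ {x}) := by
    refine (isPreconnected_punctured_ball (f x) hε).subset_of_closure_inter_subset hopen ?_ ?_
    · have h1 : Tendsto f (𝓝[≠] x) (𝓝[≠] (f x)) := by
        refine tendsto_nhdsWithin_iff.2 ⟨(hc.continuousAt hV).tendsto.mono_left nhdsWithin_le_nhds, ?_⟩
        filter_upwards [mem_nhdsWithin_of_mem_nhds hV, self_mem_nhdsWithin] with y hy hyx
        exact (hf y hy hyx).1
      have h2 : ∀ᶠ y in 𝓝[≠] x, f y ∈ Metric.ball (f x) ε \ {f x} :=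
        h1 (sdiff_mem_nhdsWithin_compl (Metric.ball_mem_nhds _ hε) _)
      have h3 : ∀ᶠ y in 𝓝[≠] x, y ∈ Metric.ball x r \ {x} :=
        sdiff_mem_nhdsWithin_compl (Metric.ball_mem_nhds _ hr) _
      obtain ⟨y, hy1, hy2⟩ := (h2.and h3).exists
      exact ⟨f y, hy1, mem_image_of_mem f hy2⟩
    · rintro q ⟨hq, hqb, hqx⟩
      have hcl : closure (f '' (Metric.ball x r \ {x})) ⊆ f '' Metric.closedBall x r := by
        refine closure_minimal (image_mono fun y hy => Metric.ball_subset_closedBall hy.1) ?_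
        exact ((isCompact_closedBall x r).image_of_continuousOn hcb).isClosed
      obtain ⟨y, hy, rfl⟩ := hcl hq
      refine ⟨y, ⟨?_, ?_⟩, rfl⟩
      · by_contra hyb
        have : y ∈ Metric.sphere x r := by
          rw [Metric.mem_ball, not_lt] at hyb
          exact le_antisymm hy hyb
        exact hεS hqb (mem_image_of_mem f this)
      · rintro rfl; exact hqx rfl
  refine mem_of_superset (Metric.ball_mem_nhds (f x) hε) fun q hq => ?_
  by_cases hqx : q = f x
  · rw [hqx]; exact (hrS hxcb).2
  · obtain ⟨y, hy, rfl⟩ := hsub ⟨hq, hqx⟩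
    exact (hrS (Metric.ball_subset_closedBall hy.1)).2

theorem spineIm_eq_zero_iff {t : ℝ} (ht : 0 < t) (y : ℝ) :
    spineIm t y = 0 ↔ y = 0 ∨ Real.sin (foldAngle t y) = 0 := by
  simp [spineIm, Real.exp_ne_zero, (foldNorm_pos ht y).ne']

theorem planeDet_spineMap_pos {z : ℂ} (hz : z.re < 0) (h : ¬ (z.im = 0 ∧ Real.sin z.re = 0)) :
    0 < planeDet (fderiv ℝ spineMap z) := by
  by_contra h'
  exact h ((spineMap_estimates hz).2.2 (not_lt.1 h'))

/-- A positive Jacobian lets the inverse function theorem apply. -/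
theorem spineMap_regular {z : ℂ} (hz : z.re < 0) (h : ¬ (z.im = 0 ∧ Real.sin z.re = 0)) :
    𝓝 (spineMap z) ≤ map spineMap (𝓝 z) ∧ ∃ U ∈ 𝓝 z, InjOn spineMap U := by
  obtain ⟨e, he⟩ := exists_planeEquiv (planeDet_spineMap_pos hz h).ne'
  have hs := hasStrictFDerivAt_spineMap hz
  rw [← he] at hs
  exact ⟨hs.map_nhds_eq_of_equiv.ge, (hs.toOpenPartialHomeomorph spineMap).source,
    (hs.toOpenPartialHomeomorph spineMap).open_source.mem_nhds hs.mem_toOpenPartialHomeomorph_source,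
    (hs.toOpenPartialHomeomorph spineMap).injOn⟩

/-- The function has derivative `-2 e^{-x} sin x`, so on `[-1, 1]` it has a strict maximum at 0,
with value 1. On the axis beyond `t = 1` the model is `e^{-(t+1/2)}(cos t + sin t)`, and `δ` plays
the role of `t - kπ`. -/
theorem exp_mul_cos_add_sin_ne {δ : ℝ} (h0 : δ ≠ 0) (h1 : |δ| < 1) :
    Real.exp (-δ) * (Real.cos δ + Real.sin δ) ≠ 1 := by
  have hd : ∀ x : ℝ, HasDerivAt (fun x => Real.exp (-x) * (Real.cos x + Real.sin x))
      (-2 * (Real.exp (-x) * Real.sin x)) x := fun x => by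
    have := (hasDerivAt_neg x).exp.mul ((Real.hasDerivAt_cos x).add (Real.hasDerivAt_sin x))
    refine this.congr_deriv ?_
    simp only [Pi.add_apply]
    ring
  have hcont : Continuous fun x : ℝ => Real.exp (-x) * (Real.cos x + Real.sin x) := by fun_prop
  have hpi := Real.pi_gt_three
  rw [abs_lt] at h1
  rcases lt_or_gt_of_ne h0 with h | h
  · have : StrictMonoOn (fun x => Real.exp (-x) * (Real.cos x + Real.sin x)) (Icc (-1) 0) := by
      refine strictMonoOn_of_deriv_pos (convex_Icc _ _) hcont.continuousOn fun x hx => ?_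
      rw [interior_Icc] at hx
      rw [(hd x).deriv]
      have := Real.sin_neg_of_neg_of_neg_pi_lt hx.2 (by linarith [hx.1])
      have := mul_neg_of_pos_of_neg (Real.exp_pos (-x)) this
      linarith
    have := this ⟨h1.1.le, h.le⟩ ⟨by norm_num, le_rfl⟩ h
    simp only [neg_zero, Real.exp_zero, Real.cos_zero, Real.sin_zero] at this
    linarith
  · have : StrictAntiOn (fun x => Real.exp (-x) * (Real.cos x + Real.sin x)) (Icc 0 1) := by
      refine strictAntiOn_of_deriv_neg (convex_Icc _ _) hcont.continuousOn fun x hx => ?_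
      rw [interior_Icc] at hx
      rw [(hd x).deriv]
      have := Real.sin_pos_of_pos_of_lt_pi hx.1 (by linarith [hx.2])
      have := mul_pos (Real.exp_pos (-x)) this
      linarith
    have := this ⟨le_rfl, zero_le_one⟩ ⟨h.le, h1.2.le⟩ h
    simp only [neg_zero, Real.exp_zero, Real.cos_zero, Real.sin_zero] at this
    linarith

theorem one_lt_of_sin_eq_zero {t : ℝ} (ht : 0 < t) (hs : Real.sin t = 0) : 1 < t := by
  by_contra h
  have := Real.sin_pos_of_pos_of_le_one ht (not_lt.1 h)
  linarith

/-- A nearby point with the same value lies on the net, since that value is real. On the axis,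
`exp_mul_cos_add_sin_ne` excludes it. On the arc `τ = kπ` the value is `±e^{-(t+1/2)}`, which
determines `t`; then `t = kπ`, and this forces `y = 0`. -/
theorem spineMap_critical_isolated {z : ℂ} (hz : z.re < 0) (hi : z.im = 0)
    (hs : Real.sin z.re = 0) : ∀ᶠ w in 𝓝[≠] z, spineMap w ≠ spineMap z := by
  have ht : 0 < -z.re := by linarith
  have hst : Real.sin (-z.re) = 0 := by rw [Real.sin_neg, hs, neg_zero]
  have ht1 := one_lt_of_sin_eq_zero ht hst
  have hct : Real.cos (-z.re) ≠ 0 := fun h => by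
    have := Real.cos_sq_add_sin_sq (-z.re)
    rw [h, hst] at this; norm_num at this
  have hcτ : Continuous fun w : ℂ => foldAngle (-w.re) w.im :=
    continuous_foldAngle.comp (by fun_prop : Continuous fun w : ℂ => ((-w.re, w.im) : ℝ × ℝ))
  have hτz : foldAngle (-z.re) z.im = -z.re := by rw [hi, foldAngle_zero_right ht]
  have e1 : ∀ᶠ w : ℂ in 𝓝 z, 1 < -w.re :=
    (Complex.continuous_re.neg.tendsto z).eventually (lt_mem_nhds ht1)
  have e2 : ∀ᶠ w : ℂ in 𝓝 z, |-w.re - -z.re| < 1 := by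
    have : Continuous fun w : ℂ => |-w.re - -z.re| := by fun_prop
    exact (this.tendsto z).eventually (gt_mem_nhds (by simp))
  have e3 : ∀ᶠ w : ℂ in 𝓝 z, |foldAngle (-w.re) w.im - -z.re| < 1 := by
    have : Continuous fun w : ℂ => |foldAngle (-w.re) w.im - -z.re| := (hcτ.sub continuous_const).abs
    exact (this.tendsto z).eventually (gt_mem_nhds (by rw [hτz]; simp))
  have hvalz : spineRe (-z.re) z.im = Real.exp (-(-z.re + 1 / 2)) * Real.cos (-z.re) := by
    rw [spineRe, hτz, hst, foldWidth_of_ge ht1.le, mul_zero, add_zero]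
  have himz : spineIm (-z.re) z.im = 0 := (spineIm_eq_zero_iff ht _).2 (Or.inl hi)
  filter_upwards [nhdsWithin_le_nhds e1, nhdsWithin_le_nhds e2, nhdsWithin_le_nhds e3,
    self_mem_nhdsWithin] with w h1 h2 h3 hw heq
  have hw0 : 0 < -w.re := by linarith
  have hre : spineRe (-w.re) w.im = spineRe (-z.re) z.im := congrArg Complex.re heq
  have him : spineIm (-w.re) w.im = 0 := himz ▸ congrArg Complex.im heq
  rw [hvalz] at hre
  rcases (spineIm_eq_zero_iff hw0 _).1 him with hy | hτ
  · have hδ : -w.re - -z.re ≠ 0 := fun h => hw (Complex.ext (by linarith) (by rw [hy, hi]))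
    apply exp_mul_cos_add_sin_ne hδ h2
    rw [hy, spineRe, foldAngle_zero_right hw0, foldNorm_zero_right hw0,
      div_self (foldWidth_pos hw0).ne', foldWidth_of_ge h1.le] at hre
    generalize hδ' : -w.re - -z.re = δ at *
    have hw' : -w.re = -z.re + δ := by linarith
    rw [hw', Real.cos_add, Real.sin_add, hst,
      show -(-z.re + δ + 1 / 2) = -(-z.re + 1 / 2) + -δ by ring, Real.exp_add] at hre
    have he := Real.exp_ne_zero (-(-z.re + 1 / 2))
    have : Real.exp (-(-z.re + 1 / 2)) * Real.cos (-z.re) *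
        (Real.exp (-δ) * (Real.cos δ + Real.sin δ) - 1) = 0 := by linear_combination hre
    have := (mul_eq_zero.1 this).resolve_left (mul_ne_zero he hct)
    linarith
  · have hsub : Real.sin (foldAngle (-w.re) w.im - -z.re) = 0 := by
      rw [Real.sin_sub, hτ, hst]; ring
    rw [abs_lt] at h3
    have hpi := Real.pi_gt_three
    have h4 := (Real.sin_eq_zero_iff_of_lt_of_lt (by linarith) (by linarith)).1 hsub
    have hτ' : foldAngle (-w.re) w.im = -z.re := by linarith
    rw [spineRe, hτ', hst, foldWidth_of_ge h1.le, mul_zero, add_zero] at hre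
    have h5 := Real.exp_injective (mul_right_cancel₀ hct hre)
    have h6 : w.re = z.re := by linarith
    refine hw (Complex.ext h6 ?_)
    rw [hi]
    rw [foldAngle, foldWidth_of_ge h1.le] at hτ'
    have h7 := foldNorm_sq (-w.re) w.im
    rw [foldWidth_of_ge h1.le, show foldNorm (-w.re) w.im = 1 / 2 by linarith] at h7
    exact pow_eq_zero_iff two_ne_zero |>.1 (by linarith)

theorem continuousOn_spineMap : ContinuousOn spineMap {z | z.re < 0} := fun _ hz =>
  (differentiableAt_spineMap hz).continuousAt.continuousWithinAt

theorem spineMap_isolated {z : ℂ} (hz : z.re < 0) : ∀ᶠ w in 𝓝[≠] z, spineMap w ≠ spineMap z := by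
  by_cases h : z.im = 0 ∧ Real.sin z.re = 0
  · exact spineMap_critical_isolated hz h.1 h.2
  · obtain ⟨U, hU, hinj⟩ := (spineMap_regular hz h).2
    filter_upwards [nhdsWithin_le_nhds hU, self_mem_nhdsWithin] with w hw hwz heq
    exact hwz (hinj hw (mem_of_mem_nhds hU) heq)

theorem nhds_le_map_spineMap {z : ℂ} (hz : z.re < 0) : 𝓝 (spineMap z) ≤ map spineMap (𝓝 z) := by
  by_cases h : z.im = 0 ∧ Real.sin z.re = 0
  · have hiso := eventually_nhdsWithin_iff.1 (spineMap_critical_isolated hz h.1 h.2)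
    -- Critical points are at distance at least `π` from each other, so `z` is the only one in this
    -- strip.
    have hsin : ∀ᶠ w : ℂ in 𝓝 z, |w.re - z.re| < 1 := by
      have : Continuous fun w : ℂ => |w.re - z.re| := by fun_prop
      exact (this.tendsto z).eventually (gt_mem_nhds (by simp))
    have hV := (hiso.and hsin).and ((isOpen_re_lt 0).mem_nhds hz)
    refine nhds_le_map_of_isolated hV (continuousOn_spineMap.mono fun w hw => hw.2) ?_
    rintro w ⟨⟨h1, h2⟩, h3⟩ hwz
    refine ⟨h1 hwz, (spineMap_regular h3 fun h' => hwz ?_).1⟩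
    have hsub : Real.sin (w.re - z.re) = 0 := by rw [Real.sin_sub, h'.2, h.2]; ring
    rw [abs_lt] at h2
    have hpi := Real.pi_gt_three
    have h4 := (Real.sin_eq_zero_iff_of_lt_of_lt (by linarith) (by linarith)).1 hsub
    exact Complex.ext (by linarith) (by rw [h'.1, h.1])
  · exact (spineMap_regular hz h).1

theorem spineMap_im_eq_zero_of_critical {z : ℂ} (hz : z.re < 0)
    (h : ¬ ∃ U ∈ 𝓝 z, InjOn spineMap U) : (spineMap z).im = 0 := by
  by_contra h'
  refine h (spineMap_regular hz fun h2 => h' ?_).2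
  exact (spineIm_eq_zero_iff (by linarith) _).2 (Or.inl h2.1)

/-! ### Quasiregularity of locally Lipschitz maps -/

/-- Integration by parts for real Lipschitz functions, applied to the real and imaginary parts;
Rademacher's theorem identifies line derivatives with values of the differential. -/
theorem integral_fderiv_mul_of_lipschitzWith {C : NNReal} {G : ℂ → ℂ} (hG : LipschitzWith C G)
    {θ : ℂ → ℝ} (hθ : ContDiff ℝ ∞ θ) (hc : HasCompactSupport θ) (v : ℂ) :
    ∫ z, (fderiv ℝ θ z v : ℂ) * G z = - ∫ z, (θ z : ℂ) * fderiv ℝ G z v := by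
  obtain ⟨D, hD⟩ := ContDiff.lipschitzWith_of_hasCompactSupport hc hθ (by simp)
  have hfd : Continuous fun z => fderiv ℝ θ z v :=
    (hθ.continuous_fderiv (by simp)).clm_apply continuous_const
  have hfdc : HasCompactSupport fun z => fderiv ℝ θ z v := hc.fderiv_apply ℝ v
  have hi1 : Integrable fun z => (fderiv ℝ θ z v : ℂ) * G z := by
    refine Continuous.integrable_of_hasCompactSupport
      ((Complex.continuous_ofReal.comp hfd).mul hG.continuous) ?_
    exact (hfdc.comp_left (g := fun x : ℝ => (x : ℂ)) Complex.ofReal_zero).mul_right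
  have hi2 : Integrable fun z => (θ z : ℂ) * fderiv ℝ G z v := by
    have h1 : Integrable fun z => (θ z : ℂ) :=
      (Complex.continuous_ofReal.comp hθ.continuous).integrable_of_hasCompactSupport
        (hc.comp_left (g := fun x : ℝ => (x : ℂ)) Complex.ofReal_zero)
    refine h1.mul_bdd (c := C * ‖v‖) (measurable_fderiv_apply_const ℝ G v).aestronglyMeasurable ?_
    refine Eventually.of_forall fun z => ?_
    exact ((fderiv ℝ G z).le_opNorm v).trans
      (mul_le_mul_of_nonneg_right (norm_fderiv_le_of_lipschitz ℝ hG) (norm_nonneg v))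
  have key : ∀ L : ℂ →L[ℝ] ℝ, ∫ z, fderiv ℝ θ z v * L (G z) = - ∫ z, θ z * L (fderiv ℝ G z v) := by
    intro L
    have hLG : LipschitzWith (‖L‖₊ * C) (fun z => L (G z)) := L.lipschitz.comp hG
    have h := hLG.integral_lineDeriv_mul_eq hD hc v (μ := volume)
    have e1 : ∫ z, lineDeriv ℝ θ z (-v) * L (G z) = - ∫ z, fderiv ℝ θ z v * L (G z) := by
      rw [← integral_neg]
      refine integral_congr_ae (Eventually.of_forall fun z => ?_)
      simp only
      rw [((hθ.differentiable (by simp)) z).lineDeriv_eq_fderiv, map_neg, neg_mul]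
    have e2 : ∫ z, lineDeriv ℝ (fun z => L (G z)) z v * θ z = ∫ z, θ z * L (fderiv ℝ G z v) := by
      refine integral_congr_ae ?_
      filter_upwards [hG.ae_differentiableAt (μ := volume)] with z hz
      have h3 : HasFDerivAt (fun z => L (G z)) (L.comp (fderiv ℝ G z)) z :=
        L.hasFDerivAt.comp z hz.hasFDerivAt
      rw [(h3.hasLineDerivAt v).lineDeriv, mul_comm]
      rfl
    rw [e1, e2] at h
    linarith
  have hk1 := key Complex.reCLM
  have hk2 := key Complex.imCLM
  have r1 := Complex.reCLM.integral_comp_comm hi1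
  have r2 := Complex.reCLM.integral_comp_comm hi2
  have i1 := Complex.imCLM.integral_comp_comm hi1
  have i2 := Complex.imCLM.integral_comp_comm hi2
  simp only [Complex.reCLM_apply, Complex.imCLM_apply, Complex.re_ofReal_mul,
    Complex.im_ofReal_mul] at hk1 hk2 r1 r2 i1 i2
  apply Complex.ext
  · rw [Complex.neg_re, ← r1, ← r2, hk1]
  · rw [Complex.neg_im, ← i1, ← i2, hk2]

theorem exists_lipschitzOnWith_cthickening {g : ℂ → ℂ} {U C : Set ℂ} (hU : IsOpen U)
    (hg : LocallyLipschitzOn U g) (hC : IsCompact C) (hCU : C ⊆ U) :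
    ∃ (V : Set ℂ) (D : NNReal), LipschitzOnWith D g V ∧ ∀ z ∈ C, V ∈ 𝓝 z := by
  obtain ⟨δ, hδ, hδU⟩ := hC.exists_cthickening_subset_open hU hCU
  obtain ⟨D, hD⟩ := (hg.mono hδU).exists_lipschitzOnWith_of_compact hC.cthickening
  refine ⟨_, D, hD, fun z hz => ?_⟩
  exact mem_of_superset (Metric.isOpen_thickening.mem_nhds (Metric.self_subset_thickening hδ C hz))
    (Metric.thickening_subset_cthickening δ C)

/-- Only the values of `g` near the support of the test function matter, so `g` may be replaced by a
global Lipschitz extension from a neighbourhood of that support. -/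
theorem isWeakDerivOn_fderiv {g : ℂ → ℂ} {U : Set ℂ} (hU : IsOpen U)
    (hg : LocallyLipschitzOn U g) (v : ℂ) : IsWeakDerivOn g (fun z => fderiv ℝ g z v) v U := by
  intro θ hθ hc hsub
  obtain ⟨V, D, hD, hV⟩ := exists_lipschitzOnWith_cthickening hU hg hc hsub
  obtain ⟨G, hG, hgG⟩ := hD.extend_finite_dimension
  have heq : ∀ z ∈ tsupport θ, g =ᶠ[𝓝 z] G := fun z hz => by
    filter_upwards [hV z hz] with w hw using hgG hw
  have e1 : ∀ z, (fderiv ℝ θ z v : ℂ) * g z = (fderiv ℝ θ z v : ℂ) * G z := fun z => by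
    by_cases hz : z ∈ tsupport θ
    · rw [(heq z hz).self_of_nhds]
    · have : fderiv ℝ θ z = 0 := by
        by_contra h
        exact hz (support_fderiv_subset ℝ h)
      simp [this]
  have e2 : ∀ z, (θ z : ℂ) * fderiv ℝ g z v = (θ z : ℂ) * fderiv ℝ G z v := fun z => by
    by_cases hz : z ∈ tsupport θ
    · rw [(heq z hz).fderiv_eq]
    · simp [image_eq_zero_of_notMem_tsupport hz]
  simp only [e1, e2]
  exact integral_fderiv_mul_of_lipschitzWith hG hθ hc v

theorem memLp_fderiv_apply {g : ℂ → ℂ} {U C : Set ℂ} (hU : IsOpen U)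
    (hg : LocallyLipschitzOn U g) (hC : IsCompact C) (hCU : C ⊆ U) (v : ℂ) :
    MemLp (fun z => fderiv ℝ g z v) 2 (volume.restrict C) := by
  obtain ⟨V, D, hD, hV⟩ := exists_lipschitzOnWith_cthickening hU hg hC hCU
  have : IsFiniteMeasure (volume.restrict C) := ⟨by simpa using hC.measure_lt_top⟩
  refine MemLp.of_bound (measurable_fderiv_apply_const ℝ g v).aestronglyMeasurable (D * ‖v‖) ?_
  refine (ae_restrict_iff' hC.measurableSet).2 (Eventually.of_forall fun z hz => ?_)
  exact ((fderiv ℝ g z).le_opNorm v).trans (mul_le_mul_of_nonneg_right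
    (norm_fderiv_le_of_lipschitzOn ℝ (hV z hz) hD) (norm_nonneg v))

theorem isQuasiregularOn_of_locallyLipschitzOn {K : ℝ} {g : ℂ → ℂ} {U : Set ℂ} (hU : IsOpen U)
    (hg : LocallyLipschitzOn U g)
    (hb : ∀ᵐ z ∂volume.restrict U, IsBeltrami ((K - 1) / (K + 1)) (fderiv ℝ g z)) :
    IsQuasiregularOn K g U :=
  ⟨hg.continuousOn, fun z => fderiv ℝ g z 1, fun z => fderiv ℝ g z Complex.I,
    isWeakDerivOn_fderiv hU hg 1, isWeakDerivOn_fderiv hU hg Complex.I,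
    fun _ hC hCU => ⟨memLp_fderiv_apply hU hg hC hCU 1, memLp_fderiv_apply hU hg hC hCU Complex.I⟩,
    hb⟩

/-! ### Topology of logarithmic staircases -/

theorem MapClusterPt.eq_of_tendsto {α Z : Type*} [TopologicalSpace Z] [T2Space Z] {F : Filter α}
    {u : α → Z} {a b : Z} (h : MapClusterPt a F u) (hu : Tendsto u F (𝓝 b)) : a = b :=
  have : NeBot (𝓝 a ⊓ 𝓝 b) := NeBot.mono h (inf_le_inf_left _ hu)
  eq_of_nhds_neBot this

section Staircase

variable {X : Type*} [TopologicalSpace X] {ψ : X → OnePoint ℂ}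

theorem IsSurfaceSpread.finite_inter_fibre (hψ : IsSurfaceSpread ψ) {K : Set X} (hK : IsCompact K)
    (p : OnePoint ℂ) : (K ∩ ψ ⁻¹' {p}).Finite :=
  (hK.inter_right (isClosed_singleton.preimage hψ.continuous)).finite
    ((hψ.discrete p).mono inter_subset_right)

/-- `φ` is the logarithmic coordinate of a staircase over the real number `r`. -/
structure IsStaircaseChart (ψ : X → OnePoint ℂ) (φ : OpenPartialHomeomorph X ℂ) (r c : ℝ) :
    Prop where
  target_eq : φ.target = {z : ℂ | z.re < c}
  apply_eq : ∀ x ∈ φ.source, ψ x = (((r : ℂ) + Complex.exp (φ x) : ℂ) : OnePoint ℂ)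

variable {φ : OpenPartialHomeomorph X ℂ} {r c : ℝ}

theorem IsStaircaseChart.apply_symm (h : IsStaircaseChart ψ φ r c) {z : ℂ} (hz : z.re < c) :
    ψ (φ.symm z) = (((r : ℂ) + Complex.exp z : ℂ) : OnePoint ℂ) := by
  have hz' : z ∈ φ.target := by rw [h.target_eq]; exact hz
  rw [h.apply_eq _ (φ.map_target hz'), φ.right_inv hz']

theorem IsStaircaseChart.re_lt (h : IsStaircaseChart ψ φ r c) {x : X} (hx : x ∈ φ.source) :
    (φ x).re < c := by
  have := φ.map_source hx
  rwa [h.target_eq] at this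

theorem IsStaircaseChart.mem_target (h : IsStaircaseChart ψ φ r c) {z : ℂ} (hz : z.re < c) :
    z ∈ φ.target := by rw [h.target_eq]; exact hz

theorem IsStaircaseChart.symm_mem (h : IsStaircaseChart ψ φ r c) {z : ℂ} (hz : z.re < c) :
    φ.symm z ∈ φ.source := φ.map_target (h.mem_target hz)

theorem IsStaircaseChart.isPreconnected_symm_image (h : IsStaircaseChart ψ φ r c) {S : Set ℂ}
    (hS : IsPreconnected S) (hSc : S ⊆ {z : ℂ | z.re < c}) : IsPreconnected (φ.symm '' S) :=
  hS.image _ (φ.continuousOn_symm.mono (h.target_eq ▸ hSc))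

/-- A neighbourhood of `x` meets only finitely many sheets of the staircase, in the sense that only
finitely many points over a given value belong to sheets which meet the neighbourhood. -/
theorem IsStaircaseChart.finite_sheets (h : IsStaircaseChart ψ φ r c) (hψ : IsSurfaceSpread ψ)
    {N : Set X} (hN : IsCompact (closure N)) {q : ℂ} (hq : q.re < c) :
    {n : ℤ | φ.symm (q + n * (2 * Real.pi * Complex.I)) ∈ N}.Finite := by
  have hre : ∀ n : ℤ, (q + n * (2 * Real.pi * Complex.I)).re = q.re := fun n => by simp
  refine Set.Finite.of_finite_image ((hψ.finite_inter_fibre hN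
    (((r : ℂ) + Complex.exp q : ℂ) : OnePoint ℂ)).subset ?_)
    (f := fun n : ℤ => φ.symm (q + n * (2 * Real.pi * Complex.I))) ?_
  · rintro _ ⟨n, hn, rfl⟩
    refine ⟨subset_closure hn, ?_⟩
    change ψ _ = _
    rw [h.apply_symm (by rw [hre]; exact hq), Complex.exp_add, Complex.exp_int_mul_two_pi_mul_I,
      mul_one]
  · intro m _ n _ hmn
    have h1 := φ.symm.injOn (h.mem_target (by rw [hre]; exact hq))
      (h.mem_target (by rw [hre]; exact hq)) hmn
    have h2 : ((m : ℂ) - n) * (2 * Real.pi * Complex.I) = 0 := by linear_combination h1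
    have h3 := (mul_eq_zero.1 h2).resolve_right Complex.two_pi_I_ne_zero
    exact_mod_cast sub_eq_zero.1 h3

theorem exists_ball_of_mem_nhds_coe {D : Set (OnePoint ℂ)} {w : ℂ}
    (hD : D ∈ 𝓝 ((w : ℂ) : OnePoint ℂ)) {η : ℝ} (hη : 0 < η) :
    ∃ ε, 0 < ε ∧ ε ≤ η ∧ ∀ u ∈ Metric.ball w ε, ((u : ℂ) : OnePoint ℂ) ∈ D := by
  have : ((↑) : ℂ → OnePoint ℂ) ⁻¹' D ∈ 𝓝 w :=
    (OnePoint.continuous_coe.tendsto w) hD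
  obtain ⟨ε, hε, h⟩ := Metric.mem_nhds_iff.1 this
  exact ⟨min ε η, lt_min hε hη, min_le_right _ _, fun u hu =>
    h (Metric.ball_subset_ball (min_le_left _ _) hu)⟩

variable [T2Space X] [LocallyCompactSpace X]

/-- Small connected pieces of preimages are trapped near points of the surface. -/
theorem IsSurfaceSpread.exists_trap (hψ : IsSurfaceSpread ψ) {x : X} {O : Set X} (hO : O ∈ 𝓝 x) :
    ∃ N : Set X, IsOpen N ∧ x ∈ N ∧ N ⊆ O ∧ IsCompact (closure N) ∧ ∃ D ∈ 𝓝 (ψ x),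
      ∀ S : Set X, IsPreconnected S → S ⊆ ψ ⁻¹' D → (S ∩ N).Nonempty → S ⊆ N := by
  obtain ⟨W, hW, hWx⟩ := nhds_inter_eq_singleton_of_mem_discrete (hψ.discrete (ψ x))
    (show x ∈ ψ ⁻¹' {ψ x} from rfl)
  obtain ⟨K, hK, hKO, hKc⟩ := local_compact_nhds (inter_mem hO hW)
  have hcl : closure (interior K) ⊆ K := closure_minimal interior_subset hKc.isClosed
  have hcc : IsCompact (closure (interior K)) := hKc.of_isClosed_subset isClosed_closure hcl
  have hfr : IsCompact (frontier (interior K)) :=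
    hcc.of_isClosed_subset isClosed_frontier frontier_subset_closure
  have hx : x ∈ interior K := mem_interior_iff_mem_nhds.2 hK
  -- As `x` is the only point of `K` over `ψ x`, the compact image of the frontier misses `ψ x`. A
  -- connected set over the complement of that image cannot cross the frontier.
  refine ⟨interior K, isOpen_interior, hx, interior_subset.trans (hKO.trans inter_subset_left), hcc,
    (ψ '' frontier (interior K))ᶜ, ?_, ?_⟩
  · refine (hfr.image hψ.continuous).isClosed.isOpen_compl.mem_nhds ?_
    rintro ⟨y, hy, hyx⟩
    have h1 : y ∈ W ∩ ψ ⁻¹' {ψ x} := ⟨(hKO (hcl (frontier_subset_closure hy))).2, hyx⟩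
    rw [hWx] at h1
    rw [isOpen_interior.frontier_eq] at hy
    exact hy.2 (h1 ▸ hx)
  · intro S hS hSD hSN
    refine hS.subset_of_closure_inter_subset isOpen_interior hSN fun y hy => ?_
    by_contra hyN
    refine hSD hy.2 ⟨y, ?_, rfl⟩
    rw [isOpen_interior.frontier_eq]
    exact ⟨hy.1, hyN⟩

/-- The logarithmic coordinate is locally bounded on the surface. -/
theorem IsStaircaseChart.locally_bounded (h : IsStaircaseChart ψ φ r c) (hψ : IsSurfaceSpread ψ)
    (x : X) : ∃ N ∈ 𝓝 x, ∃ R : ℝ, ∀ y ∈ N ∩ φ.source, ‖φ y‖ ≤ R := by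
  set B : Set (OnePoint ℂ) :=
    (fun z : ℂ => (((r : ℂ) + z : ℂ) : OnePoint ℂ)) '' Metric.closedBall 0 (Real.exp c) with hB
  have hBc : IsClosed B := ((isCompact_closedBall _ _).image
    (OnePoint.continuous_coe.comp (continuous_const.add continuous_id))).isClosed
  have hYB : ∀ y ∈ φ.source, ψ y ∈ B := fun y hy => by
    refine ⟨Complex.exp (φ y), ?_, (h.apply_eq y hy).symm⟩
    rw [mem_closedBall_zero_iff, Complex.norm_exp]
    exact Real.exp_le_exp.2 (h.re_lt hy).le
  by_cases hx : ψ x ∈ B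
  swap
  · refine ⟨ψ ⁻¹' Bᶜ, hψ.continuous.continuousAt (hBc.isOpen_compl.mem_nhds hx), 0, fun y hy => ?_⟩
    exact absurd (hYB y hy.2) hy.1
  obtain ⟨w, hw, hwx⟩ := hx
  simp only at hwx
  rw [mem_closedBall_zero_iff] at hw
  obtain ⟨N, hNo, hxN, -, hNc, D, hD, htrap⟩ := hψ.exists_trap (univ_mem (f := 𝓝 x))
  rw [← hwx] at hD
  -- Over `r` itself the staircase stays away from `x`: otherwise a whole half-plane of the
  -- coordinate would be trapped in `N`, although it contains infinitely many points over a single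
  -- value.
  by_cases hw0 : w = 0
  · subst hw0
    rw [add_zero] at hD hwx
    obtain ⟨ε, hε, -, hεD⟩ := exists_ball_of_mem_nhds_coe hD zero_lt_one
    have hVo : IsOpen (((↑) : ℂ → OnePoint ℂ) '' Metric.ball (r : ℂ) ε) :=
      OnePoint.isOpenEmbedding_coe.isOpenMap _ Metric.isOpen_ball
    refine ⟨N ∩ ψ ⁻¹' (((↑) : ℂ → OnePoint ℂ) '' Metric.ball (r : ℂ) ε),
      inter_mem (hNo.mem_nhds hxN) (hψ.continuous.continuousAt (hVo.mem_nhds ?_)), 0, ?_⟩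
    · rw [← hwx]; exact mem_image_of_mem _ (Metric.mem_ball_self hε)
    rintro y ⟨⟨hyN, u, hu, huy⟩, hyY⟩
    exfalso
    have hsub : ∀ z : ℂ, z.re < min c (Real.log ε) → φ.symm z ∈ N := by
      have hpre := h.isPreconnected_symm_image (convex_re_lt (min c (Real.log ε))).isPreconnected
        (fun z (hz : z.re < _) => lt_of_lt_of_le hz (min_le_left c (Real.log ε)))
      have hs := htrap _ hpre ?_ ⟨y, ⟨φ y, ?_, φ.left_inv hyY⟩, hyN⟩
      · exact fun z hz => hs (mem_image_of_mem _ hz)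
      · rintro _ ⟨z, hz, rfl⟩
        change ψ _ ∈ D
        rw [h.apply_symm (lt_of_lt_of_le hz (min_le_left _ _))]
        refine hεD _ ?_
        rw [mem_ball_iff_norm, add_sub_cancel_left, Complex.norm_exp, ← Real.lt_log_iff_exp_lt hε]
        exact lt_of_lt_of_le hz (min_le_right _ _)
      · refine lt_min (h.re_lt hyY) ?_
        rw [h.apply_eq y hyY] at huy
        have := OnePoint.coe_injective huy
        rw [this, mem_ball_iff_norm, add_sub_cancel_left, Complex.norm_exp] at hu
        rwa [Real.lt_log_iff_exp_lt hε]
    have hfin := h.finite_sheets hψ hNc (q := ((min c (Real.log ε) - 1 : ℝ) : ℂ))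
      (by rw [Complex.ofReal_re]; linarith [min_le_left c (Real.log ε)])
    refine Set.infinite_univ (α := ℤ) (hfin.subset fun n _ => hsub _ ?_)
    have : (((min c (Real.log ε) - 1 : ℝ) : ℂ) + n * (2 * Real.pi * Complex.I)).re
        = min c (Real.log ε) - 1 := by simp
    rw [this]
    exact sub_one_lt _
  -- Over `r + w` with `w ≠ 0`, the disc of radius at most `|w|/2` about `w` carries all branches `ℓ
  -- n` of the logarithm, and `A` is the convex part of it covered by `Y`. A branch which meets `N`
  -- is trapped in `N` over all of `A`, so only finitely many `n` occur, and each branch is bounded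
  -- on `A`.
  · obtain ⟨ε, hε, hεw, hεD⟩ := exists_ball_of_mem_nhds_coe hD (half_pos (norm_pos_iff.2 hw0))
    set A : Set ℂ := Metric.ball w ε ∩ Metric.ball 0 (Real.exp c) with hA
    have hAcv : Convex ℝ A := (convex_ball _ _).inter (convex_ball _ _)
    have hdiv : ∀ u ∈ A, u / w ∈ Metric.closedBall (1 : ℂ) (1 / 2) := fun u hu => by
      rw [mem_closedBall_iff_norm]
      have : u / w - 1 = (u - w) / w := by field_simp
      rw [this, norm_div, div_le_iff₀ (norm_pos_iff.2 hw0)]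
      have := mem_ball_iff_norm.1 hu.1
      linarith
    have hslit : ∀ u ∈ Metric.closedBall (1 : ℂ) (1 / 2), u ∈ Complex.slitPlane := fun u hu => by
      left
      have h1 := (Complex.abs_re_le_norm (u - 1)).trans (mem_closedBall_iff_norm.1 hu)
      rw [Complex.sub_re, Complex.one_re, abs_le] at h1
      linarith [h1.1]
    have hA0 : ∀ u ∈ A, u ≠ 0 := fun u hu hu0 => by
      have := hslit _ (hdiv u hu)
      simp [hu0] at this
    set ℓ : ℤ → ℂ → ℂ := fun n u => Complex.log (u / w) + Complex.log w + n * (2 * Real.pi * Complex.I)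
      with hℓ
    have hℓexp : ∀ n, ∀ u ∈ A, Complex.exp (ℓ n u) = u := fun n u hu => by
      rw [hℓ]
      simp only
      rw [Complex.exp_add, Complex.exp_int_mul_two_pi_mul_I, mul_one, Complex.exp_add,
        Complex.exp_log (div_ne_zero (hA0 u hu) hw0), Complex.exp_log hw0, div_mul_cancel₀ _ hw0]
    have hℓre : ∀ n, ∀ u ∈ A, (ℓ n u).re < c := fun n u hu => by
      rw [← Real.exp_lt_exp, ← Complex.norm_exp, hℓexp n u hu]
      exact mem_ball_zero_iff.1 hu.2
    have hℓc : ∀ n, ContinuousOn (ℓ n) A := fun n => by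
      refine ContinuousOn.add (ContinuousOn.add ?_ continuousOn_const) continuousOn_const
      exact (continuousOn_id.div_const w).clog fun u hu => hslit _ (hdiv u hu)
    have htrapn : ∀ n, (∃ u ∈ A, φ.symm (ℓ n u) ∈ N) → ∀ u ∈ A, φ.symm (ℓ n u) ∈ N := by
      rintro n ⟨u₀, hu₀, hu₀N⟩ u hu
      have hpre : IsPreconnected (φ.symm '' (ℓ n '' A)) := by
        refine h.isPreconnected_symm_image (hAcv.isPreconnected.image _ (hℓc n)) ?_
        rintro _ ⟨v, hv, rfl⟩; exact hℓre n v hv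
      refine htrap _ hpre ?_ ⟨_, mem_image_of_mem _ (mem_image_of_mem _ hu₀), hu₀N⟩
        (mem_image_of_mem _ (mem_image_of_mem _ hu))
      rintro _ ⟨_, ⟨v, hv, rfl⟩, rfl⟩
      change ψ _ ∈ D
      rw [h.apply_symm (hℓre n v hv), hℓexp n v hv]
      refine hεD _ ?_
      rw [mem_ball_iff_norm, add_sub_add_left_eq_sub]
      exact mem_ball_iff_norm.1 hv.1
    obtain ⟨M, hM⟩ := (isCompact_closedBall (1 : ℂ) (1 / 2)).exists_bound_of_continuousOn
      (f := Complex.log) (continuousOn_id.clog hslit)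
    have hfin : {n : ℤ | ∃ u ∈ A, φ.symm (ℓ n u) ∈ N}.Finite := by
      by_cases hAe : A.Nonempty
      · obtain ⟨q, hq⟩ := hAe
        refine (h.finite_sheets hψ hNc (q := ℓ 0 q) (hℓre 0 q hq)).subset fun n hn => ?_
        have := htrapn n hn q hq
        have e : ℓ n q = ℓ 0 q + n * (2 * Real.pi * Complex.I) := by simp [hℓ]
        rwa [e] at this
      · refine Set.finite_empty.subset fun n hn => ?_
        obtain ⟨u, hu, -⟩ := hn
        exact hAe ⟨u, hu⟩
    obtain ⟨R, hR⟩ := (hfin.image fun n : ℤ => ‖(n : ℂ) * (2 * Real.pi * Complex.I)‖).bddAbove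
    have hVo : IsOpen (((↑) : ℂ → OnePoint ℂ) '' Metric.ball ((r : ℂ) + w) ε) :=
      OnePoint.isOpenEmbedding_coe.isOpenMap _ Metric.isOpen_ball
    refine ⟨N ∩ ψ ⁻¹' (((↑) : ℂ → OnePoint ℂ) '' Metric.ball ((r : ℂ) + w) ε),
      inter_mem (hNo.mem_nhds hxN) (hψ.continuous.continuousAt (hVo.mem_nhds ?_)),
      M + ‖Complex.log w‖ + R, ?_⟩
    · rw [← hwx]; exact mem_image_of_mem _ (Metric.mem_ball_self hε)
    rintro y ⟨⟨hyN, u, hu, huy⟩, hyY⟩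
    rw [h.apply_eq y hyY] at huy
    have huy' := OnePoint.coe_injective huy
    have hyA : Complex.exp (φ y) ∈ A := by
      refine ⟨?_, ?_⟩
      · rw [huy', mem_ball_iff_norm, add_sub_add_left_eq_sub] at hu
        exact mem_ball_iff_norm.2 hu
      · rw [mem_ball_zero_iff, Complex.norm_exp]
        exact Real.exp_lt_exp.2 (h.re_lt hyY)
    obtain ⟨n, hn⟩ := Complex.exp_eq_exp_iff_exists_int.1 (hℓexp 0 _ hyA).symm
    have hn' : φ y = ℓ n (Complex.exp (φ y)) := by
      conv_lhs => rw [hn]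
      simp [hℓ]
    have hmem : n ∈ {n : ℤ | ∃ u ∈ A, φ.symm (ℓ n u) ∈ N} :=
      ⟨_, hyA, by rw [← hn', φ.left_inv hyY]; exact hyN⟩
    rw [hn']
    refine (norm_add₃_le).trans ?_
    gcongr
    · exact hM _ (hdiv _ hyA)
    · exact hR (mem_image_of_mem _ hmem)

end Staircase

/-! ### The boundary line of a staircase and curves tending to infinity -/

section StaircaseBoundary

variable {X : Type*} [TopologicalSpace X] [T2Space X] [LocallyCompactSpace X]
  {ψ : X → OnePoint ℂ} {φ : OpenPartialHomeomorph X ℂ} {r c : ℝ}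

/-- Curves in the staircase whose logarithmic coordinate is unbounded leave every compact set. -/
theorem IsStaircaseChart.tendsto_cocompact (h : IsStaircaseChart ψ φ r c) (hψ : IsSurfaceSpread ψ)
    {α : Type*} {l : Filter α} {γ : α → X} (hγ : ∀ᶠ t in l, γ t ∈ φ.source)
    (hu : Tendsto (fun t => ‖φ (γ t)‖) l atTop) : Tendsto γ l (cocompact X) := by
  rw [(hasBasis_cocompact).tendsto_right_iff]
  intro K hK
  have hb : ∃ R : ℝ, ∀ y ∈ K ∩ φ.source, ‖φ y‖ ≤ R := by
    refine hK.induction_on (p := fun S => ∃ R : ℝ, ∀ y ∈ S ∩ φ.source, ‖φ y‖ ≤ R) ⟨0, by simp⟩ ?_ ?_ ?_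
    · rintro S T hST ⟨R, hR⟩
      exact ⟨R, fun y hy => hR y ⟨hST hy.1, hy.2⟩⟩
    · rintro S T ⟨R, hR⟩ ⟨R', hR'⟩
      refine ⟨max R R', ?_⟩
      rintro y ⟨hy | hy, hyY⟩
      · exact (hR y ⟨hy, hyY⟩).trans (le_max_left _ _)
      · exact (hR' y ⟨hy, hyY⟩).trans (le_max_right _ _)
    · intro x _
      obtain ⟨N, hN, R, hR⟩ := h.locally_bounded hψ x
      exact ⟨N, mem_nhdsWithin_of_mem_nhds hN, R, hR⟩
  obtain ⟨R, hR⟩ := hb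
  filter_upwards [hγ, hu.eventually_gt_atTop R] with t h1 h2 h3
  exact absurd (hR _ ⟨h3, h1⟩) (not_le.2 h2)

/-- Boundary points of the staircase are limits of boundary points in the logarithmic coordinate. -/
theorem IsStaircaseChart.exists_mapClusterPt (h : IsStaircaseChart ψ φ r c)
    (hψ : IsSurfaceSpread ψ) {x : X} (hx : x ∈ frontier φ.source) :
    ∃ ζ : ℂ, ζ.re = c ∧ MapClusterPt ζ (𝓝[φ.source] x) φ ∧
      ψ x = (((r : ℂ) + Complex.exp ζ : ℂ) : OnePoint ℂ) := by
  rw [φ.open_source.frontier_eq] at hx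
  have hne : NeBot (𝓝[φ.source] x) := mem_closure_iff_nhdsWithin_neBot.1 hx.1
  obtain ⟨N, hN, R, hR⟩ := h.locally_bounded hψ x
  have hev : ∀ᶠ y in 𝓝[φ.source] x, φ y ∈ Metric.closedBall (0 : ℂ) R ∩ {z : ℂ | z.re ≤ c} := by
    filter_upwards [mem_nhdsWithin_of_mem_nhds hN, self_mem_nhdsWithin] with y h1 h2
    exact ⟨mem_closedBall_zero_iff.2 (hR y ⟨h1, h2⟩), (h.re_lt h2).le⟩
  obtain ⟨ζ, ⟨-, hζ⟩, hcl⟩ := ((isCompact_closedBall (0 : ℂ) R).inter_right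
    (isClosed_le Complex.continuous_re continuous_const)).exists_mapClusterPt
    (f := 𝓝[φ.source] x) (u := φ) (by rwa [le_principal_iff, mem_map])
  refine ⟨ζ, ?_, hcl, ?_⟩
  -- If `ζ` were interior to the half-plane, continuity of `φ.symm` at `ζ` would put `x` into the
  -- open set `φ.source`.
  · refine le_antisymm hζ (not_lt.1 fun hlt => hx.2 ?_)
    have h1 := hcl.continuousAt_comp (φ.continuousAt_symm (h.mem_target hlt))
    have h2 : Tendsto (φ.symm ∘ φ) (𝓝[φ.source] x) (𝓝 x) := by
      refine (tendsto_id.mono_left nhdsWithin_le_nhds).congr' ?_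
      filter_upwards [self_mem_nhdsWithin] with y hy using (φ.left_inv hy).symm
    rw [← h1.eq_of_tendsto h2]
    exact h.symm_mem hlt
  · have hc : Continuous fun z : ℂ => (((r : ℂ) + Complex.exp z : ℂ) : OnePoint ℂ) :=
      OnePoint.continuous_coe.comp (by fun_prop)
    have h1 := hcl.continuousAt_comp hc.continuousAt
    refine (h1.eq_of_tendsto ?_).symm
    refine (hψ.continuous.continuousAt.tendsto.mono_left nhdsWithin_le_nhds).congr' ?_
    filter_upwards [self_mem_nhdsWithin] with y hy using h.apply_eq y hy

/-- The inverse of the logarithmic coordinate extends continuously to the boundary line. -/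
theorem IsStaircaseChart.exists_tendsto_symm (h : IsStaircaseChart ψ φ r c)
    (hasym : ∀ p, IsAsymptoticValueIn ψ φ.source p → p = ((r : ℂ) : OnePoint ℂ))
    (hψ : IsSurfaceSpread ψ) {ζ : ℂ} (hζ : ζ.re = c) :
    ∃ x ∈ frontier φ.source, Tendsto φ.symm (𝓝[{z : ℂ | z.re < c}] ζ) (𝓝 x) := by
  -- A horizontal approach to `ζ`; the absolute value makes it continuous on the whole line.
  set u : ℝ → ℂ := fun t => ζ - ((1 + |t|)⁻¹ : ℝ) with hu
  have hut : Tendsto u atTop (𝓝[{z : ℂ | z.re < c}] ζ) := by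
    refine tendsto_nhdsWithin_iff.2 ⟨?_, Eventually.of_forall fun t => ?_⟩
    · have h1 : Tendsto (fun t : ℝ => (1 + |t|)⁻¹) atTop (𝓝 0) :=
        (tendsto_atTop_add_const_left _ _ tendsto_abs_atTop_atTop).inv_tendsto_atTop
      have h2 := ((Complex.continuous_ofReal.tendsto 0).comp h1).const_sub ζ
      simpa [hu] using h2
    · simp only [hu, mem_ofPred_eq, Complex.sub_re, Complex.ofReal_re, hζ]
      have : 0 < (1 + |t|)⁻¹ := by positivity
      linarith
  have hure : ∀ t, (u t).re < c := fun t => by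
    simp only [hu, Complex.sub_re, Complex.ofReal_re, hζ]
    have : 0 < (1 + |t|)⁻¹ := by positivity
    linarith
  have huc : Continuous u := by
    have : Continuous fun t : ℝ => (1 + |t|)⁻¹ :=
      Continuous.inv₀ (by fun_prop) fun t => by positivity
    exact continuous_const.sub (Complex.continuous_ofReal.comp this)
  have hc : Continuous fun z : ℂ => (((r : ℂ) + Complex.exp z : ℂ) : OnePoint ℂ) :=
    OnePoint.continuous_coe.comp (by fun_prop)
  have hψu : Tendsto (fun t => ψ (φ.symm (u t))) atTop
      (𝓝 (((r : ℂ) + Complex.exp ζ : ℂ) : OnePoint ℂ)) := by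
    refine ((hc.tendsto ζ).comp (hut.mono_right nhdsWithin_le_nhds)).congr fun t => ?_
    exact (h.apply_symm (hure t)).symm
  -- The projection tends to `r + e^ζ ≠ r` along this curve, so the curve does not tend to infinity.
  -- It returns to a fixed compact set at arbitrarily large times and has a cluster point there.
  have hnot : ¬ Tendsto (fun t => φ.symm (u t)) atTop (cocompact X) := fun hco => by
    have := hasym _ ⟨fun t => φ.symm (u t), ?_, fun t _ => h.symm_mem (hure t), hco, hψu⟩
    · have := OnePoint.coe_injective this
      exact Complex.exp_ne_zero ζ (by linear_combination this)
    · exact (φ.continuousOn_symm.comp huc.continuousOn fun t _ => h.mem_target (hure t))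
  rw [(hasBasis_cocompact).tendsto_right_iff] at hnot
  push Not at hnot
  obtain ⟨K, hK, hfr⟩ := hnot
  have hfr' : ∃ᶠ t in atTop, φ.symm (u t) ∈ K := by
    refine hfr.mono fun t ht => ?_
    simpa using ht
  obtain ⟨x, -, hx⟩ := hK.exists_mapClusterPt_of_frequently hfr'
  have hψx : ψ x = (((r : ℂ) + Complex.exp ζ : ℂ) : OnePoint ℂ) :=
    (hx.continuousAt_comp hψ.continuous.continuousAt).eq_of_tendsto hψu
  have hxY : x ∉ φ.source := fun hxY => by
    have h1 := hx.continuousAt_comp (φ.continuousAt hxY)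
    have h2 : Tendsto (φ ∘ fun t => φ.symm (u t)) atTop (𝓝 ζ) := by
      refine (hut.mono_right nhdsWithin_le_nhds).congr fun t => ?_
      exact (φ.right_inv (h.mem_target (hure t))).symm
    have h3 := h1.eq_of_tendsto h2
    have h4 := h.re_lt hxY
    rw [h3, hζ] at h4
    exact lt_irrefl _ h4
  -- A half-disc about `ζ` is connected, so the trap turns the cluster point along one curve into a
  -- limit from the half-plane.
  have hlim : Tendsto φ.symm (𝓝[{z : ℂ | z.re < c}] ζ) (𝓝 x) := by
    intro O hO
    obtain ⟨N, hNo, hxN, hNO, -, D, hD, htrap⟩ := hψ.exists_trap hO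
    rw [hψx] at hD
    obtain ⟨δ, hδ, hδD⟩ := Metric.mem_nhds_iff.1 (hc.continuousAt hD)
    have hpre := h.isPreconnected_symm_image
      ((convex_ball ζ δ).inter (convex_re_lt c)).isPreconnected inter_subset_right
    have hmem : Metric.ball ζ δ ∩ {z : ℂ | z.re < c} ∈ 𝓝[{z : ℂ | z.re < c}] ζ :=
      inter_mem (mem_nhdsWithin_of_mem_nhds (Metric.ball_mem_nhds ζ hδ)) self_mem_nhdsWithin
    have hfrN := hx.frequently (p := (· ∈ N)) (hNo.mem_nhds hxN)
    obtain ⟨t, ht1, ht2⟩ := (hfrN.and_eventually (hut hmem)).exists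
    have hs := htrap _ hpre ?_ ⟨_, mem_image_of_mem _ ht2, ht1⟩
    · refine mem_map.2 (mem_of_superset hmem fun z hz => ?_)
      exact hNO (hs ⟨z, hz, rfl⟩)
    · rintro _ ⟨z, hz, rfl⟩
      change ψ _ ∈ D
      rw [h.apply_symm hz.2]
      exact hδD hz.1
  refine ⟨x, ?_, hlim⟩
  rw [φ.open_source.frontier_eq]
  refine ⟨mem_closure_of_tendsto (hlim.comp hut) (Eventually.of_forall fun t => h.symm_mem (hure t)), hxY⟩

/-- Every boundary point of the staircase lies on the image of the boundary line. -/
theorem IsStaircaseChart.exists_tendsto_of_mem_frontier (h : IsStaircaseChart ψ φ r c)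
    (hasym : ∀ p, IsAsymptoticValueIn ψ φ.source p → p = ((r : ℂ) : OnePoint ℂ))
    (hψ : IsSurfaceSpread ψ) {x : X} (hx : x ∈ frontier φ.source) :
    ∃ ζ : ℂ, ζ.re = c ∧ Tendsto φ.symm (𝓝[{z : ℂ | z.re < c}] ζ) (𝓝 x) ∧
      ψ x = (((r : ℂ) + Complex.exp ζ : ℂ) : OnePoint ℂ) := by
  obtain ⟨ζ, hζ, hcl, hψx⟩ := h.exists_mapClusterPt hψ hx
  obtain ⟨x', -, hx'⟩ := h.exists_tendsto_symm hasym hψ hζ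
  refine ⟨ζ, hζ, ?_, hψx⟩
  -- Near `x` the coordinate clusters at `ζ`, where its inverse has the limit `x'`. So `x'` is a
  -- cluster point of the identity at `x`, hence equal to `x`.
  have h1 : MapClusterPt x' (𝓝[φ.source] x) (φ.symm ∘ φ) := by
    refine hcl.tendsto_comp' (hx'.mono_left (le_inf inf_le_left ?_))
    refine inf_le_right.trans (le_principal_iff.2 (mem_map.2 ?_))
    filter_upwards [self_mem_nhdsWithin] with y hy using h.re_lt hy
  have h2 : Tendsto (φ.symm ∘ φ) (𝓝[φ.source] x) (𝓝 x) := by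
    refine (tendsto_id.mono_left nhdsWithin_le_nhds).congr' ?_
    filter_upwards [self_mem_nhdsWithin] with y hy using (φ.left_inv hy).symm
  rwa [h1.eq_of_tendsto h2] at hx'

/-- Along a curve in the staircase which leaves every compact subset of the surface, the
logarithmic coordinate is unbounded. -/
theorem IsStaircaseChart.not_eventually_bounded (h : IsStaircaseChart ψ φ r c)
    (hasym : ∀ p, IsAsymptoticValueIn ψ φ.source p → p = ((r : ℂ) : OnePoint ℂ))
    (hψ : IsSurfaceSpread ψ) {γ : ℝ → X} (hγ : ∀ᶠ t in atTop, γ t ∈ φ.source)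
    (hco : Tendsto γ atTop (cocompact X)) (R : ℝ) : ¬ ∀ᶠ t in atTop, ‖φ (γ t)‖ ≤ R := by
  intro hb
  have hnc : ∀ x, ¬ MapClusterPt x atTop γ := fun x hx => by
    obtain ⟨K, hK, hxK⟩ := exists_compact_mem_nhds x
    have h1 := hx.frequently (p := (· ∈ K)) hxK
    obtain ⟨t, ht, ht'⟩ := (h1.and_eventually (hco hK.compl_mem_cocompact)).exists
    exact ht' ht
  have hev : ∀ᶠ t in atTop, φ (γ t) ∈ Metric.closedBall (0 : ℂ) R ∩ {z : ℂ | z.re ≤ c} := by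
    filter_upwards [hb, hγ] with t h1 h2
    exact ⟨mem_closedBall_zero_iff.2 h1, (h.re_lt h2).le⟩
  obtain ⟨ζ, ⟨-, hζ⟩, hcl⟩ := ((isCompact_closedBall (0 : ℂ) R).inter_right
    (isClosed_le Complex.continuous_re continuous_const)).exists_mapClusterPt
    (f := atTop) (u := fun t => φ (γ t)) (by rwa [le_principal_iff, mem_map])
  have hcongr : (φ.symm ∘ fun t => φ (γ t)) =ᶠ[atTop] γ := by
    filter_upwards [hγ] with t ht using φ.left_inv ht
  rcases lt_or_eq_of_le (show ζ.re ≤ c from hζ) with hlt | heq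
  · have h1 := hcl.continuousAt_comp (φ.continuousAt_symm (h.mem_target hlt))
    exact hnc _ (h1.congrFun hcongr)
  · obtain ⟨x', -, hx'⟩ := h.exists_tendsto_symm hasym hψ heq
    have h1 : MapClusterPt x' atTop (φ.symm ∘ fun t => φ (γ t)) := by
      refine hcl.tendsto_comp' (hx'.mono_left (le_inf inf_le_left ?_))
      refine inf_le_right.trans (le_principal_iff.2 (mem_map.2 ?_))
      filter_upwards [hγ] with t ht using h.re_lt ht
    exact hnc _ (h1.congrFun hcongr)

end StaircaseBoundary

/-! ### Analytic lemmas for the splicing of the model map into the surface -/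

/-- By continuity the imaginary part of `h w - h z` stays in `(-π, π)`, so this difference is the
principal logarithm of `e^{h w - h z}`. -/
theorem hasDerivAt_of_exp {h : ℂ → ℂ} {z q : ℂ} (hc : ContinuousAt h z)
    (hq : HasDerivAt (fun w => Complex.exp (h w)) q z) :
    HasDerivAt h (q / Complex.exp (h z)) z := by
  have h1 : HasDerivAt (fun w => Complex.exp (h w) / Complex.exp (h z)) (q / Complex.exp (h z)) z :=
    hq.div_const _
  have h2 := h1.clog (by rw [div_self (Complex.exp_ne_zero _)]; exact Complex.one_mem_slitPlane)
  rw [div_self (Complex.exp_ne_zero _), div_one] at h2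
  have h3 := h2.add_const (h z)
  refine h3.congr_of_eventuallyEq ?_
  have hev : ∀ᶠ w in 𝓝 z, ‖h w - h z‖ < Real.pi :=
    (hc.sub continuousAt_const).norm.eventually (gt_mem_nhds (by simpa using Real.pi_pos))
  filter_upwards [hev] with w hw
  have him := abs_lt.1 ((Complex.abs_im_le_norm _).trans_lt hw)
  rw [← Complex.exp_sub, Complex.log_exp him.1 him.2.le, sub_add_cancel]

/-- A continuous function which is differentiable with bounded derivative away from its zeros is
Lipschitz. -/
theorem norm_sub_le_of_fderiv_bound_off_zeros {u : ℂ → ℂ} {B O : Set ℂ} {C : ℝ} (hB : Convex ℝ B)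
    (hu : ContinuousOn u B) (hO : IsOpen O) (h0 : ∀ z ∈ B, z ∉ O → u z = 0)
    (hd : ∀ z ∈ B ∩ O, ∃ L : ℂ →L[ℝ] ℂ, HasFDerivAt u L z ∧ ‖L‖ ≤ C) {x y : ℂ} (hx : x ∈ B)
    (hy : y ∈ B) (hC : 0 ≤ C) : ‖u x - u y‖ ≤ C * ‖x - y‖ := by
  -- Follow the segment from `x` towards `p` up to its first point outside `O`: the function
  -- vanishes there, and before it the derivative bound applies.
  have key : ∀ x ∈ B, ∀ p ∈ B, p ∉ O → ‖u x‖ ≤ C * ‖x - p‖ := by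
    intro x hx p hp hpO
    by_cases hxO : x ∈ O
    swap
    · rw [h0 x hx hxO, norm_zero]; positivity
    set γ : ℝ → ℂ := ⇑(AffineMap.lineMap (k := ℝ) x p) with hγ
    have hγc : Continuous γ := AffineMap.lineMap_continuous
    have hγB : ∀ s ∈ Icc (0 : ℝ) 1, γ s ∈ B := fun s hs =>
      hB.segment_subset hx hp (by rw [segment_eq_image_lineMap]; exact ⟨s, hs, rfl⟩)
    have hS : IsCompact (Icc (0 : ℝ) 1 ∩ γ ⁻¹' Oᶜ) :=
      isCompact_Icc.inter_right (hO.isClosed_compl.preimage hγc)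
    obtain ⟨s, ⟨hs, hsO⟩, hmin⟩ := hS.exists_isLeast ⟨1, ⟨zero_le_one, le_rfl⟩, by simpa [hγ] using hpO⟩
    have hlt : ∀ t ∈ Ico 0 s, γ t ∈ O := fun t ht => by
      by_contra h
      exact not_le.2 ht.2 (hmin ⟨⟨ht.1, ht.2.le.trans hs.2⟩, h⟩)
    have hmem : ∀ t ∈ Ico 0 s, γ t ∈ B ∩ O := fun t ht =>
      ⟨hγB t ⟨ht.1, ht.2.le.trans hs.2⟩, hlt t ht⟩
    choose! L hL1 hL2 using hd
    have hγd : ∀ t, HasDerivAt γ (p - x) t := fun t => AffineMap.hasDerivAt_lineMap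
    have hcont : ContinuousOn (u ∘ γ) (Icc 0 s) := hu.comp hγc.continuousOn fun t ht =>
      hγB t ⟨ht.1, ht.2.trans hs.2⟩
    have := norm_image_sub_le_of_norm_deriv_right_le_segment hcont
      (f' := fun t => L (γ t) (p - x)) (C := C * ‖p - x‖)
      (fun t ht => ((hL1 _ (hmem t ht)).comp_hasDerivAt t (hγd t)).hasDerivWithinAt)
      (fun t ht => ((L (γ t)).le_opNorm _).trans
        (mul_le_mul_of_nonneg_right (hL2 _ (hmem t ht)) (norm_nonneg _))) s ⟨hs.1, le_rfl⟩
    simp only [Function.comp_apply, h0 _ (hγB s hs) hsO, zero_sub, norm_neg, sub_zero] at this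
    have e0 : γ 0 = x := by simp [hγ]
    rw [e0, norm_sub_rev p x] at this
    refine this.trans (mul_le_of_le_one_right (by positivity) hs.2)
  by_cases hseg : segment ℝ x y ⊆ O
  · have hsB := hB.segment_subset hx hy
    choose! L hL1 hL2 using hd
    have := (convex_segment x y).norm_image_sub_le_of_norm_hasFDerivWithin_le (f := u) (f' := L)
      (C := C) (fun z hz => (hL1 z ⟨hsB hz, hseg hz⟩).hasFDerivWithinAt)
      (fun z hz => hL2 z ⟨hsB hz, hseg hz⟩) (right_mem_segment ℝ x y) (left_mem_segment ℝ x y)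
    exact this
  -- A segment which leaves `O` is split at a point outside `O`, and the two distances add up.
  · obtain ⟨p, hp, hpO⟩ := not_subset.1 hseg
    have hpB := hB.segment_subset hx hy hp
    have h1 := key x hx p hpB hpO
    have h2 := key y hy p hpB hpO
    have h3 := dist_add_dist_of_mem_segment hp
    rw [dist_eq_norm, dist_eq_norm, dist_eq_norm] at h3
    rw [← h3, mul_add, norm_sub_rev p y]
    exact (norm_sub_le _ _).trans (add_le_add h1 h2)

/-- Holomorphic functions pull back null sets to null sets near noncritical points. -/
theorem exists_nhds_volume_preimage_eq_zero {f : ℂ → ℂ} {z : ℂ} (hf : AnalyticAt ℂ f z)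
    (hd : deriv f z ≠ 0) {S : Set ℂ} (hS : volume S = 0) :
    ∃ V ∈ 𝓝 z, volume (V ∩ f ⁻¹' S) = 0 := by
  have hstrict : HasStrictDerivAt f (deriv f z) z := hf.hasStrictDerivAt
  set P := (hstrict.hasStrictFDerivAt_equiv hd).toOpenPartialHomeomorph f with hP
  have hPf : ∀ w, P w = f w := fun w => by rw [hP, HasStrictFDerivAt.toOpenPartialHomeomorph_coe]
  have hzP : z ∈ P.source := (hstrict.hasStrictFDerivAt_equiv hd).mem_toOpenPartialHomeomorph_source
  have h1 : ∀ᶠ w in 𝓝 z, AnalyticAt ℂ f w := hf.eventually_analyticAt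
  have h2 : ∀ᶠ w in 𝓝 z, deriv f w ≠ 0 := hf.deriv.continuousAt.eventually_ne hd
  have h3 : ∀ᶠ w in 𝓝 z, w ∈ P.source := P.open_source.mem_nhds hzP
  refine ⟨{w | (AnalyticAt ℂ f w ∧ deriv f w ≠ 0) ∧ w ∈ P.source}, (h1.and h2).and h3, ?_⟩
  set V := {w | (AnalyticAt ℂ f w ∧ deriv f w ≠ 0) ∧ w ∈ P.source}
  set S' : Set ℂ := {a | a ∈ S ∧ a ∈ P.target ∧ P.symm a ∈ V} with hS'
  have hsub : V ∩ f ⁻¹' S ⊆ P.symm '' S' := by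
    rintro w ⟨hw, hwS⟩
    refine ⟨P w, ⟨by rw [hPf]; exact hwS, P.map_source hw.2, by rwa [P.left_inv hw.2]⟩, P.left_inv hw.2⟩
  have hdiff : DifferentiableOn ℝ P.symm S' := by
    rintro a ⟨-, ha, ⟨ha1, ha2⟩, -⟩
    have hda : HasDerivAt P (deriv f (P.symm a)) (P.symm a) :=
      (ha1.differentiableAt.hasDerivAt).congr_of_eventuallyEq (Eventually.of_forall hPf)
    exact ((P.hasDerivAt_symm ha ha2 hda).differentiableAt.restrictScalars ℝ).differentiableWithinAt
  exact measure_mono_null hsub (addHaar_image_eq_zero_of_differentiableOn_of_addHaar_eq_zero _ hdiff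
    (measure_mono_null (fun a ha => ha.1) hS))

/-- A holomorphic function with discrete fibres pulls back null sets to null sets. -/
theorem volume_preimage_eq_zero_of_discrete {f : ℂ → ℂ} {U : Set ℂ} (hU : IsOpen U)
    (hf : DifferentiableOn ℂ f U) (hne : ∀ z ∈ U, ∀ᶠ w in 𝓝[≠] z, f w ≠ f z) {S : Set ℂ}
    (hS : volume S = 0) : volume (U ∩ f ⁻¹' S) = 0 := by
  have han : ∀ z ∈ U, AnalyticAt ℂ f z := fun z hz => hf.analyticAt (hU.mem_nhds hz)
  refine measure_null_of_locally_null _ fun z hz => ?_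
  by_cases hd : deriv f z = 0
  swap
  · obtain ⟨V, hV, h0⟩ := exists_nhds_volume_preimage_eq_zero (han z hz.1) hd hS
    refine ⟨V ∩ f ⁻¹' S, ?_, h0⟩
    exact mem_of_superset (inter_mem (mem_nhdsWithin_of_mem_nhds hV) self_mem_nhdsWithin)
      fun w hw => ⟨hw.1, hw.2.2⟩
  -- A critical point is isolated, because otherwise `f` would be locally constant. It contributes
  -- one point, and the noncritical case applies around it.
  have hev : ∀ᶠ w in 𝓝[≠] z, deriv f w ≠ 0 := by
    refine ((han z hz.1).deriv.eventually_eq_zero_or_eventually_ne_zero).resolve_left fun h0 => ?_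
    obtain ⟨δ, hδ, hball⟩ := Metric.mem_nhds_iff.1 (inter_mem h0 (hU.mem_nhds hz.1))
    have hconst : ∀ w ∈ Metric.ball z δ, f w = f z := fun w hw => by
      have := (convex_ball z δ).norm_image_sub_le_of_norm_deriv_le (f := f) (C := 0)
        (fun v hv => (han v (hball hv).2).differentiableAt)
        (fun v hv => by rw [show deriv f v = 0 from (hball hv).1, norm_zero])
        (Metric.mem_ball_self hδ) hw
      rw [zero_mul, norm_le_zero_iff, sub_eq_zero] at this
      exact this
    have hc : ∀ᶠ w in 𝓝[≠] z, f w = f z :=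
      mem_nhdsWithin_of_mem_nhds (mem_of_superset (Metric.ball_mem_nhds z hδ) hconst)
    obtain ⟨w, hw1, hw2⟩ := (hc.and (hne z hz.1)).exists
    exact hw2 hw1
  obtain ⟨W, hW, hWd⟩ := (eventually_nhdsWithin_iff.1 hev).exists_mem
  refine ⟨(W ∩ U) ∩ f ⁻¹' S, ?_, ?_⟩
  · exact mem_of_superset (inter_mem (mem_nhdsWithin_of_mem_nhds hW) self_mem_nhdsWithin)
      fun w hw => ⟨⟨hw.1, hw.2.1⟩, hw.2.2⟩
  · have hsub : (W ∩ U) ∩ f ⁻¹' S ⊆ {z} ∪ {w | w ∈ W ∧ w ∈ U ∧ w ≠ z ∧ f w ∈ S} := fun w hw => by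
      by_cases hwz : w = z
      · exact Or.inl hwz
      · exact Or.inr ⟨hw.1.1, hw.1.2, hwz, hw.2⟩
    refine measure_mono_null hsub (measure_union_null (measure_singleton z) ?_)
    refine measure_null_of_locally_null _ fun w hw => ?_
    obtain ⟨V, hV, h0⟩ := exists_nhds_volume_preimage_eq_zero (han w hw.2.1) (hWd w hw.1 hw.2.2.1) hS
    refine ⟨V ∩ f ⁻¹' S, ?_, h0⟩
    exact mem_of_superset (inter_mem (mem_nhdsWithin_of_mem_nhds hV) self_mem_nhdsWithin)
      fun w hw => ⟨hw.1, hw.2.2.2.2⟩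

/-! ### Splicing the model map into a staircase -/

theorem affineCoord_coe (z : ℂ) : affineCoord (z : OnePoint ℂ) = z := rfl

theorem coe_affineCoord {p : OnePoint ℂ} (hp : p ≠ OnePoint.infty) :
    ((affineCoord p : ℂ) : OnePoint ℂ) = p := by
  obtain ⟨z, rfl⟩ := OnePoint.ne_infty_iff_exists.1 hp
  rfl

theorem continuousAt_affineCoord {p : OnePoint ℂ} (hp : p ≠ OnePoint.infty) :
    ContinuousAt affineCoord p := by
  obtain ⟨z, rfl⟩ := OnePoint.ne_infty_iff_exists.1 hp
  rw [ContinuousAt, OnePoint.nhds_coe_eq, tendsto_map'_iff]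
  exact tendsto_id

theorem affineCoord_sphereInv_coe (w : ℂ) : affineCoord (sphereInv (w : OnePoint ℂ)) = w⁻¹ := by
  unfold sphereInv
  rw [if_neg (OnePoint.coe_ne_infty w)]
  split_ifs with h
  · rw [OnePoint.coe_injective h, inv_zero]; rfl
  · rfl

/-- The model map transported to the half-plane `Re z < Re ζ`; it agrees with `r + exp` on the
boundary line. -/
def spinePatch (r : ℝ) (ζ z : ℂ) : ℂ := r + Complex.exp ζ * spineMap (z - ζ)

section Patch

variable {r : ℝ} {ζ z : ℂ}

theorem sub_re_neg (hz : z.re < ζ.re) : (z - ζ).re < 0 := by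
  rw [Complex.sub_re]; linarith

theorem hasFDerivAt_spinePatch (hz : z.re < ζ.re) : HasFDerivAt (spinePatch r ζ)
    (Complex.exp ζ • fderiv ℝ spineMap (z - ζ)) z := by
  have h1 := (differentiableAt_spineMap (sub_re_neg hz)).hasFDerivAt
  have h2 : HasFDerivAt (fun z => spineMap (z - ζ)) (fderiv ℝ spineMap (z - ζ)) z := by
    simpa [Function.comp_def] using h1.comp z ((hasFDerivAt_id z).sub_const ζ)
  exact (h2.const_mul (Complex.exp ζ)).const_add (r : ℂ)

theorem contDiffAt_spinePatch (hz : z.re < ζ.re) : ContDiffAt ℝ 1 (spinePatch r ζ) z := by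
  have h1 := (contDiffAt_spineMap_of_re_neg (sub_re_neg hz)).comp z
    (contDiffAt_id.sub (contDiffAt_const (c := ζ)))
  exact contDiffAt_const.add (contDiffAt_const.mul h1)

theorem isBeltrami_spineMap (hz : z.re < 0) :
    IsBeltrami ((1216 - 1) / (1216 + 1)) (fderiv ℝ spineMap z) :=
  IsBeltrami.of_energy (by norm_num) (spineMap_estimates hz).2.1

theorem norm_spinePatch_sub_le (hz : z.re < ζ.re) :
    ‖spinePatch r ζ z - (r + Complex.exp z)‖ ≤ 23 * Real.exp ζ.re * |z.re - ζ.re| := by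
  have h := norm_spineMap_sub_exp_le (sub_re_neg hz)
  have e : spinePatch r ζ z - (r + Complex.exp z)
      = Complex.exp ζ * (spineMap (z - ζ) - Complex.exp (z - ζ)) := by
    rw [mul_sub, ← Complex.exp_add, add_sub_cancel, spinePatch]; ring
  rw [e, norm_mul, Complex.norm_exp, mul_comm 23, mul_assoc]
  gcongr
  exact h

theorem exists_hasFDerivAt_spinePatch_sub (hz : z.re < ζ.re) :
    ∃ L : ℂ →L[ℝ] ℂ, HasFDerivAt (fun z => spinePatch r ζ z - (r + Complex.exp z)) L z ∧
      ‖L‖ ≤ 23 * Real.exp ζ.re := by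
  have h2 := ((Complex.hasDerivAt_exp z).const_add (r : ℂ)).hasFDerivAt.restrictScalars ℝ
  refine ⟨_, (hasFDerivAt_spinePatch hz).sub h2, (norm_sub_le _ _).trans ?_⟩
  rw [norm_smul, ContinuousLinearMap.norm_restrictScalars, Complex.norm_exp]
  have h3 := norm_fderiv_spineMap_le (sub_re_neg hz)
  have h4 : ‖ContinuousLinearMap.toSpanSingleton ℂ (Complex.exp z)‖ ≤ Real.exp ζ.re := by
    rw [ContinuousLinearMap.norm_toSpanSingleton, Complex.norm_exp]
    exact Real.exp_le_exp.2 hz.le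
  nlinarith [Real.exp_pos ζ.re]

end Patch

section Splice

variable {X : Type*} [TopologicalSpace X] {ψ : X → OnePoint ℂ} {φ : OpenPartialHomeomorph X ℂ}
  {r : ℝ} {ζ : ℂ}

open Classical in
/-- The map which agrees with the projection outside the staircase, and with the model map in the
staircase. -/
def spliceSpine (ψ : X → OnePoint ℂ) (φ : OpenPartialHomeomorph X ℂ) (r : ℝ) (ζ : ℂ) :
    X → OnePoint ℂ := fun x =>
  if x ∈ φ.source then ((spinePatch r ζ (φ x) : ℂ) : OnePoint ℂ) else ψ x

theorem spliceSpine_of_mem {x : X} (hx : x ∈ φ.source) :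
    spliceSpine ψ φ r ζ x = ((spinePatch r ζ (φ x) : ℂ) : OnePoint ℂ) := if_pos hx

theorem spliceSpine_of_notMem {x : X} (hx : x ∉ φ.source) : spliceSpine ψ φ r ζ x = ψ x := if_neg hx

theorem IsStaircaseChart.spliceSpine_ne_infty_iff (h : IsStaircaseChart ψ φ r ζ.re) (x : X) :
    spliceSpine ψ φ r ζ x ≠ OnePoint.infty ↔ ψ x ≠ OnePoint.infty := by
  by_cases hx : x ∈ φ.source
  · rw [spliceSpine_of_mem hx, h.apply_eq x hx]
    simp
  · rw [spliceSpine_of_notMem hx]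

/-- In `Y` the real part of the coordinate is `log |ψ - r|`. The bound is expressed through `ψ`
alone, so it makes sense across the frontier, where the coordinate is not defined. Outside `Y` the
left side is 0, so the values of `Real.log` at 0 and of `affineCoord` at infinity play no role. -/
theorem IsStaircaseChart.norm_splice_sub_le (h : IsStaircaseChart ψ φ r ζ.re) (x : X) :
    ‖affineCoord (spliceSpine ψ φ r ζ x) - affineCoord (ψ x)‖
      ≤ 23 * Real.exp ζ.re * |Real.log ‖affineCoord (ψ x) - r‖ - ζ.re| := by
  by_cases hxs : x ∈ φ.source
  · rw [spliceSpine_of_mem hxs, h.apply_eq x hxs, affineCoord_coe, affineCoord_coe,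
      add_sub_cancel_left, Complex.norm_exp, Real.log_exp]
    exact norm_spinePatch_sub_le (h.re_lt hxs)
  · rw [spliceSpine_of_notMem hxs, sub_self, norm_zero]
    positivity

theorem IsStaircaseChart.continuous_splice (h : IsStaircaseChart ψ φ r ζ.re) (hc : Continuous ψ)
    (hfr : ∀ x ∈ frontier φ.source, ∃ w : ℂ, w.re = ζ.re ∧
      ψ x = (((r : ℂ) + Complex.exp w : ℂ) : OnePoint ℂ)) : Continuous (spliceSpine ψ φ r ζ) := by
  rw [continuous_iff_continuousAt]
  intro x
  by_cases hx : x ∈ φ.source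
  · have h1 : ContinuousAt (fun y => ((spinePatch r ζ (φ y) : ℂ) : OnePoint ℂ)) x :=
      OnePoint.continuous_coe.continuousAt.comp
        ((hasFDerivAt_spinePatch (h.re_lt hx)).continuousAt.comp (φ.continuousAt hx))
    refine h1.congr ?_
    filter_upwards [φ.open_source.mem_nhds hx] with y hy using (spliceSpine_of_mem hy).symm
  by_cases hx' : x ∈ frontier φ.source
  swap
  · have hxc : x ∉ closure φ.source := fun hcl => hx' (by
      rw [φ.open_source.frontier_eq]; exact ⟨hcl, hx⟩)
    refine hc.continuousAt.congr ?_
    filter_upwards [isClosed_closure.isOpen_compl.mem_nhds hxc] with y hy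
    exact (spliceSpine_of_notMem fun hy' => hy (subset_closure hy')).symm
  obtain ⟨w, hw, hψx⟩ := hfr x hx'
  have hfin : ψ x ≠ OnePoint.infty := by rw [hψx]; exact OnePoint.coe_ne_infty _
  have hev : ∀ᶠ y in 𝓝 x, ψ y ≠ OnePoint.infty := hc.continuousAt.eventually_ne hfin
  have hA : ContinuousAt (fun y => affineCoord (ψ y)) x :=
    ContinuousAt.comp (continuousAt_affineCoord hfin) hc.continuousAt
  have hnorm : ‖affineCoord (ψ x) - r‖ = Real.exp ζ.re := by
    rw [hψx, affineCoord_coe, add_sub_cancel_left, Complex.norm_exp, hw]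
  -- On the frontier `|ψ - r| = e^c`, so the bound for the error tends to 0.
  have herr : Tendsto (fun y => affineCoord (spliceSpine ψ φ r ζ y) - affineCoord (ψ y)) (𝓝 x) (𝓝 0) := by
    have h1 : ContinuousAt (fun y => 23 * Real.exp ζ.re * |Real.log ‖affineCoord (ψ y) - r‖ - ζ.re|) x := by
      refine continuousAt_const.mul (ContinuousAt.abs (ContinuousAt.sub ?_ continuousAt_const))
      refine (hA.sub continuousAt_const).norm.log ?_
      change ‖affineCoord (ψ x) - r‖ ≠ 0
      rw [hnorm]; exact (Real.exp_pos _).ne'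
    have h2 := h1.tendsto
    rw [hnorm, Real.log_exp, sub_self, abs_zero, mul_zero] at h2
    refine squeeze_zero_norm' ?_ h2
    exact Eventually.of_forall h.norm_splice_sub_le
  have hg : Tendsto (fun y => affineCoord (spliceSpine ψ φ r ζ y)) (𝓝 x) (𝓝 (affineCoord (ψ x))) := by
    have := herr.add hA.tendsto
    simpa using this
  have hlim := (OnePoint.continuous_coe.tendsto _).comp hg
  rw [ContinuousAt, spliceSpine_of_notMem hx]
  rw [coe_affineCoord hfin] at hlim
  refine hlim.congr' ?_
  filter_upwards [hev] with y hy
  exact coe_affineCoord ((h.spliceSpine_ne_infty_iff y).2 hy)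

end Splice

/-! ### Quasiregularity of the spliced map in charts -/

section SpliceQuasiregular

variable {X : Type*} [TopologicalSpace X] {ψ : X → OnePoint ℂ} {φ : OpenPartialHomeomorph X ℂ}
  {r : ℝ} {ζ : ℂ} {e : OpenPartialHomeomorph X ℂ}

theorem isOpen_target_ne {F : X → OnePoint ℂ} (hF : Continuous F) (e : OpenPartialHomeomorph X ℂ)
    (p : OnePoint ℂ) : IsOpen {z ∈ e.target | F (e.symm z) ≠ p} :=
  (hF.comp_continuousOn e.continuousOn_symm).isOpen_inter_preimage e.open_target
    (isOpen_compl_singleton (x := p))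

theorem IsPullbackChart.differentiableAt (he : IsPullbackChart ψ e) (hc : Continuous ψ) {z : ℂ}
    (hz : z ∈ e.target) (hzi : ψ (e.symm z) ≠ OnePoint.infty) :
    DifferentiableAt ℂ (fun w => affineCoord (ψ (e.symm w))) z :=
  he.affine.differentiableAt ((isOpen_target_ne hc e _).mem_nhds ⟨hz, hzi⟩)

theorem IsPullbackChart.analyticAt (he : IsPullbackChart ψ e) (hc : Continuous ψ) {z : ℂ}
    (hz : z ∈ e.target) (hzi : ψ (e.symm z) ≠ OnePoint.infty) :
    AnalyticAt ℂ (fun w => affineCoord (ψ (e.symm w))) z :=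
  he.affine.analyticAt ((isOpen_target_ne hc e _).mem_nhds ⟨hz, hzi⟩)

theorem isOpen_target_source (e φ : OpenPartialHomeomorph X ℂ) :
    IsOpen {z | z ∈ e.target ∧ e.symm z ∈ φ.source} :=
  e.continuousOn_symm.isOpen_inter_preimage e.open_target φ.open_source

/-- The coordinate is a continuous logarithm of the holomorphic function `ψ - r`, so its derivative
is `ψ'/(ψ - r)`. -/
theorem IsStaircaseChart.hasDerivAt_coord (h : IsStaircaseChart ψ φ r ζ.re) (hc : Continuous ψ)
    (he : IsPullbackChart ψ e) {z : ℂ} (hz : z ∈ e.target) (hzY : e.symm z ∈ φ.source) :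
    HasDerivAt (fun w => φ (e.symm w)) (deriv (fun w => affineCoord (ψ (e.symm w))) z /
      (affineCoord (ψ (e.symm z)) - r)) z := by
  have hψz := h.apply_eq _ hzY
  have hfin : ψ (e.symm z) ≠ OnePoint.infty := by rw [hψz]; exact OnePoint.coe_ne_infty _
  have hd := (he.differentiableAt hc hz hfin).hasDerivAt.sub_const (r : ℂ)
  have heq : (fun w => Complex.exp (φ (e.symm w))) =ᶠ[𝓝 z]
      fun w => affineCoord (ψ (e.symm w)) - r := by
    filter_upwards [(isOpen_target_source e φ).mem_nhds ⟨hz, hzY⟩] with w hw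
    rw [h.apply_eq _ hw.2, affineCoord_coe, add_sub_cancel_left]
  have hcont : ContinuousAt (fun w => φ (e.symm w)) z :=
    (φ.continuousAt hzY).comp (e.continuousAt_symm hz)
  have := hasDerivAt_of_exp hcont (hd.congr_of_eventuallyEq heq)
  have e1 : Complex.exp (φ (e.symm z)) = affineCoord (ψ (e.symm z)) - r := heq.self_of_nhds
  rwa [e1] at this

theorem splice_eventuallyEq_inner {z : ℂ} (hz : z ∈ e.target) (hzY : e.symm z ∈ φ.source) :
    (fun w => affineCoord (spliceSpine ψ φ r ζ (e.symm w))) =ᶠ[𝓝 z]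
      fun w => spinePatch r ζ (φ (e.symm w)) := by
  filter_upwards [(isOpen_target_source e φ).mem_nhds ⟨hz, hzY⟩] with w hw
  rw [spliceSpine_of_mem hw.2, affineCoord_coe]

theorem splice_eventuallyEq_outer {z : ℂ} (hz : z ∈ e.target) (hzY : e.symm z ∉ closure φ.source) :
    ∀ᶠ w in 𝓝 z, spliceSpine ψ φ r ζ (e.symm w) = ψ (e.symm w) := by
  filter_upwards [(e.continuousAt_symm hz).eventually (isClosed_closure.isOpen_compl.mem_nhds hzY)]
    with w hw
  exact spliceSpine_of_notMem fun hw' => hw (subset_closure hw')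

/-- Away from the boundary of the staircase, the spliced map is smooth and satisfies the Beltrami
inequality. -/
theorem IsStaircaseChart.splice_regular (h : IsStaircaseChart ψ φ r ζ.re) (hc : Continuous ψ)
    (he : IsPullbackChart ψ e) {z : ℂ} (hz : z ∈ e.target)
    (hzi : ψ (e.symm z) ≠ OnePoint.infty) (hzf : e.symm z ∉ frontier φ.source) :
    ContDiffAt ℝ 1 (fun w => affineCoord (spliceSpine ψ φ r ζ (e.symm w))) z ∧
    IsBeltrami ((1216 - 1) / (1216 + 1))
      (fderiv ℝ (fun w => affineCoord (spliceSpine ψ φ r ζ (e.symm w))) z) := by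
  by_cases hzY : e.symm z ∈ φ.source
  · have heq := splice_eventuallyEq_inner (ψ := ψ) (r := r) (ζ := ζ) hz hzY
    have hd := h.hasDerivAt_coord hc he hz hzY
    have hre := h.re_lt hzY
    have han : AnalyticAt ℂ (fun w => φ (e.symm w)) z := by
      refine DifferentiableOn.analyticAt (s := {z | z ∈ e.target ∧ e.symm z ∈ φ.source})
        (fun w hw => ?_) ((isOpen_target_source e φ).mem_nhds ⟨hz, hzY⟩)
      exact (h.hasDerivAt_coord hc he hw.1 hw.2).differentiableAt.differentiableWithinAt
    refine ⟨?_, ?_⟩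
    · refine ContDiffAt.congr_of_eventuallyEq ?_ heq
      have h1 : ContDiffAt ℝ 1 (fun w => φ (e.symm w)) z := han.contDiffAt.restrict_scalars ℝ
      exact ContDiffAt.comp (g := spinePatch r ζ) (f := fun w => φ (e.symm w)) z
        (contDiffAt_spinePatch hre) h1
    · rw [heq.fderiv_eq]
      have h1 := (hasFDerivAt_spinePatch (r := r) hre).comp z (hd.hasFDerivAt.restrictScalars ℝ)
      have h2 : fderiv ℝ (fun w => spinePatch r ζ (φ (e.symm w))) z = _ := h1.fderiv
      rw [h2]
      refine (isBeltrami_spineMap (sub_re_neg hre)).comp_mul (Complex.exp ζ) (deriv (fun w => affineCoord (ψ (e.symm w))) z /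
      (affineCoord (ψ (e.symm z)) - r)) fun v => ?_
      simp [mul_comm]
  · have hzc : e.symm z ∉ closure φ.source := fun hcl => hzf (by
      rw [φ.open_source.frontier_eq]; exact ⟨hcl, hzY⟩)
    have heq : (fun w => affineCoord (spliceSpine ψ φ r ζ (e.symm w))) =ᶠ[𝓝 z]
        fun w => affineCoord (ψ (e.symm w)) := by
      filter_upwards [splice_eventuallyEq_outer hz hzc] with w hw
      rw [hw]
    refine ⟨?_, ?_⟩
    · exact ContDiffAt.congr_of_eventuallyEq
        ((he.analyticAt hc hz hzi).contDiffAt.restrict_scalars ℝ) heq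
    · rw [heq.fderiv_eq]
      have h1 := (he.differentiableAt hc hz hzi).hasDerivAt.hasFDerivAt.restrictScalars ℝ
      rw [h1.fderiv]
      exact IsBeltrami.mul (by norm_num) (deriv (fun w => affineCoord (ψ (e.symm w))) z)
        fun v => by simp [mul_comm]

/-- The spliced map is Lipschitz near the boundary of the staircase. -/
theorem IsStaircaseChart.splice_lipschitz_frontier (h : IsStaircaseChart ψ φ r ζ.re)
    (hc : Continuous ψ) (hs : Continuous (spliceSpine ψ φ r ζ)) (he : IsPullbackChart ψ e)
    (hfr : ∀ x ∈ frontier φ.source, ∃ w : ℂ, w.re = ζ.re ∧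
      ψ x = (((r : ℂ) + Complex.exp w : ℂ) : OnePoint ℂ))
    {z : ℂ} (hz : z ∈ e.target) (hzf : e.symm z ∈ frontier φ.source) :
    ∃ C : NNReal, ∃ V ∈ 𝓝 z,
      LipschitzOnWith C (fun w => affineCoord (spliceSpine ψ φ r ζ (e.symm w))) V := by
  obtain ⟨w, hw, hψz⟩ := hfr _ hzf
  have hfin : ψ (e.symm z) ≠ OnePoint.infty := by rw [hψz]; exact OnePoint.coe_ne_infty _
  set f : ℂ → ℂ := fun w => affineCoord (ψ (e.symm w)) with hf
  set g : ℂ → ℂ := fun w => affineCoord (spliceSpine ψ φ r ζ (e.symm w)) with hg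
  have han := he.analyticAt hc hz hfin
  have hfz : ‖f z - r‖ = Real.exp ζ.re := by
    rw [hf]; simp only
    rw [hψz, affineCoord_coe, add_sub_cancel_left, Complex.norm_exp, hw]
  have ev1 : ∀ᶠ w in 𝓝 z, w ∈ e.target ∧ ψ (e.symm w) ≠ OnePoint.infty :=
    (isOpen_target_ne hc e _).mem_nhds ⟨hz, hfin⟩
  have ev2 : ∀ᶠ w in 𝓝 z, Real.exp ζ.re / 2 < ‖f w - r‖ :=
    (han.continuousAt.sub continuousAt_const).norm.eventually
      (lt_mem_nhds (by
        change _ < ‖f z - r‖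
        rw [hfz]; linarith [Real.exp_pos ζ.re]))
  have ev3 : ∀ᶠ w in 𝓝 z, ‖deriv f w‖ < ‖deriv f z‖ + 1 :=
    han.deriv.continuousAt.norm.eventually (gt_mem_nhds (lt_add_one _))
  obtain ⟨C₁, V₁, hV₁, hL₁⟩ :=
    (han.contDiffAt.restrict_scalars ℝ : ContDiffAt ℝ 1 f z).exists_lipschitzOnWith
  obtain ⟨δ, hδ, hball⟩ := Metric.mem_nhds_iff.1 (inter_mem ((ev1.and ev2).and ev3) hV₁)
  set D : ℝ := ‖deriv f z‖ + 1 with hD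
  have hD0 : 0 ≤ D := by positivity
  have hgc : ∀ w ∈ Metric.ball z δ, ContinuousAt g w := fun w hw => by
    have hw1 := (hball hw).1.1.1
    have h1 : ContinuousAt (fun w => spliceSpine ψ φ r ζ (e.symm w)) w :=
      ContinuousAt.comp hs.continuousAt (e.continuousAt_symm hw1.1)
    exact ContinuousAt.comp (f := fun w => spliceSpine ψ φ r ζ (e.symm w))
      (continuousAt_affineCoord ((h.spliceSpine_ne_infty_iff _).2 hw1.2)) h1
  have hfc : ∀ w ∈ Metric.ball z δ, ContinuousAt f w := fun w hw =>
    (he.differentiableAt hc (hball hw).1.1.1.1 (hball hw).1.1.1.2).continuousAt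
  -- The difference of the spliced map and the projection vanishes off `Y`, so no regularity of the
  -- frontier is needed. Its differential in the logarithmic coordinate is at most `23 e^c`, and
  -- that of the coordinate is at most `D/(e^c/2)`; the product is `46 D`.
  have hu : ∀ x ∈ Metric.ball z δ, ∀ y ∈ Metric.ball z δ,
      ‖(g x - f x) - (g y - f y)‖ ≤ 46 * D * ‖x - y‖ := by
    intro x hx y hy
    refine norm_sub_le_of_fderiv_bound_off_zeros (u := fun w => g w - f w) (convex_ball z δ)
      (fun w hw => ((hgc w hw).sub (hfc w hw)).continuousWithinAt) (isOpen_target_source e φ) ?_ ?_ hx hy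
      (by positivity)
    · intro v hv hvO
      have : e.symm v ∉ φ.source := fun h' => hvO ⟨(hball hv).1.1.1.1, h'⟩
      simp only [hg, hf]
      rw [spliceSpine_of_notMem this, sub_self]
    · rintro v ⟨hv, hvt, hvY⟩
      obtain ⟨L, hL, hLn⟩ := exists_hasFDerivAt_spinePatch_sub (r := r) (h.re_lt hvY)
      have hd := h.hasDerivAt_coord hc he hvt hvY
      have h1 := hL.comp v (hd.hasFDerivAt.restrictScalars ℝ)
      refine ⟨_, h1.congr_of_eventuallyEq ?_, ?_⟩
      · filter_upwards [(isOpen_target_source e φ).mem_nhds ⟨hvt, hvY⟩] with w hw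
        simp only [hg, hf, Function.comp_apply]
        rw [spliceSpine_of_mem hw.2, h.apply_eq _ hw.2, affineCoord_coe, affineCoord_coe]
      · refine (ContinuousLinearMap.opNorm_comp_le _ _).trans ?_
        rw [ContinuousLinearMap.norm_restrictScalars, ContinuousLinearMap.norm_toSpanSingleton, norm_div]
        have hE := Real.exp_pos ζ.re
        have hb1 : Real.exp ζ.re / 2 < ‖f v - r‖ := (hball hv).1.1.2
        have hb2 : ‖deriv f v‖ < D := (hball hv).1.2
        have h5 : ‖deriv f v‖ / ‖f v - r‖ ≤ D / (Real.exp ζ.re / 2) :=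
          div_le_div₀ hD0 hb2.le (by positivity) hb1.le
        calc ‖L‖ * (‖deriv f v‖ / ‖f v - r‖) ≤ (23 * Real.exp ζ.re) * (D / (Real.exp ζ.re / 2)) :=
              mul_le_mul hLn h5 (by positivity) (by positivity)
          _ = 46 * D := by field_simp; ring
  refine ⟨(46 * D).toNNReal + C₁, Metric.ball z δ, Metric.ball_mem_nhds z hδ, ?_⟩
  have hL2 : LipschitzOnWith (46 * D).toNNReal (fun w => g w - f w) (Metric.ball z δ) :=
    LipschitzOnWith.of_dist_le_mul fun x hx y hy => by
      rw [dist_eq_norm, dist_eq_norm, Real.coe_toNNReal _ (by positivity)]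
      exact hu x hx y hy
  have hsum : g = fun w => (g w - f w) + f w := funext fun w => (sub_add_cancel _ _).symm
  rw [hsum]
  exact hL2.add (hL₁.mono fun w hw => (hball hw).2)

/-- The part of the domain of a chart lying over the boundary of the staircase is null. -/
theorem volume_frontier_eq_zero (hψ : IsSurfaceSpread ψ) (he : IsPullbackChart ψ e)
    (hfr : ∀ x ∈ frontier φ.source, ∃ w : ℂ, w.re = ζ.re ∧
      ψ x = (((r : ℂ) + Complex.exp w : ℂ) : OnePoint ℂ)) :
    volume {z ∈ e.target | e.symm z ∈ frontier φ.source} = 0 := by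
  -- The frontier lies over the circle of radius `e^c` about `r`, and a holomorphic map with
  -- discrete fibres pulls this null set back to a null set.
  have h0 := volume_preimage_eq_zero_of_discrete (isOpen_target_ne hψ.continuous e OnePoint.infty)
    he.affine ?_ (Measure.addHaar_sphere volume (r : ℂ) (Real.exp ζ.re))
  · refine measure_mono_null ?_ h0
    rintro z ⟨hz, hzf⟩
    obtain ⟨w, hw, hψz⟩ := hfr _ hzf
    refine ⟨⟨hz, by rw [hψz]; exact OnePoint.coe_ne_infty _⟩, ?_⟩
    simp only [mem_preimage, mem_sphere_iff_norm]
    rw [hψz, affineCoord_coe, add_sub_cancel_left, Complex.norm_exp, hw]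
  · rintro z ⟨hz, hzi⟩
    obtain ⟨W, hW, hWx⟩ := nhds_inter_eq_singleton_of_mem_discrete
      (hψ.discrete (ψ (e.symm z))) (show e.symm z ∈ ψ ⁻¹' {ψ (e.symm z)} from rfl)
    have ev1 : ∀ᶠ w in 𝓝 z, w ∈ e.target ∧ ψ (e.symm w) ≠ OnePoint.infty :=
      (isOpen_target_ne hψ.continuous e _).mem_nhds ⟨hz, hzi⟩
    have ev2 : ∀ᶠ w in 𝓝 z, e.symm w ∈ W := (e.continuousAt_symm hz) hW
    filter_upwards [nhdsWithin_le_nhds ev1, nhdsWithin_le_nhds ev2, self_mem_nhdsWithin] with w h1 h2 hwz heq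
    have h3 : ψ (e.symm w) = ψ (e.symm z) := by
      rw [← coe_affineCoord h1.2, ← coe_affineCoord hzi, heq]
    have h4 : e.symm w ∈ W ∩ ψ ⁻¹' {ψ (e.symm z)} := ⟨h2, h3⟩
    rw [hWx] at h4
    exact hwz (e.symm.injOn h1.1 hz h4)

theorem IsBeltrami.inv {k : ℝ} {g : ℂ → ℂ} {z : ℂ} (hg : DifferentiableAt ℝ g z) (h0 : g z ≠ 0)
    (hb : IsBeltrami k (fderiv ℝ g z)) : IsBeltrami k (fderiv ℝ (fun w => (g w)⁻¹) z) := by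
  have h1 := ((hasDerivAt_inv h0).hasFDerivAt.restrictScalars ℝ).comp z hg.hasFDerivAt
  have h2 : fderiv ℝ (fun w => (g w)⁻¹) z = _ := h1.fderiv
  rw [h2]
  refine hb.comp_mul (-(g z ^ 2)⁻¹) 1 fun v => ?_
  simp [mul_comm]

theorem affineCoord_ne_zero {p : OnePoint ℂ} (hp : p ≠ OnePoint.infty)
    (h0 : p ≠ ((0 : ℂ) : OnePoint ℂ)) : affineCoord p ≠ 0 := fun h => by
  rw [← coe_affineCoord hp, h] at h0
  exact h0 rfl

theorem IsStaircaseChart.sphereInv_splice_eventuallyEq (h : IsStaircaseChart ψ φ r ζ.re)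
    (hc : Continuous ψ) {z : ℂ} (hz : z ∈ e.target) (hzi : ψ (e.symm z) ≠ OnePoint.infty) :
    ∀ᶠ w in 𝓝 z, affineCoord (sphereInv (spliceSpine ψ φ r ζ (e.symm w))) =
      (affineCoord (spliceSpine ψ φ r ζ (e.symm w)))⁻¹ := by
  filter_upwards [(isOpen_target_ne hc e _).mem_nhds ⟨hz, hzi⟩] with w hw
  have := affineCoord_sphereInv_coe (affineCoord (spliceSpine ψ φ r ζ (e.symm w)))
  rwa [coe_affineCoord ((h.spliceSpine_ne_infty_iff _).2 hw.2)] at this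

/-- Near a pole the spliced map coincides with the projection. -/
theorem IsStaircaseChart.splice_regular_infty (h : IsStaircaseChart ψ φ r ζ.re)
    (hc : Continuous ψ) (he : IsPullbackChart ψ e)
    (hfr : ∀ x ∈ frontier φ.source, ∃ w : ℂ, w.re = ζ.re ∧
      ψ x = (((r : ℂ) + Complex.exp w : ℂ) : OnePoint ℂ))
    {z : ℂ} (hz : z ∈ e.target) (hzi : ψ (e.symm z) = OnePoint.infty) :
    ContDiffAt ℝ 1 (fun w => affineCoord (sphereInv (spliceSpine ψ φ r ζ (e.symm w)))) z ∧
    IsBeltrami ((1216 - 1) / (1216 + 1))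
      (fderiv ℝ (fun w => affineCoord (sphereInv (spliceSpine ψ φ r ζ (e.symm w)))) z) := by
  have hzc : e.symm z ∉ closure φ.source := fun hcl => by
    by_cases hzY : e.symm z ∈ φ.source
    · rw [h.apply_eq _ hzY] at hzi
      exact OnePoint.coe_ne_infty _ hzi
    · obtain ⟨w, -, hw⟩ := hfr (e.symm z) (by rw [φ.open_source.frontier_eq]; exact ⟨hcl, hzY⟩)
      rw [hw] at hzi
      exact OnePoint.coe_ne_infty _ hzi
  have heq : (fun w => affineCoord (sphereInv (spliceSpine ψ φ r ζ (e.symm w)))) =ᶠ[𝓝 z]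
      fun w => affineCoord (sphereInv (ψ (e.symm w))) := by
    filter_upwards [splice_eventuallyEq_outer hz hzc] with w hw
    rw [hw]
  have hmem : {w ∈ e.target | ψ (e.symm w) ≠ ((0 : ℂ) : OnePoint ℂ)} ∈ 𝓝 z :=
    (isOpen_target_ne hc e _).mem_nhds ⟨hz, by rw [hzi]; exact OnePoint.infty_ne_coe _⟩
  refine ⟨ContDiffAt.congr_of_eventuallyEq
    ((he.atInfty.analyticAt hmem).contDiffAt.restrict_scalars ℝ) heq, ?_⟩
  rw [heq.fderiv_eq]
  have h1 := (he.atInfty.differentiableAt hmem).hasDerivAt.hasFDerivAt.restrictScalars ℝ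
  rw [h1.fderiv]
  exact IsBeltrami.mul (by norm_num)
    (deriv (fun w => affineCoord (sphereInv (ψ (e.symm w)))) z) fun v => by simp [mul_comm]

/-- The spliced map is quasiregular, with a universal constant. -/
theorem IsStaircaseChart.isQuasiregularMap_splice (h : IsStaircaseChart ψ φ r ζ.re)
    (hψ : IsSurfaceSpread ψ)
    (hfr : ∀ x ∈ frontier φ.source, ∃ w : ℂ, w.re = ζ.re ∧
      ψ x = (((r : ℂ) + Complex.exp w : ℂ) : OnePoint ℂ)) :
    IsQuasiregularMap 1216 ψ (spliceSpine ψ φ r ζ) := by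
  have hc := hψ.continuous
  have hs := h.continuous_splice hc hfr
  refine ⟨hs, fun e he => ?_⟩
  have hnull := volume_frontier_eq_zero hψ he hfr
  have hae : ∀ U : Set ℂ, ∀ᵐ z ∂volume.restrict U,
      z ∉ {z ∈ e.target | e.symm z ∈ frontier φ.source} := fun U =>
    ae_restrict_of_ae (measure_eq_zero_iff_ae_notMem.1 hnull)
  have hlip : ∀ z ∈ e.target, ψ (e.symm z) ≠ OnePoint.infty → ∃ C : NNReal, ∃ V ∈ 𝓝 z,
      LipschitzOnWith C (fun w => affineCoord (spliceSpine ψ φ r ζ (e.symm w))) V := by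
    intro z hz hzi
    by_cases hzf : e.symm z ∈ frontier φ.source
    · exact h.splice_lipschitz_frontier hc hs he hfr hz hzf
    · exact (h.splice_regular hc he hz hzi hzf).1.exists_lipschitzOnWith
  refine ⟨isQuasiregularOn_of_locallyLipschitzOn (isOpen_target_ne hs e _) ?_ ?_,
    isQuasiregularOn_of_locallyLipschitzOn (isOpen_target_ne hs e _) ?_ ?_⟩
  · rintro z ⟨hz, hzi⟩
    obtain ⟨C, V, hV, hL⟩ := hlip z hz ((h.spliceSpine_ne_infty_iff _).1 hzi)
    exact ⟨C, V, mem_nhdsWithin_of_mem_nhds hV, hL⟩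
  · filter_upwards [hae _, ae_restrict_mem (isOpen_target_ne hs e _).measurableSet] with z hz1 hz2
    exact (h.splice_regular hc he hz2.1 ((h.spliceSpine_ne_infty_iff _).1 hz2.2)
      fun hf => hz1 ⟨hz2.1, hf⟩).2
  · rintro z ⟨hz, hz0⟩
    suffices ∃ C : NNReal, ∃ V ∈ 𝓝 z, LipschitzOnWith C
        (fun w => affineCoord (sphereInv (spliceSpine ψ φ r ζ (e.symm w)))) V by
      obtain ⟨C, V, hV, hL⟩ := this
      exact ⟨C, V, mem_nhdsWithin_of_mem_nhds hV, hL⟩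
    by_cases hzi : ψ (e.symm z) = OnePoint.infty
    · obtain ⟨h1, -⟩ := h.splice_regular_infty hc he hfr hz hzi
      exact h1.exists_lipschitzOnWith
    · obtain ⟨C, V, hV, hL⟩ := hlip z hz hzi
      have hne : affineCoord (spliceSpine ψ φ r ζ (e.symm z)) ≠ 0 :=
        affineCoord_ne_zero ((h.spliceSpine_ne_infty_iff _).2 hzi) hz0
      obtain ⟨C', V', hV', hL'⟩ := ((contDiffAt_inv ℂ hne).restrict_scalars ℝ :
        ContDiffAt ℝ 1 Inv.inv _).exists_lipschitzOnWith
      have hg : ContinuousAt (fun w => affineCoord (spliceSpine ψ φ r ζ (e.symm w))) z :=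
        hL.continuousOn.continuousAt hV
      have hev := h.sphereInv_splice_eventuallyEq (e := e) hc hz hzi
      refine ⟨C' * C, _, inter_mem (inter_mem hV (hg hV')) hev, ?_⟩
      have h2 := (hL'.comp (hL.mono (inter_subset_left.trans inter_subset_left))
        (s := (V ∩ (fun w => affineCoord (spliceSpine ψ φ r ζ (e.symm w))) ⁻¹' V') ∩
          {w | affineCoord (sphereInv (spliceSpine ψ φ r ζ (e.symm w))) =
            (affineCoord (spliceSpine ψ φ r ζ (e.symm w)))⁻¹}) fun w hw => hw.1.2)
      intro x hx y hy
      have h3 := h2 hx hy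
      have ex := hx.2
      have ey := hy.2
      simp only [mem_ofPred_eq] at ex ey
      simp only [Function.comp_apply] at h3
      simp only
      rw [ex, ey]
      exact h3
  · filter_upwards [hae _, ae_restrict_mem (isOpen_target_ne hs e _).measurableSet] with z hz1 hz2
    by_cases hzi : ψ (e.symm z) = OnePoint.infty
    · exact (h.splice_regular_infty hc he hfr hz2.1 hzi).2
    · have hne : affineCoord (spliceSpine ψ φ r ζ (e.symm z)) ≠ 0 :=
        affineCoord_ne_zero ((h.spliceSpine_ne_infty_iff _).2 hzi) hz2.2
      obtain ⟨h1, h2⟩ := h.splice_regular hc he hz2.1 hzi fun hf => hz1 ⟨hz2.1, hf⟩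
      have hev : (fun w => affineCoord (sphereInv (spliceSpine ψ φ r ζ (e.symm w)))) =ᶠ[𝓝 z]
          fun w => (affineCoord (spliceSpine ψ φ r ζ (e.symm w)))⁻¹ :=
        h.sphereInv_splice_eventuallyEq (e := e) hc hz2.1 hzi
      rw [hev.fderiv_eq]
      exact IsBeltrami.inv (h1.differentiableAt one_ne_zero) hne h2

end SpliceQuasiregular

/-! ### The net of the model -/

/-- The point with parameter `q` on the level curve `foldAngle = s`. -/
def levelPoint (s q : ℝ) : ℂ := ⟨-(s - q ^ 2), q * √(q ^ 2 + 2 * foldWidth (s - q ^ 2))⟩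

theorem sub_sq_pos {s q : ℝ} (hq : |q| < √s) : 0 < s - q ^ 2 := by
  have h := (Real.lt_sqrt (abs_nonneg q)).1 hq
  rw [sq_abs] at h
  linarith

/-- On the level `τ = s` one has `N = ρ + (s - t)`. With `q² = s - t` this gives `y² = N² - ρ² =
q²(q² + 2ρ)`. Giving `q` the sign of `y` yields a single parameter for the whole arc, which crosses
the axis at `q = 0` and reaches the boundary line at `q = ±√s`. -/
theorem foldAngle_levelPoint {s q : ℝ} (hq : |q| < √s) :
    foldAngle (-(levelPoint s q).re) (levelPoint s q).im = s := by
  have ht := sub_sq_pos hq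
  have hρ := foldWidth_pos ht
  have hN : foldNorm (s - q ^ 2) (q * √(q ^ 2 + 2 * foldWidth (s - q ^ 2)))
      = q ^ 2 + foldWidth (s - q ^ 2) := by
    rw [foldNorm, Real.sqrt_eq_iff_mul_self_eq (by positivity) (by positivity), mul_pow,
      Real.sq_sqrt (by positivity)]
    ring
  simp only [levelPoint, neg_neg]
  rw [foldAngle, hN]
  ring

theorem exists_levelPoint {s : ℝ} {z : ℂ} (hz : z.re < 0) (h : foldAngle (-z.re) z.im = s) :
    ∃ q, |q| < √s ∧ levelPoint s q = z := by
  have ht : 0 < -z.re := by linarith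
  have hρ := foldWidth_pos ht
  have hts : -z.re ≤ s := h ▸ le_foldAngle _ _
  have hN := foldNorm_sq (-z.re) z.im
  have hN' : foldNorm (-z.re) z.im = (s - -z.re) + foldWidth (-z.re) := by
    rw [← h, foldAngle]; ring
  rw [hN'] at hN
  set d : ℝ := s - -z.re with hd
  have hd0 : 0 ≤ d := by linarith
  have hds : √d < √s := Real.sqrt_lt_sqrt hd0 (by linarith)
  have hy : |z.im| = √d * √(d + 2 * foldWidth (-z.re)) := by
    rw [← Real.sqrt_mul hd0, ← Real.sqrt_sq_eq_abs]
    congr 1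
    linarith
  have key : ∀ q : ℝ, q ^ 2 = d → q * √(d + 2 * foldWidth (-z.re)) = z.im → levelPoint s q = z := by
    intro q hq hqi
    have hsd : s - d = -z.re := by rw [hd]; ring
    apply Complex.ext
    · change -(s - q ^ 2) = z.re
      rw [hq, hsd, neg_neg]
    · change q * √(q ^ 2 + 2 * foldWidth (s - q ^ 2)) = z.im
      rw [hq, hsd]
      exact hqi
  rcases le_total 0 z.im with hi | hi
  · refine ⟨√d, by rwa [abs_of_nonneg (Real.sqrt_nonneg _)], key _ (Real.sq_sqrt hd0) ?_⟩
    rw [← hy, abs_of_nonneg hi]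
  · refine ⟨-√d, by rwa [abs_neg, abs_of_nonneg (Real.sqrt_nonneg _)],
      key _ (by rw [neg_sq, Real.sq_sqrt hd0]) ?_⟩
    rw [neg_mul, ← hy, abs_of_nonpos hi, neg_neg]

theorem levelPoint_injOn (s : ℝ) : InjOn (levelPoint s) {q | |q| < √s} := by
  intro q hq q' _ h
  have hre : -(s - q ^ 2) = -(s - q' ^ 2) := congrArg Complex.re h
  have hsq : q ^ 2 = q' ^ 2 := by linarith
  have him : q * √(q ^ 2 + 2 * foldWidth (s - q ^ 2))
    = q' * √(q' ^ 2 + 2 * foldWidth (s - q' ^ 2)) := congrArg Complex.im h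
  rw [← hsq] at him
  have hρ := foldWidth_pos (sub_sq_pos hq)
  have : √(q ^ 2 + 2 * foldWidth (s - q ^ 2)) ≠ 0 := by positivity
  exact mul_right_cancel₀ this him

theorem continuous_levelPoint (s : ℝ) : Continuous (levelPoint s) := by
  have h : levelPoint s = fun q : ℝ => Complex.equivRealProdCLM.symm
      (-(s - q ^ 2), q * √(q ^ 2 + 2 * foldWidth (s - q ^ 2))) := by
    funext q
    apply Complex.ext <;> simp [levelPoint]
  have := continuous_foldWidth
  rw [h]
  fun_prop

/-- A parametrisation of the interval of parameters of a level curve by the line. -/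
def levelParam (s x : ℝ) : ℝ := √s * (2 / Real.pi * Real.arctan x)

theorem abs_levelParam_lt {s : ℝ} (hs : 0 < s) (x : ℝ) : |levelParam s x| < √s := by
  have hpi := Real.pi_pos
  have h1 : |Real.arctan x| < Real.pi / 2 :=
    abs_lt.2 ⟨Real.neg_pi_div_two_lt_arctan x, Real.arctan_lt_pi_div_two x⟩
  have h2 : 0 < √s := Real.sqrt_pos.2 hs
  rw [levelParam, abs_mul, abs_mul, abs_of_pos h2, abs_of_pos (by positivity : 0 < 2 / Real.pi)]
  refine mul_lt_of_lt_one_right h2 ?_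
  calc 2 / Real.pi * |Real.arctan x| < 2 / Real.pi * (Real.pi / 2) := by gcongr
    _ = 1 := by field_simp

theorem levelParam_injective {s : ℝ} (hs : 0 < s) : Function.Injective (levelParam s) := by
  intro x y h
  have h2 : √s ≠ 0 := (Real.sqrt_pos.2 hs).ne'
  have h3 := mul_left_cancel₀ (by positivity : 2 / Real.pi ≠ 0) (mul_left_cancel₀ h2 h)
  exact Real.arctan_injective h3

theorem exists_levelParam_eq {s q : ℝ} (hs : 0 < s) (hq : |q| < √s) : ∃ x, levelParam s x = q := by
  have hpi := Real.pi_pos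
  have h2 : 0 < √s := Real.sqrt_pos.2 hs
  obtain ⟨hq1, hq2⟩ := abs_lt.1 hq
  refine ⟨Real.tan (q / √s * (Real.pi / 2)), ?_⟩
  have h3 : q / √s < 1 := (div_lt_one h2).2 hq2
  have h4 : -1 < q / √s := by rw [lt_div_iff₀ h2]; linarith
  rw [levelParam, Real.arctan_tan (by nlinarith) (by nlinarith)]
  field_simp

theorem continuous_levelParam (s : ℝ) : Continuous (levelParam s) := by
  unfold levelParam
  exact continuous_const.mul (continuous_const.mul Real.continuous_arctan)

theorem tendsto_levelParam_atTop (s : ℝ) : Tendsto (levelParam s) atTop (𝓝 (√s)) := by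
  have h := ((tendsto_nhds_of_tendsto_nhdsWithin Real.tendsto_arctan_atTop).const_mul
    (2 / Real.pi)).const_mul (√s)
  have e : √s * (2 / Real.pi * (Real.pi / 2)) = √s := by
    have := Real.pi_pos
    field_simp
  rwa [e] at h

theorem tendsto_levelParam_atBot (s : ℝ) : Tendsto (levelParam s) atBot (𝓝 (-√s)) := by
  have h := ((tendsto_nhds_of_tendsto_nhdsWithin Real.tendsto_arctan_atBot).const_mul
    (2 / Real.pi)).const_mul (√s)
  have e : √s * (2 / Real.pi * (-(Real.pi / 2))) = -√s := by
    have := Real.pi_pos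
    field_simp
  rwa [e] at h

/-- The lines of the net of the model: the negative half-axis and the level curves of the fold angle
at the positive multiples of `π`. -/
def spineLine (k : ℕ) (x : ℝ) : ℂ :=
  if k = 0 then ⟨-Real.exp x, 0⟩ else levelPoint (k * Real.pi) (levelParam (k * Real.pi) x)

theorem spineLine_zero (x : ℝ) : spineLine 0 x = ⟨-Real.exp x, 0⟩ := if_pos rfl

theorem spineLine_of_ne {k : ℕ} (hk : k ≠ 0) (x : ℝ) :
    spineLine k x = levelPoint (k * Real.pi) (levelParam (k * Real.pi) x) := if_neg hk

theorem natCast_mul_pi_pos {k : ℕ} (hk : k ≠ 0) : 0 < k * Real.pi := by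
  have := Nat.pos_of_ne_zero hk
  have := Real.pi_pos
  positivity

theorem spineLine_re_neg (k : ℕ) (x : ℝ) : (spineLine k x).re < 0 := by
  by_cases hk : k = 0
  · subst hk
    rw [spineLine_zero]
    exact neg_lt_zero.2 (Real.exp_pos x)
  · rw [spineLine_of_ne hk]
    exact neg_lt_zero.2 (sub_sq_pos (abs_levelParam_lt (natCast_mul_pi_pos hk) x))

theorem continuous_spineLine (k : ℕ) : Continuous (spineLine k) := by
  by_cases hk : k = 0
  · subst hk
    have h : spineLine 0 = fun x : ℝ => (((-Real.exp x : ℝ)) : ℂ) := by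
      funext x
      rw [spineLine_zero]
      rfl
    rw [h]
    exact Complex.continuous_ofReal.comp Real.continuous_exp.neg
  · have h : spineLine k = fun x => levelPoint (k * Real.pi) (levelParam (k * Real.pi) x) :=
      funext fun x => spineLine_of_ne hk x
    rw [h]
    exact (continuous_levelPoint _).comp (continuous_levelParam _)

theorem spineLine_injective (k : ℕ) : Function.Injective (spineLine k) := by
  intro x y h
  by_cases hk : k = 0
  · subst hk
    rw [spineLine_zero, spineLine_zero] at h
    have : -Real.exp x = -Real.exp y := congrArg Complex.re h
    exact Real.exp_injective (neg_injective this)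
  · rw [spineLine_of_ne hk, spineLine_of_ne hk] at h
    have hs := natCast_mul_pi_pos hk
    exact levelParam_injective hs
      (levelPoint_injOn _ (abs_levelParam_lt hs x) (abs_levelParam_lt hs y) h)

theorem foldAngle_spineLine {k : ℕ} (hk : k ≠ 0) (x : ℝ) :
    foldAngle (-(spineLine k x).re) (spineLine k x).im = k * Real.pi := by
  rw [spineLine_of_ne hk]
  exact foldAngle_levelPoint (abs_levelParam_lt (natCast_mul_pi_pos hk) x)

theorem spineMap_im_eq_zero_iff {z : ℂ} (hz : z.re < 0) :
    (spineMap z).im = 0 ↔ ∃ k x, spineLine k x = z := by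
  have ht : 0 < -z.re := by linarith
  have h0 : (spineMap z).im = spineIm (-z.re) z.im := rfl
  rw [h0, spineIm_eq_zero_iff ht]
  constructor
  · rintro (h | h)
    · refine ⟨0, Real.log (-z.re), ?_⟩
      rw [spineLine_zero, Real.exp_log ht]
      apply Complex.ext <;> simp [h]
    · obtain ⟨n, hn⟩ := Real.sin_eq_zero_iff.1 h
      -- The fold angle is positive in the half-plane, so only the levels `kπ` with `k ≥ 1` occur.
      have hpos : 0 < foldAngle (-z.re) z.im := ht.trans_le (le_foldAngle _ _)
      rw [← hn] at hpos
      have hn0 : 0 < n := by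
        have := pos_of_mul_pos_left hpos Real.pi_pos.le
        exact_mod_cast this
      obtain ⟨k, rfl⟩ := Int.eq_ofNat_of_zero_le hn0.le
      have hk : k ≠ 0 := by rintro rfl; simp at hn0
      rw [Int.cast_natCast] at hn
      obtain ⟨q, hq, hqz⟩ := exists_levelPoint hz hn.symm
      obtain ⟨x, hx⟩ := exists_levelParam_eq (natCast_mul_pi_pos hk) hq
      exact ⟨k, x, by rw [spineLine_of_ne hk, hx, hqz]⟩
  · rintro ⟨k, x, rfl⟩
    by_cases hk : k = 0
    · subst hk
      left
      rw [spineLine_zero]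
    · right
      rw [foldAngle_spineLine hk, Real.sin_nat_mul_pi]

theorem tendsto_spineLine_zero_atBot : Tendsto (spineLine 0) atBot (𝓝 0) := by
  have h : spineLine 0 = fun x : ℝ => (((-Real.exp x : ℝ)) : ℂ) := by
    funext x
    rw [spineLine_zero]
    rfl
  rw [h]
  have := (Complex.continuous_ofReal.tendsto _).comp Real.tendsto_exp_atBot.neg
  rwa [neg_zero, Complex.ofReal_zero] at this

theorem tendsto_norm_spineLine_zero_atTop : Tendsto (fun x => ‖spineLine 0 x‖) atTop atTop := by
  have h : (fun x => ‖spineLine 0 x‖) = Real.exp := by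
    funext x
    have : spineLine 0 x = ((-Real.exp x : ℝ) : ℂ) := by rw [spineLine_zero]; rfl
    rw [this, Complex.norm_real, norm_neg, Real.norm_of_nonneg (Real.exp_pos x).le]
  rw [h]
  exact Real.tendsto_exp_atTop

theorem levelPoint_sqrt {s : ℝ} (hs : 0 < s) : levelPoint s (√s) = s * Complex.I := by
  have h1 : √s ^ 2 = s := Real.sq_sqrt hs.le
  apply Complex.ext
  · simp [levelPoint, h1]
  · simp [levelPoint, h1, foldWidth_zero]
    nlinarith

theorem levelPoint_neg_sqrt {s : ℝ} (hs : 0 < s) : levelPoint s (-√s) = -(s * Complex.I) := by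
  have h1 : √s ^ 2 = s := Real.sq_sqrt hs.le
  apply Complex.ext
  · simp [levelPoint, h1]
  · simp [levelPoint, h1, foldWidth_zero]
    nlinarith

theorem tendsto_spineLine_atTop {k : ℕ} (hk : k ≠ 0) :
    Tendsto (spineLine k) atTop (𝓝 (((k * Real.pi : ℝ) : ℂ) * Complex.I)) := by
  have h := ((continuous_levelPoint (k * Real.pi)).tendsto _).comp (tendsto_levelParam_atTop (k * Real.pi))
  rw [levelPoint_sqrt (natCast_mul_pi_pos hk)] at h
  exact h.congr fun x => (spineLine_of_ne hk x).symm

theorem tendsto_spineLine_atBot {k : ℕ} (hk : k ≠ 0) :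
    Tendsto (spineLine k) atBot (𝓝 (-(((k * Real.pi : ℝ) : ℂ) * Complex.I))) := by
  have h := ((continuous_levelPoint (k * Real.pi)).tendsto _).comp (tendsto_levelParam_atBot (k * Real.pi))
  rw [levelPoint_neg_sqrt (natCast_mul_pi_pos hk)] at h
  exact h.congr fun x => (spineLine_of_ne hk x).symm

theorem disjoint_range_spineLine {j k : ℕ} (hj : j ≠ 0) (hk : k ≠ 0) (hjk : j ≠ k) (x y : ℝ) :
    spineLine j x ≠ spineLine k y := fun h => by
  have h1 := foldAngle_spineLine hj x
  rw [h, foldAngle_spineLine hk y] at h1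
  have := mul_right_cancel₀ Real.pi_ne_zero h1
  exact hjk (by exact_mod_cast this.symm)

/-- On the axis the fold angle is `t`, so the level `kπ` is met only at `-kπ`. -/
theorem spineLine_zero_eq_iff {k : ℕ} (hk : k ≠ 0) {x : ℝ} :
    (∃ y, spineLine k y = spineLine 0 x) ↔ spineLine 0 x = ((-(k * Real.pi) : ℝ) : ℂ) := by
  constructor
  · rintro ⟨y, hy⟩
    have h1 := foldAngle_spineLine hk y
    rw [hy, spineLine_zero] at h1
    simp only [neg_neg] at h1
    rw [foldAngle_zero_right (Real.exp_pos x)] at h1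
    rw [spineLine_zero, h1]
    rfl
  · intro h
    have hre := congrArg Complex.re h
    rw [spineLine_zero, Complex.ofReal_re] at hre
    simp only at hre
    obtain ⟨q, hq, hqz⟩ := exists_levelPoint (s := k * Real.pi) (z := spineLine 0 x)
      (spineLine_re_neg 0 x) (by
        rw [spineLine_zero]
        simp only [neg_neg]
        rw [foldAngle_zero_right (Real.exp_pos x)]
        linarith)
    obtain ⟨y, hy⟩ := exists_levelParam_eq (natCast_mul_pi_pos hk) hq
    exact ⟨y, by rw [spineLine_of_ne hk, hy, hqz]⟩

/-! ### The spliced map is a cos-spine -/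

theorem coe_mem_extendedReals_iff {w : ℂ} : (w : OnePoint ℂ) ∈ extendedReals ↔ w.im = 0 := by
  constructor
  · rintro (h | ⟨x, hx⟩)
    · exact absurd h (OnePoint.coe_ne_infty w)
    · rw [← OnePoint.coe_injective hx]
      exact Complex.ofReal_im x
  · intro h
    refine Or.inr ⟨w.re, congrArg _ ?_⟩
    apply Complex.ext
    · simp
    · simp [h]

theorem isClosed_extendedReals : IsClosed extendedReals := by
  have h : extendedRealsᶜ = ((↑) : ℂ → OnePoint ℂ) '' {w : ℂ | w.im ≠ 0} := by
    ext p
    constructor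
    · intro hp
      have hp' : p ≠ OnePoint.infty := fun h => hp (Or.inl h)
      obtain ⟨w, rfl⟩ := OnePoint.ne_infty_iff_exists.1 hp'
      exact ⟨w, fun h => hp (coe_mem_extendedReals_iff.2 h), rfl⟩
    · rintro ⟨w, hw, rfl⟩ h
      exact hw (coe_mem_extendedReals_iff.1 h)
  rw [← isOpen_compl_iff, h]
  refine OnePoint.isOpenEmbedding_coe.isOpenMap _ ?_
  exact isOpen_ne_fun Complex.continuous_im continuous_const

theorem spinePatch_im {r : ℝ} {ζ z : ℂ} (hζ : (Complex.exp ζ).im = 0) :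
    (spinePatch r ζ z).im = (Complex.exp ζ).re * (spineMap (z - ζ)).im := by
  simp [spinePatch, hζ]

theorem exp_re_ne_zero {ζ : ℂ} (hζ : (Complex.exp ζ).im = 0) : (Complex.exp ζ).re ≠ 0 := fun h =>
  Complex.exp_ne_zero ζ (Complex.ext h hζ)

theorem spinePatch_injective_comp {r : ℝ} {ζ : ℂ} {z w : ℂ} :
    spinePatch r ζ z = spinePatch r ζ w ↔ spineMap (z - ζ) = spineMap (w - ζ) := by
  simp [spinePatch, Complex.exp_ne_zero]

theorem map_sub_nhds (z ζ : ℂ) : map (fun w => w - ζ) (𝓝 z) = 𝓝 (z - ζ) :=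
  (Homeomorph.subRight ζ).map_nhds_eq z

theorem nhds_le_map_spinePatch {r : ℝ} {ζ z : ℂ} (hz : z.re < ζ.re) :
    𝓝 (spinePatch r ζ z) ≤ map (spinePatch r ζ) (𝓝 z) := by
  have h1 : map (fun w => (r : ℂ) + Complex.exp ζ * w) (𝓝 (spineMap (z - ζ)))
      = 𝓝 (spinePatch r ζ z) :=
    ((Homeomorph.mulLeft₀ _ (Complex.exp_ne_zero ζ)).trans (Homeomorph.addLeft (r : ℂ))).map_nhds_eq _
  have h2 : spinePatch r ζ
      = (fun w => (r : ℂ) + Complex.exp ζ * w) ∘ spineMap ∘ (fun w => w - ζ) := rfl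
  rw [← h1, h2, ← Filter.map_map, ← Filter.map_map, map_sub_nhds]
  exact map_mono (nhds_le_map_spineMap (sub_re_neg hz))

/-! ### Cellularity and the net of the spliced map -/

section SpliceSpine

variable {X : Type*} [TopologicalSpace X] {ψ : X → OnePoint ℂ} {φ : OpenPartialHomeomorph X ℂ}
  {r : ℝ} {ζ : ℂ}

theorem spliceSpine_eventuallyEq {x : X} (hx : x ∈ φ.source) : spliceSpine ψ φ r ζ =ᶠ[𝓝 x]
    ((↑) : ℂ → OnePoint ℂ) ∘ spinePatch r ζ ∘ φ := by
  filter_upwards [φ.open_source.mem_nhds hx] with y hy using spliceSpine_of_mem hy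

theorem IsStaircaseChart.nhds_le_map_splice (h : IsStaircaseChart ψ φ r ζ.re) {x : X}
    (hx : x ∈ φ.source) :
    𝓝 (spliceSpine ψ φ r ζ x) ≤ map (spliceSpine ψ φ r ζ) (𝓝 x) := by
  rw [Filter.map_congr (spliceSpine_eventuallyEq hx), ← Filter.map_map, ← Filter.map_map,
    φ.map_nhds_eq hx, spliceSpine_of_mem hx, ← OnePoint.isOpenEmbedding_coe.map_nhds_eq]
  exact map_mono (nhds_le_map_spinePatch (h.re_lt hx))

theorem spliceSpine_mem_extendedReals_iff (hζ : (Complex.exp ζ).im = 0) {x : X}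
    (hx : x ∈ φ.source) :
    spliceSpine ψ φ r ζ x ∈ extendedReals ↔ (spineMap (φ x - ζ)).im = 0 := by
  rw [spliceSpine_of_mem hx, coe_mem_extendedReals_iff, spinePatch_im hζ, mul_eq_zero]
  exact or_iff_right (exp_re_ne_zero hζ)

theorem spliceSpine_eq_iff {x y : X} (hx : x ∈ φ.source) (hy : y ∈ φ.source) :
    spliceSpine ψ φ r ζ x = spliceSpine ψ φ r ζ y ↔
      spineMap (φ x - ζ) = spineMap (φ y - ζ) := by
  rw [spliceSpine_of_mem hx, spliceSpine_of_mem hy, OnePoint.coe_eq_coe, spinePatch_injective_comp]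

theorem tendsto_chart_sub {x : X} (hx : x ∈ φ.source) :
    Tendsto (fun y => φ y - ζ) (𝓝 x) (𝓝 (φ x - ζ)) :=
  (φ.continuousAt hx).sub continuousAt_const

theorem IsStaircaseChart.critical_splice (h : IsStaircaseChart ψ φ r ζ.re)
    (hζ : (Complex.exp ζ).im = 0) {x : X} (hx : x ∈ φ.source)
    (hc : IsCriticalPt (spliceSpine ψ φ r ζ) x) : spliceSpine ψ φ r ζ x ∈ extendedReals := by
  rw [spliceSpine_mem_extendedReals_iff hζ hx]
  refine spineMap_im_eq_zero_of_critical (sub_re_neg (h.re_lt hx)) ?_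
  rintro ⟨U, hU, hinj⟩
  refine hc ⟨_, inter_mem (φ.open_source.mem_nhds hx) (tendsto_chart_sub hx hU), ?_⟩
  rintro y ⟨hy, hyU⟩ y' ⟨hy', hyU'⟩ heq
  rw [spliceSpine_eq_iff hy hy'] at heq
  exact φ.injOn hy hy' (sub_left_injective (hinj hyU hyU' heq))

theorem IsStaircaseChart.discrete_splice (h : IsStaircaseChart ψ φ r ζ.re) (p : OnePoint ℂ) :
    IsDiscrete (φ.source ∩ spliceSpine ψ φ r ζ ⁻¹' {p}) := by
  refine IsDiscrete.of_nhdsWithin ?_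
  rintro x ⟨hx, hxp⟩
  have h1 := eventually_nhdsWithin_iff.1 (spineMap_isolated (sub_re_neg (h.re_lt hx)))
  have h2 := (tendsto_chart_sub (ζ := ζ) hx).eventually h1
  intro S hS
  have hxS : x ∈ S := hS
  filter_upwards [mem_nhdsWithin_of_mem_nhds h2, self_mem_nhdsWithin] with y hy1 hy2
  by_cases hyx : y = x
  · rwa [hyx]
  · refine absurd ?_ (hy1 fun e => hyx (φ.injOn hy2.1 hx (sub_left_injective e)))
    rw [← spliceSpine_eq_iff (ψ := ψ) (r := r) hy2.1 hx]
    exact hy2.2.trans hxp.symm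

/-- The lines of the net of the spliced map. -/
def spliceLine (φ : OpenPartialHomeomorph X ℂ) (ζ : ℂ) (k : ℕ) (x : ℝ) : X :=
  φ.symm (ζ + spineLine k x)

theorem add_spineLine_re_lt (ζ : ℂ) (k : ℕ) (x : ℝ) : (ζ + spineLine k x).re < ζ.re := by
  rw [Complex.add_re]; linarith [spineLine_re_neg k x]

theorem IsStaircaseChart.spliceLine_mem (h : IsStaircaseChart ψ φ r ζ.re) (k : ℕ) (x : ℝ) :
    spliceLine φ ζ k x ∈ φ.source := h.symm_mem (add_spineLine_re_lt ζ k x)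

theorem IsStaircaseChart.apply_spliceLine (h : IsStaircaseChart ψ φ r ζ.re) (k : ℕ) (x : ℝ) :
    φ (spliceLine φ ζ k x) = ζ + spineLine k x :=
  φ.right_inv (h.mem_target (add_spineLine_re_lt ζ k x))

theorem IsStaircaseChart.spliceLine_eq_iff (h : IsStaircaseChart ψ φ r ζ.re) {j k : ℕ} {x y : ℝ} :
    spliceLine φ ζ j x = spliceLine φ ζ k y ↔ spineLine j x = spineLine k y := by
  refine ⟨fun e => ?_, fun e => by rw [spliceLine, e, spliceLine]⟩
  have := congrArg φ e
  rw [h.apply_spliceLine, h.apply_spliceLine] at this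
  exact add_left_cancel this

theorem IsStaircaseChart.continuous_spliceLine (h : IsStaircaseChart ψ φ r ζ.re) (k : ℕ) :
    Continuous (spliceLine φ ζ k) :=
  φ.continuousOn_symm.comp_continuous (continuous_const.add (continuous_spineLine k))
    fun x => h.mem_target (add_spineLine_re_lt ζ k x)

theorem IsStaircaseChart.simplyConnectedSpace (h : IsStaircaseChart ψ φ r ζ.re) :
    SimplyConnectedSpace φ.source := by
  have : ContractibleSpace φ.target := by
    rw [h.target_eq]
    exact (convex_re_lt ζ.re).contractibleSpace ⟨ζ - 1, by simp⟩
  have := φ.toHomeomorphSourceTarget.contractibleSpace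
  infer_instance

theorem IsStaircaseChart.net_splice (h : IsStaircaseChart ψ φ r ζ.re)
    (hζ : (Complex.exp ζ).im = 0) :
    φ.source ∩ spliceSpine ψ φ r ζ ⁻¹' extendedReals = ⋃ k, range (spliceLine φ ζ k) := by
  ext x
  rw [mem_iUnion]
  constructor
  · rintro ⟨hx, hxr⟩
    rw [mem_preimage, spliceSpine_mem_extendedReals_iff hζ hx,
      spineMap_im_eq_zero_iff (sub_re_neg (h.re_lt hx))] at hxr
    obtain ⟨k, y, hy⟩ := hxr
    refine ⟨k, y, ?_⟩
    rw [spliceLine, hy, add_sub_cancel, φ.left_inv hx]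
  · rintro ⟨k, y, rfl⟩
    refine ⟨h.spliceLine_mem k y, ?_⟩
    rw [mem_preimage, spliceSpine_mem_extendedReals_iff hζ (h.spliceLine_mem k y),
      h.apply_spliceLine, add_sub_cancel_left, spineMap_im_eq_zero_iff (spineLine_re_neg k y)]
    exact ⟨k, y, rfl⟩

theorem tendsto_add_spineLine {l : Filter ℝ} {k : ℕ} {w : ℂ} (h : Tendsto (spineLine k) l (𝓝 w)) :
    Tendsto (fun x => ζ + spineLine k x) l (𝓝[{z : ℂ | z.re < ζ.re}] (ζ + w)) :=
  tendsto_nhdsWithin_iff.2 ⟨h.const_add ζ, Eventually.of_forall fun x => add_spineLine_re_lt ζ k x⟩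

/-- A path in the staircase over a small disc cannot change sheets. -/
theorem IsStaircaseChart.not_joinedIn (h : IsStaircaseChart ψ φ r ζ.re) {ξ : ℂ} (hξ : ξ.re = ζ.re)
    {x y : X} (hx : (φ x).im < ξ.im + Real.pi) (hy : ξ.im + Real.pi < (φ y).im) :
    ¬ JoinedIn (ψ ⁻¹' (((↑) : ℂ → OnePoint ℂ) ''
      Metric.ball ((r : ℂ) + Complex.exp ξ) (Real.exp ζ.re)) ∩ φ.source) x y := by
  rintro ⟨p, hp⟩
  have hc : Continuous fun t => (φ (p t)).im := Complex.continuous_im.comp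
    (φ.continuousOn.comp_continuous p.continuous fun t => (hp t).2)
  have hmem : ξ.im + Real.pi ∈ range fun t => (φ (p t)).im := by
    refine mem_range_of_exists_le_of_exists_ge hc ⟨0, ?_⟩ ⟨1, ?_⟩
    · rw [p.source]; exact hx.le
    · rw [p.target]; exact hy.le
  obtain ⟨t, ht⟩ := hmem
  simp only at ht
  obtain ⟨⟨u, hu, hut⟩, htY⟩ := hp t
  rw [h.apply_eq _ htY] at hut
  rw [OnePoint.coe_injective hut, mem_ball_iff_norm, add_sub_add_left_eq_sub] at hu
  -- On the horizontal line at height `Im ξ + π` the exponential is a negative multiple of `e^ξ`, so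
  -- its distance from `e^ξ` exceeds `|e^ξ| = e^c`, the radius of the disc.
  have e1 : Complex.exp (φ (p t)) = -(Real.exp ((φ (p t)).re - ζ.re) : ℂ) * Complex.exp ξ := by
    have : φ (p t) = (((φ (p t)).re - ζ.re : ℝ) : ℂ) + ξ + Real.pi * Complex.I := by
      apply Complex.ext
      · simp [hξ]
      · simp [ht]
    conv_lhs => rw [this]
    rw [Complex.exp_add, Complex.exp_add, Complex.exp_pi_mul_I, Complex.ofReal_exp]
    ring
  have e2 : Complex.exp (φ (p t)) - Complex.exp ξ
      = -((Real.exp ((φ (p t)).re - ζ.re) + 1 : ℝ) : ℂ) * Complex.exp ξ := by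
    rw [e1]; push_cast; ring
  rw [e2, norm_mul, norm_neg, Complex.norm_real, Complex.norm_exp, hξ,
    Real.norm_of_nonneg (by positivity)] at hu
  nlinarith [Real.exp_pos ζ.re, Real.exp_pos ((φ (p t)).re - ζ.re),
    mul_pos (Real.exp_pos ζ.re) (Real.exp_pos ((φ (p t)).re - ζ.re))]

variable [T2Space X] [LocallyCompactSpace X]

/-- If the limit were not in the extended real line, the curve would eventually avoid the net, so
`sin τ ≠ 0` on it and `τ` would stay below some `nπ`. As `t ≤ τ` and `|y| ≤ τ`, the coordinate would
be bounded, which is impossible on a curve tending to infinity in `X`. -/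
theorem IsStaircaseChart.asymptotic_splice (h : IsStaircaseChart ψ φ r ζ.re)
    (hasym : ∀ p, IsAsymptoticValueIn ψ φ.source p → p = ((r : ℂ) : OnePoint ℂ))
    (hψ : IsSurfaceSpread ψ) (hζ : (Complex.exp ζ).im = 0) {p : OnePoint ℂ}
    (hp : IsAsymptoticValueIn (spliceSpine ψ φ r ζ) φ.source p) : p ∈ extendedReals := by
  by_contra hpe
  obtain ⟨γ, hγc, hγY, hγco, hγp⟩ := hp
  have hev := hγp.eventually (isClosed_extendedReals.isOpen_compl.mem_nhds hpe)
  obtain ⟨T, hT⟩ := eventually_atTop.1 hev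
  set T₀ : ℝ := max T 0 with hT₀
  set u : ℝ → ℂ := fun t => φ (γ t) - ζ with hu
  have huc : ContinuousOn u (Ici 0) :=
    (φ.continuousOn.comp hγc fun t ht => hγY t ht).sub continuousOn_const
  have hun : ∀ t, 0 ≤ t → (u t).re < 0 := fun t ht => sub_re_neg (h.re_lt (hγY t ht))
  set τ : ℝ → ℝ := fun t => foldAngle (-(u t).re) (u t).im with hτ
  have hτc : ContinuousOn τ (Ici 0) :=
    continuous_foldAngle.comp_continuousOn
      ((Complex.continuous_re.comp_continuousOn huc).neg.prodMk
        (Complex.continuous_im.comp_continuousOn huc))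
  have hsin : ∀ t, T₀ ≤ t → Real.sin (τ t) ≠ 0 := fun t ht hs => by
    have ht0 : 0 ≤ t := (le_max_right _ _).trans ht
    refine hT t ((le_max_left _ _).trans ht) ?_
    rw [spliceSpine_mem_extendedReals_iff hζ (hγY t ht0)]
    exact (spineIm_eq_zero_iff (by linarith [hun t ht0]) _).2 (Or.inr hs)
  obtain ⟨n, hn⟩ := exists_nat_gt (τ T₀ / Real.pi)
  rw [div_lt_iff₀ Real.pi_pos] at hn
  have hlt : ∀ t, T₀ ≤ t → τ t < n * Real.pi := fun t ht => by
    by_contra hle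
    obtain ⟨s, hs, hsn⟩ := intermediate_value_Icc ht
      (hτc.mono fun s hs => (le_max_right T 0).trans hs.1) ⟨hn.le, not_lt.1 hle⟩
    exact hsin s hs.1 (by rw [hsn, Real.sin_nat_mul_pi])
  refine h.not_eventually_bounded hasym hψ ?_ hγco (2 * (n * Real.pi) + ‖ζ‖) ?_
  · filter_upwards [eventually_ge_atTop 0] with t ht using hγY t ht
  · filter_upwards [eventually_ge_atTop T₀] with t ht
    have ht0 : 0 ≤ t := (le_max_right _ _).trans ht
    have h1 := le_foldAngle (-(u t).re) (u t).im
    have h2 := abs_le_foldAngle (-(u t).re) (u t).im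
    have h3 := hlt t ht
    have h4 := Complex.norm_le_abs_re_add_abs_im (u t)
    rw [abs_of_neg (hun t ht0)] at h4
    have h5 : φ (γ t) = u t + ζ := by rw [hu]; ring
    rw [h5]
    refine (norm_add_le _ _).trans ?_
    simp only [hτ] at h3
    linarith

theorem IsStaircaseChart.isCellularOn_splice (h : IsStaircaseChart ψ φ r ζ.re)
    (hasym : ∀ p, IsAsymptoticValueIn ψ φ.source p → p = ((r : ℂ) : OnePoint ℂ))
    (hψ : IsSurfaceSpread ψ) (hs : Continuous (spliceSpine ψ φ r ζ))
    (hζ : (Complex.exp ζ).im = 0) : IsCellularOn (spliceSpine ψ φ r ζ) φ.source where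
  continuousOn := hs.continuousOn
  isOpenMap U hUY hU := by
    rw [isOpen_iff_mem_nhds]
    rintro _ ⟨x, hx, rfl⟩
    exact h.nhds_le_map_splice (hUY hx) (image_mem_map (hU.mem_nhds hx))
  discrete := h.discrete_splice
  critical _ hx hc := h.critical_splice hζ hx hc
  asymptotic _ hp := h.asymptotic_splice hasym hψ hζ hp

theorem IsStaircaseChart.isCosSpine_splice (h : IsStaircaseChart ψ φ r ζ.re)
    (hasym : ∀ p, IsAsymptoticValueIn ψ φ.source p → p = ((r : ℂ) : OnePoint ℂ))
    (hψ : IsSurfaceSpread ψ) (hs : Continuous (spliceSpine ψ φ r ζ))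
    (hζ : (Complex.exp ζ).im = 0) :
    IsCosSpine (spliceSpine ψ φ r ζ) φ.source (spliceLine φ ζ) where
  isOpen := φ.open_source
  simplyConnected := h.simplyConnectedSpace
  cellular := h.isCellularOn_splice hasym hψ hs hζ
  continuous := h.continuous_spliceLine
  injective k x y e := spineLine_injective k (h.spliceLine_eq_iff.1 e)
  net := h.net_splice hζ
  axis := by
    refine ⟨?_, h.tendsto_cocompact hψ (Eventually.of_forall fun x => h.spliceLine_mem 0 x) ?_⟩
    · obtain ⟨p, hp, hlim⟩ := h.exists_tendsto_symm hasym hψ rfl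
      refine ⟨p, hp, hlim.comp ?_⟩
      simpa using tendsto_add_spineLine (ζ := ζ) tendsto_spineLine_zero_atBot
    · refine tendsto_atTop_mono (fun x => ?_)
        (tendsto_atTop_add_const_right _ (-‖ζ‖) tendsto_norm_spineLine_zero_atTop)
      rw [h.apply_spliceLine]
      have := norm_sub_le (ζ + spineLine 0 x) ζ
      rw [add_sub_cancel_left] at this
      linarith
  endpoints k hk := by
    set ξ : ℂ := ζ + -(((k * Real.pi : ℝ) : ℂ) * Complex.I) with hξ
    have hξre : ξ.re = ζ.re := by simp [hξ]
    have hξim : ξ.im = ζ.im - k * Real.pi := by simp [hξ]; ring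
    have hk1 : (1 : ℝ) ≤ k := by exact_mod_cast Nat.one_le_iff_ne_zero.2 hk
    have hpi := Real.pi_pos
    obtain ⟨p, hp, hlimp⟩ := h.exists_tendsto_symm hasym hψ hξre
    obtain ⟨q, hq, hlimq⟩ := h.exists_tendsto_symm hasym hψ
      (ζ := ζ + ((k * Real.pi : ℝ) : ℂ) * Complex.I) (by simp)
    refine ⟨p, hp, q, hq, hlimp.comp (tendsto_add_spineLine (tendsto_spineLine_atBot hk)),
      hlimq.comp (tendsto_add_spineLine (tendsto_spineLine_atTop hk)), fun _ => ?_⟩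
    have hψp : ψ p = (((r : ℂ) + Complex.exp ξ : ℂ) : OnePoint ℂ) := by
      have hne : NeBot (𝓝[{z : ℂ | z.re < ζ.re}] ξ) := by
        have := tendsto_add_spineLine (ζ := ζ) (tendsto_spineLine_atBot hk)
        exact this.neBot
      refine tendsto_nhds_unique ((hψ.continuous.tendsto p).comp hlimp) ?_
      have h1 : Tendsto (fun z : ℂ => (((r : ℂ) + Complex.exp z : ℂ) : OnePoint ℂ))
          (𝓝[{z : ℂ | z.re < ζ.re}] ξ) (𝓝 (((r : ℂ) + Complex.exp ξ : ℂ) : OnePoint ℂ)) :=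
        ((OnePoint.continuous_coe.comp (continuous_const.add Complex.continuous_exp)).tendsto
          ξ).mono_left nhdsWithin_le_nhds
      refine h1.congr' ?_
      filter_upwards [self_mem_nhdsWithin] with z hz using (h.apply_symm hz).symm
    -- The coordinates of the two ends differ by `2kπi`, so both ends lie over the same value and
    -- may be one point of `X`. They are on different sides of the line at height `Im ξ + π`, which
    -- no path over this disc can cross.
    refine ⟨ψ ⁻¹' (((↑) : ℂ → OnePoint ℂ) ''
      Metric.ball ((r : ℂ) + Complex.exp ξ) (Real.exp ζ.re)), ?_, ?_⟩
    · refine hψ.continuous.continuousAt ?_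
      rw [hψp]
      exact (OnePoint.isOpenEmbedding_coe.isOpenMap _ Metric.isOpen_ball).mem_nhds
        (mem_image_of_mem _ (Metric.mem_ball_self (Real.exp_pos _)))
    · have h1 := (Complex.continuous_im.tendsto _).comp (tendsto_spineLine_atBot hk)
      have h2 := (Complex.continuous_im.tendsto _).comp (tendsto_spineLine_atTop hk)
      have ev1 : ∀ᶠ s in atBot, (spineLine k s).im < -(k * Real.pi) + Real.pi :=
        h1.eventually (gt_mem_nhds (by simp [hpi]))
      have ev2 : ∀ᶠ t in atTop, -(k * Real.pi) + Real.pi < (spineLine k t).im :=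
        h2.eventually (lt_mem_nhds (by simp; nlinarith))
      filter_upwards [ev1] with s hs1
      filter_upwards [ev2] with t ht1
      refine h.not_joinedIn hξre ?_ ?_
      · rw [hξim, h.apply_spliceLine, Complex.add_im]; linarith
      · rw [hξim, h.apply_spliceLine, Complex.add_im]; linarith
  axis_inter k hk := by
    refine ⟨spliceLine φ ζ 0 (Real.log (k * Real.pi)), ?_⟩
    have hv : ∀ x, spineLine 0 x = ((-(k * Real.pi) : ℝ) : ℂ) ↔ x = Real.log (k * Real.pi) := by
      intro x
      rw [spineLine_zero]
      constructor
      · intro e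
        have : -Real.exp x = -(k * Real.pi) := congrArg Complex.re e
        rw [← neg_injective this, Real.log_exp]
      · rintro rfl
        rw [Real.exp_log (natCast_mul_pi_pos hk)]
        rfl
    ext z
    constructor
    · rintro ⟨⟨x, rfl⟩, ⟨y, hy⟩⟩
      have := (spineLine_zero_eq_iff hk).1 ⟨y, h.spliceLine_eq_iff.1 hy⟩
      rw [(hv x).1 this]
      rfl
    · rintro rfl
      obtain ⟨y, hy⟩ := (spineLine_zero_eq_iff hk).2 ((hv _).2 rfl)
      exact ⟨⟨_, rfl⟩, ⟨y, h.spliceLine_eq_iff.2 hy⟩⟩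
  disjoint j k hj hk hjk := by
    rw [Set.disjoint_left]
    rintro _ ⟨x, rfl⟩ ⟨y, hy⟩
    exact disjoint_range_spineLine hk hj hjk.symm y x (h.spliceLine_eq_iff.1 hy)

end SpliceSpine

/-! ### The inversion of the sphere -/

theorem sphereInv_infty : sphereInv OnePoint.infty = ((0 : ℂ) : OnePoint ℂ) := if_pos rfl

theorem sphereInv_zero : sphereInv ((0 : ℂ) : OnePoint ℂ) = OnePoint.infty := by
  rw [sphereInv, if_neg (OnePoint.coe_ne_infty _), if_pos rfl]

theorem sphereInv_coe {w : ℂ} (hw : w ≠ 0) :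
    sphereInv (w : OnePoint ℂ) = ((w⁻¹ : ℂ) : OnePoint ℂ) := by
  rw [sphereInv, if_neg (OnePoint.coe_ne_infty _), if_neg fun h => hw (OnePoint.coe_injective h)]
  rfl

theorem sphereInv_involutive : Function.Involutive sphereInv := by
  intro p
  induction p using OnePoint.rec with
  | infty => rw [sphereInv_infty, sphereInv_zero]
  | coe w =>
    by_cases hw : w = 0
    · rw [hw, sphereInv_zero, sphereInv_infty]
    · rw [sphereInv_coe hw, sphereInv_coe (inv_ne_zero hw), inv_inv]

theorem continuous_sphereInv : Continuous sphereInv := by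
  have hcob : Tendsto ((↑) : ℂ → OnePoint ℂ) (Bornology.cobounded ℂ) (𝓝 OnePoint.infty) := by
    rw [Metric.cobounded_eq_cocompact, ← Filter.coclosedCompact_eq_cocompact]
    exact OnePoint.tendsto_coe_infty
  rw [continuous_iff_continuousAt]
  intro p
  induction p using OnePoint.rec with
  | infty =>
    rw [ContinuousAt, OnePoint.nhds_infty_eq, sphereInv_infty, tendsto_sup]
    refine ⟨?_, ?_⟩
    · rw [tendsto_map'_iff]
      have h1 : Tendsto (fun w : ℂ => ((w⁻¹ : ℂ) : OnePoint ℂ)) (Bornology.cobounded ℂ)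
          (𝓝 ((0 : ℂ) : OnePoint ℂ)) :=
        (OnePoint.continuous_coe.tendsto 0).comp tendsto_inv₀_cobounded
      rw [Filter.coclosedCompact_eq_cocompact, ← Metric.cobounded_eq_cocompact]
      refine h1.congr' ?_
      filter_upwards [Bornology.eventually_ne_cobounded (0 : ℂ)] with w hw using (sphereInv_coe hw).symm
    · rw [tendsto_pure_left]
      intro S hS
      rw [sphereInv_infty]
      exact mem_of_mem_nhds hS
  | coe w =>
    rw [ContinuousAt, OnePoint.nhds_coe_eq, tendsto_map'_iff]
    by_cases hw : w = 0
    · subst hw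
      rw [sphereInv_zero, ← nhdsNE_sup_pure, tendsto_sup]
      refine ⟨?_, ?_⟩
      · refine (hcob.comp tendsto_inv₀_nhdsNE_zero).congr' ?_
        filter_upwards [self_mem_nhdsWithin] with w hw using (sphereInv_coe hw).symm
      · rw [tendsto_pure_left]
        intro S hS
        rw [Function.comp_apply, sphereInv_zero]
        exact mem_of_mem_nhds hS
    · rw [sphereInv_coe hw]
      refine ((OnePoint.continuous_coe.tendsto _).comp (tendsto_inv₀ hw)).congr' ?_
      filter_upwards [eventually_ne_nhds hw] with v hv using (sphereInv_coe hv).symm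

/-- The inversion as a homeomorphism. -/
def sphereInvHomeomorph : OnePoint ℂ ≃ₜ OnePoint ℂ where
  toEquiv := sphereInv_involutive.toPerm
  continuous_toFun := continuous_sphereInv
  continuous_invFun := continuous_sphereInv

theorem sphereInv_mem_extendedReals {p : OnePoint ℂ} (hp : p ∈ extendedReals) :
    sphereInv p ∈ extendedReals := by
  induction p using OnePoint.rec with
  | infty => rw [sphereInv_infty, coe_mem_extendedReals_iff]; rfl
  | coe w =>
    rw [coe_mem_extendedReals_iff] at hp
    by_cases hw : w = 0
    · rw [hw, sphereInv_zero]
      exact Or.inl rfl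
    · rw [sphereInv_coe hw, coe_mem_extendedReals_iff, Complex.inv_im, hp, neg_zero, zero_div]

theorem sphereInv_mem_extendedReals_iff {p : OnePoint ℂ} :
    sphereInv p ∈ extendedReals ↔ p ∈ extendedReals :=
  ⟨fun h => by rw [← sphereInv_involutive p]; exact sphereInv_mem_extendedReals h,
    sphereInv_mem_extendedReals⟩

theorem sphereInv_eq_iff {p q : OnePoint ℂ} : sphereInv p = q ↔ p = sphereInv q :=
  sphereInv_involutive.eq_iff

theorem sphereInv_ne_infty_iff {p : OnePoint ℂ} :
    sphereInv p ≠ OnePoint.infty ↔ p ≠ ((0 : ℂ) : OnePoint ℂ) := by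
  rw [Ne, sphereInv_eq_iff, sphereInv_infty]

theorem sphereInv_ne_zero_iff {p : OnePoint ℂ} :
    sphereInv p ≠ ((0 : ℂ) : OnePoint ℂ) ↔ p ≠ OnePoint.infty := by
  rw [Ne, sphereInv_eq_iff, sphereInv_zero]

theorem preimage_sphereInv_comp {X : Type*} (f : X → OnePoint ℂ) (p : OnePoint ℂ) :
    (fun x => sphereInv (f x)) ⁻¹' {p} = f ⁻¹' {sphereInv p} := by
  ext x
  simp [sphereInv_eq_iff]

section Inversion

variable {X : Type*} [TopologicalSpace X] {ψ f : X → OnePoint ℂ} {Y : Set X}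

theorem IsSurfaceSpread.sphereInv (hψ : IsSurfaceSpread ψ) :
    IsSurfaceSpread fun x => sphereInv (ψ x) where
  continuous := continuous_sphereInv.comp hψ.continuous
  isOpenMap := sphereInvHomeomorph.isOpenMap.comp hψ.isOpenMap
  discrete p := by
    rw [preimage_sphereInv_comp]
    exact hψ.discrete _

theorem IsHolomorphicToSphere.sphereInv {g : ℂ → OnePoint ℂ} {U : Set ℂ}
    (hg : IsHolomorphicToSphere g U) : IsHolomorphicToSphere (fun z => sphereInv (g z)) U where
  continuousOn := continuous_sphereInv.comp_continuousOn hg.continuousOn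
  affine := by
    simp only [sphereInv_ne_infty_iff]
    exact hg.atInfty
  atInfty := by
    simp only [sphereInv_ne_zero_iff, sphereInv_involutive _]
    exact hg.affine

theorem IsQuasiregularMap.sphereInv {K : ℝ} (hf : IsQuasiregularMap K (fun x => sphereInv (ψ x)) f) :
    IsQuasiregularMap K ψ fun x => sphereInv (f x) := by
  refine ⟨continuous_sphereInv.comp hf.1, fun e he => ?_⟩
  obtain ⟨h1, h2⟩ := hf.2 e (IsHolomorphicToSphere.sphereInv he)
  simp only [sphereInv_ne_infty_iff, sphereInv_ne_zero_iff, sphereInv_involutive _]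
  exact ⟨h2, h1⟩

theorem IsAsymptoticValueIn.sphereInv {p : OnePoint ℂ} (h : IsAsymptoticValueIn f Y p) :
    IsAsymptoticValueIn (fun x => sphereInv (f x)) Y (sphereInv p) := by
  obtain ⟨γ, h1, h2, h3, h4⟩ := h
  exact ⟨γ, h1, h2, h3, (continuous_sphereInv.tendsto p).comp h4⟩

theorem isAsymptoticValueIn_sphereInv_iff {p : OnePoint ℂ} :
    IsAsymptoticValueIn (fun x => sphereInv (f x)) Y p ↔ IsAsymptoticValueIn f Y (sphereInv p) := by
  constructor
  · intro h
    simpa only [sphereInv_involutive _] using h.sphereInv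
  · intro h
    simpa only [sphereInv_involutive _] using h.sphereInv

theorem IsCellularOn.sphereInv (hf : IsCellularOn f Y) :
    IsCellularOn (fun x => sphereInv (f x)) Y where
  continuousOn := continuous_sphereInv.comp_continuousOn hf.continuousOn
  isOpenMap U hUY hU := by
    have h : (fun x => _root_.sphereInv (f x)) '' U = _root_.sphereInv '' (f '' U) :=
      (image_image _ _ _).symm
    rw [h]
    exact sphereInvHomeomorph.isOpenMap _ (hf.isOpenMap U hUY hU)
  discrete p := by
    rw [preimage_sphereInv_comp]
    exact hf.discrete _
  critical x hx hc := by
    refine sphereInv_mem_extendedReals (hf.critical x hx ?_)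
    rintro ⟨U, hU, hinj⟩
    exact hc ⟨U, hU, sphereInv_involutive.injective.comp_injOn hinj⟩
  asymptotic p hp :=
    sphereInv_mem_extendedReals_iff.1 (hf.asymptotic _ (isAsymptoticValueIn_sphereInv_iff.1 hp))

theorem IsCosSpine.sphereInv {l : ℕ → ℝ → X} (hf : IsCosSpine f Y l) :
    IsCosSpine (fun x => sphereInv (f x)) Y l :=
  { hf with
    cellular := hf.cellular.sphereInv
    net := by
      rw [← hf.net]
      ext x
      exact and_congr_right fun _ => sphereInv_mem_extendedReals_iff }

end Inversion

/-- A staircase over a real number can be turned into a cos-spine by a quasiregular modification. -/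
theorem IsLogStaircaseOverReal.exists_isCosSpine {X : Type*} [TopologicalSpace X] [T2Space X]
    [LocallyCompactSpace X] {ψ : X → OnePoint ℂ} {Y : Set X} {r : ℝ} {z₀ : X}
    (hY : IsLogStaircaseOverReal ψ Y r) (hψ : IsSurfaceSpread ψ)
    (hasym : ∀ p, IsAsymptoticValueIn ψ Y p → p = ((r : ℂ) : OnePoint ℂ))
    (hz₀ : z₀ ∈ frontier Y) (hreal : ψ z₀ ∈ extendedReals) :
    ∃ ψ' : X → OnePoint ℂ, IsQuasiregularMap 1216 ψ ψ' ∧ (∀ x ∉ Y, ψ' x = ψ x) ∧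
      (∀ x ∈ Y, ψ' x ≠ OnePoint.infty) ∧
      ∃ l : ℕ → ℝ → X, IsCosSpine ψ' Y l ∧ Tendsto (l 0) atBot (𝓝 z₀) := by
  obtain ⟨c, φ, rfl, htarget, hφ⟩ := hY
  have h : IsStaircaseChart ψ φ r c := ⟨htarget, hφ⟩
  obtain ⟨ζ, rfl, hlim, hζ⟩ := h.exists_tendsto_of_mem_frontier hasym hψ hz₀
  -- The boundary point corresponding to `z₀` is the corner of the model, and `e^ζ = ψ z₀ - r` is
  -- real. This aligns the net with the real axis and makes `z₀` the endpoint of the line `l 0`.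
  have him : (Complex.exp ζ).im = 0 := by
    rw [hζ, coe_mem_extendedReals_iff] at hreal
    simpa using hreal
  have hfr : ∀ x ∈ frontier φ.source, ∃ w : ℂ, w.re = ζ.re ∧
      ψ x = (((r : ℂ) + Complex.exp w : ℂ) : OnePoint ℂ) := fun x hx => by
    obtain ⟨w, hw, -, hψw⟩ := h.exists_tendsto_of_mem_frontier hasym hψ hx
    exact ⟨w, hw, hψw⟩
  refine ⟨spliceSpine ψ φ r ζ, h.isQuasiregularMap_splice hψ hfr,
    fun x hx => spliceSpine_of_notMem hx, fun x hx => ?_, spliceLine φ ζ,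
    h.isCosSpine_splice hasym hψ (h.continuous_splice hψ.continuous hfr) him, ?_⟩
  · rw [spliceSpine_of_mem hx]
    exact OnePoint.coe_ne_infty _
  · refine hlim.comp ?_
    simpa using tendsto_add_spineLine (ζ := ζ) tendsto_spineLine_zero_atBot

end

theorem theorem2 :
    ∃ K : ℝ, 1 < K ∧
      ∀ (X : Type*) [TopologicalSpace X] [T2Space X] [ChartedSpace ℂ X]
        (ψ : X → OnePoint ℂ) (Y : Set X) (a : OnePoint ℂ) (z₀ : X),
        IsSurfaceSpread ψ →
        IsLogStaircase ψ Y a →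
        -- inside `X`, the staircase is bordered by its whole boundary line
        (∀ p, IsAsymptoticValueIn ψ Y p → p = a) →
        z₀ ∈ frontier Y →
        (∃ x : ℝ, ψ z₀ = ((x : ℂ) : OnePoint ℂ)) →
        ∃ ψ' : X → OnePoint ℂ,
          IsQuasiregularMap K ψ ψ' ∧
          (∀ x ∉ Y, ψ' x = ψ x) ∧
          (a ≠ OnePoint.infty → ∀ x ∈ Y, ψ' x ≠ OnePoint.infty) ∧
          ∃ l : ℕ → ℝ → X, IsCosSpine ψ' Y l ∧ Tendsto (l 0) atBot (𝓝 z₀) := by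
  refine ⟨1216, by norm_num, ?_⟩
  intro X _ _ _ ψ Y a z₀ hψ hY hasym hz₀ hreal
  have : LocallyCompactSpace X := ChartedSpace.locallyCompactSpace ℂ X
  have hreal' : ψ z₀ ∈ extendedReals := by
    obtain ⟨x, hx⟩ := hreal
    exact Or.inr ⟨x, hx.symm⟩
  rcases hY with ⟨r, rfl, hY⟩ | ⟨rfl, hY⟩
  · obtain ⟨ψ', h1, h2, h3, h4⟩ := hY.exists_isCosSpine hψ hasym hz₀ hreal'
    exact ⟨ψ', h1, h2, fun _ => h3, h4⟩
  -- Over infinity the result over 0 is applied to `1/ψ`, which induces the same complex structure,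
  -- and the new map is inverted. The inversion preserves the extended real line, hence the net, and
  -- the quasiregularity constant.
  · obtain ⟨χ, h1, h2, -, l, h4, h5⟩ := hY.exists_isCosSpine hψ.sphereInv (fun p hp => by
      have := hasym _ (isAsymptoticValueIn_sphereInv_iff.1 hp)
      rw [sphereInv_eq_iff, sphereInv_infty] at this
      rw [this, Complex.ofReal_zero]) hz₀ (sphereInv_mem_extendedReals hreal')
    refine ⟨fun x => sphereInv (χ x), h1.sphereInv, fun x hx => ?_, fun h => absurd rfl h, l,
      h4.sphereInv, h5⟩
    simp only
    rw [h2 x hx, sphereInv_involutive]
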